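/- **Setting.** Fix an integer bucket capacity $b\ge 1$ and $0<\alpha<1$. Given numbers $X_i\ge 0$ of keys with hash address $i\in\mathbb Z$, let $Q_i=\max_{j\le i}\sum_{k=j+1}^{i}(X_k-b)$ be the overflow from bucket $i$ and $H_i=X_i+Q_{i-1}$ the number of keys that try bucket $i$ (this is the minimal solution of $H_i=X_i+Q_{i-1}$, $Q_i=\max(H_i-b,0)$). Bucket $i$ is full if $H_i\ge b$. A block is a maximal sequence of consecutive full buckets ended by a non-full one (a non-full bucket preceded by a non-full bucket is a block of length 1). *Infinite Poisson model:* $(X_i)_{i\in\mathbb Z}$ are i.i.d. $\mathrm{Po}(b\alpha)$. Let $\hat B_\alpha$ be the length of the block containing a given bucket $i\in\mathbb Z$. Let $B_\alpha$ be the length of the first block in the one-sided table with buckets $1,2,\dots$ and key counts $X_1,X_2,\dots$, i.e. $B_\alpha=\min\{i\ge1: H_i<b\}$, where now $Q_0=0$. *Exact model:* $n$ keys get independent uniformly random hash addresses in $\mathbb Z_m$, and the $X_i$ are extended $m$-periodically to $i\in\mathbb Z$; $\hat B_{m,n}$ is the length of the block containing a given bucket $i$ (for $n<bm$; its values for $n\ge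 bm$ are irrelevant). Let $T(z)=\sum_{k\ge1}\frac{k^{k-1}}{k!}z^k$ ($|z|\le e^{-1}$) be the tree function, $\omega=e^{2\pi \mathrm i/b}$, $$T_0(b\alpha)=\frac{b(1-\alpha)}{\prod_{j=1}^{b-1}\bigl(1-T(\omega^j\alpha e^{-\alpha})/\alpha\bigr)},\qquad \zeta_\ell(q)=\frac{T(\omega^\ell\alpha e^{-\alpha}q^{1/b})}{\alpha}\quad(0\le\ell<b),$$ and $R=(e^{\alpha-1}/\alpha)^b$. Write $\psi_B(q)=\mathbb E\,q^{B_\alpha}$ and $\psi_{\hat B}(q)=\mathbb E\,q^{\hat B_\alpha}$. **Theorem.** (1) Almost surely $1\le B_\alpha<\infty$ and $1\le\hat B_\alpha<\infty$; moreover $\mathbb E B_\alpha<\infty$ and $\hat B_\alpha$ has the size-biased distribution $$\mathbb P(\hat B_\alpha=k)=\frac{k\,\mathbb P(B_\alpha=k)}{\mathbb E B_\alpha}=T_0(b\alpha)\,k\,\mathbb P(B_\alpha=k)\qquad (k\ge0).$$ (2) $R>1$, and for all complex $q$ with $|q|<R$ both generating functions converge absolutely, $\psi_B$ is differentiable at $q$,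 and $$\psi_{\hat B}(q)=T_0(b\alpha)\,q\,\psi_B'(q).$$ If moreover $q\ne0$, then for every choice of a function that is continuous at $q$ and is a $b$-th root $q^{1/b}$ in a neighbourhood of $q$, the corresponding functions $\zeta_0,\dots,\zeta_{b-1}$ are differentiable at $q$ and $$\psi_{\hat B}(q)=T_0(b\alpha)\,q\sum_{\ell=0}^{b-1}\zeta_\ell'(q)\prod_{j\ne\ell}\bigl(1-\zeta_j(q)\bigr).$$ (3) There is $\delta>0$ with $1+\delta<R$ such that, whenever $m,n\to\infty$ with $n/(bm)\to\alpha$: $\hat B_{m,n}\to\hat B_\alpha$ in distribution; $\mathbb E\hat B_\alpha^{\,r}<\infty$ and $\mathbb E\hat B_{m,n}^{\,r}\to\mathbb E\hat B_\alpha^{\,r}$ for every integer $r\ge0$; and $\mathbb E\,q^{\hat B_{m,n}}\to\psi_{\hat B}(q)$ uniformly for $|q|\le1+\delta$. -/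

import Mathlib

open MeasureTheory ProbabilityTheory Filter Topology

namespace LinearProbing

/-! ### Hash tables indexed by the integers

Buckets of capacity `b` are indexed by `ℤ`, and `x i` is the number of keys with hash address `i`.
A cyclic table with `m` buckets is the `m`-periodic case. Profile and overflow live in `ℕ∞`, so
that they are defined for every `x`. -/

/-- The overflow `Q i = max_{j ≤ i} ∑_{k = j+1}^{i} (x k - b)`, with `L = i - j`. The truncation of
the differences at `0` is harmless because the term `L = 0` is `0`. -/
noncomputable def overflow (b : ℕ) (x : ℤ → ℕ) (i : ℤ) : ℕ∞ :=
  ⨆ L : ℕ, (((∑ k ∈ Finset.range L, x (i - k)) - b * L : ℕ) : ℕ∞)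

/-- The profile `H i = x i + Q (i - 1)`: the number of keys that try bucket `i`. -/
noncomputable def profile (b : ℕ) (x : ℤ → ℕ) (i : ℤ) : ℕ∞ :=
  (x i : ℕ∞) + overflow b x (i - 1)

/-- The overflow solves the hashing equations `H i = x i + Q (i - 1)`, `Q i = (H i - b)₊`. -/
theorem overflow_eq (b : ℕ) (x : ℤ → ℕ) (i : ℤ) :
    overflow b x i = profile b x i - b := by
  have hsum : ∀ L : ℕ, (∑ k ∈ Finset.range (L + 1), x (i - k))
      = x i + ∑ k ∈ Finset.range L, x (i - 1 - k) := by
    intro L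
    rw [Finset.sum_range_succ', add_comm]
    congr 1
    · simp
    · refine Finset.sum_congr rfl fun k _ => ?_
      congr 1
      push_cast
      ring
  apply le_antisymm
  · refine iSup_le fun L => ?_
    rcases L with _ | L
    · simp
    · have h : ((∑ k ∈ Finset.range L, x (i - 1 - k)) - b * L : ℕ) ≤ overflow b x (i - 1) :=
        le_iSup (fun L : ℕ => (((∑ k ∈ Finset.range L, x (i - 1 - k)) - b * L : ℕ) : ℕ∞)) L
      refine le_trans ?_ (tsub_le_tsub_right (add_le_add_right h (x i : ℕ∞)) _)
      rw [hsum]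
      norm_cast
      have : b * (L + 1) = b * L + b := by ring
      omega
  · rw [tsub_le_iff_right, profile, overflow, ENat.add_iSup]
    refine iSup_le fun L => ?_
    have h0 := le_iSup (fun L : ℕ => (((∑ k ∈ Finset.range L, x (i - k)) - b * L : ℕ) : ℕ∞))
      (0 + 1)
    have h1 := le_iSup (fun L : ℕ => (((∑ k ∈ Finset.range L, x (i - k)) - b * L : ℕ) : ℕ∞))
      (L + 1)
    rw [hsum] at h0 h1
    have : b * (L + 1) = b * L + b := by ring
    by_cases h : (∑ k ∈ Finset.range L, x (i - 1 - k)) ≤ b * L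
    · refine le_trans ?_ (add_le_add_left h0 _)
      norm_cast
      simp only [Finset.sum_range_zero]
      omega
    · refine le_trans ?_ (add_le_add_left h1 _)
      norm_cast
      omega

/-- The overflow is the minimal solution of the hashing equations. -/
theorem overflow_le (b : ℕ) (x : ℤ → ℕ) (Q : ℤ → ℕ∞)
    (hQ : ∀ i, Q i = (x i : ℕ∞) + Q (i - 1) - b) (i : ℤ) : overflow b x i ≤ Q i := by
  refine iSup_le fun L => ?_
  induction L generalizing i with
  | zero => simp
  | succ L ih =>
    rw [hQ i]
    refine le_trans ?_ (tsub_le_tsub_right (add_le_add_right (ih (i - 1)) (x i : ℕ∞)) _)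
    have hsum : (∑ k ∈ Finset.range (L + 1), x (i - k))
        = x i + ∑ k ∈ Finset.range L, x (i - 1 - k) := by
      rw [Finset.sum_range_succ', add_comm]
      congr 1
      · simp
      · refine Finset.sum_congr rfl fun k _ => ?_
        congr 1
        push_cast
        ring
    rw [hsum]
    norm_cast
    have : b * (L + 1) = b * L + b := by ring
    omega

/-- Bucket `i` is full. -/
def IsFull (b : ℕ) (x : ℤ → ℕ) (i : ℤ) : Prop := (b : ℕ∞) ≤ profile b x i

/-- The block (maximal run of full buckets ended by a non-full one) that contains bucket `i`:
buckets `i` and `j` share a block iff all buckets from the left one up to, but not including, the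
right one are full. -/
def block (b : ℕ) (x : ℤ → ℕ) (i : ℤ) : Set ℤ :=
  {j | ∀ k, min i j ≤ k → k < max i j → IsFull b x k}

/-- The length of the block that contains bucket `i` (by convention `0` if infinite). -/
noncomputable def blockLength (b : ℕ) (x : ℤ → ℕ) (i : ℤ) : ℕ := (block b x i).ncard

/-! ### One-sided tables, with buckets `1, 2, 3, …` -/

/-- Overflow in the one-sided table: `Q 0 = 0`, `Q (i+1) = (x (i+1) + Q i - b)₊`. -/
def overflowOneSided (b : ℕ) (x : ℕ → ℕ) : ℕ → ℕ
  | 0 => 0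
  | i + 1 => x (i + 1) + overflowOneSided b x i - b

/-- Profile of the one-sided table: `H i = x i + Q (i - 1)` for `i ≥ 1`. -/
def profileOneSided (b : ℕ) (x : ℕ → ℕ) (i : ℕ) : ℕ :=
  x i + overflowOneSided b x (i - 1)

/-- The length of the first block of the one-sided table, `min {i ≥ 1 : H i < b}`
(by convention `0` if there is no such `i`). -/
noncomputable def firstBlockLength (b : ℕ) (x : ℕ → ℕ) : ℕ :=
  sInf {i | 1 ≤ i ∧ profileOneSided b x i < b}

/-! ### The exact model -/

/-- The exact model: `n` keys, with all `m ^ n` sequences of hash addresses equally likely. -/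
noncomputable abbrev exactModel (m n : ℕ) : Measure (Fin n → Fin m) :=
  uniformOn Set.univ

/-- The number of keys with hash address `i` modulo `m`. -/
def keyCount {m n : ℕ} (h : Fin n → Fin m) (i : ℤ) : ℕ :=
  (Finset.univ.filter fun k => ((h k : ℕ) : ℤ) = i % (m : ℤ)).card

/-! ### The tree function -/

/-- The tree function `T z = ∑_{n ≥ 1} n ^ (n - 1) / n! * z ^ n`, for `|z| ≤ 1 / e`. -/
noncomputable def treeFun (z : ℂ) : ℂ :=
  ∑' n : ℕ, ((n + 1 : ℂ) ^ n / ((n + 1).factorial : ℂ)) * z ^ (n + 1)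

/-- `ζ_ℓ(q) = T(ω ^ ℓ * α * e ^ (-α) * q ^ (1/b)) / α` with `ω = e ^ (2πi/b)`, where the function
`root` is the branch of `q ^ (1/b)` that is used. -/
noncomputable def zeta (b : ℕ) (α : ℝ) (root : ℂ → ℂ) (l : ℕ) (q : ℂ) : ℂ :=
  treeFun (Complex.exp (2 * Real.pi * Complex.I / b) ^ l * (α * Complex.exp (-α)) * root q) / α

/-- `T₀(bα) = b (1 - α) / ∏_{j=1}^{b-1} (1 - T(ω ^ j * α * e ^ (-α)) / α)`. -/
noncomputable def T0 (b : ℕ) (α : ℝ) : ℂ :=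
  b * (1 - α) / ∏ j ∈ Finset.Ico 1 b,
    (1 - treeFun (Complex.exp (2 * Real.pi * Complex.I / b) ^ j * (α * Complex.exp (-α))) / α)

end LinearProbing

open LinearProbing

namespace LinearProbing

/-! ### The walk of a table -/

/-! Blocks are read off the walk `S` with increments `x i - b`. A bucket is non-full exactly when
`S` has a strict record minimum there (`isFull_iff_walk`), so a block runs from just after one
record to the next. If `S` tends to `+∞` on the left and takes arbitrarily low values far to the
right, the block containing `i` has length `k` iff for exactly one `r < k` the bucket `a = i - 1 -
r` is non-full and the table started empty after `a` has a first block of length `k`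
(`blockLength_eq_iff`, `firstBlock_start_unique`).

In the Poisson model the first condition involves only buckets up to `a`, the second only buckets
after `a`. Independence and stationarity give `P(B̂ = k) = p k P(B = k)` with `p` the probability
that a bucket is not full (`measure_blockLength`), and total mass one gives `p E B = 1`. A Chernoff
bound at base `1 / α` yields tails of order `R^(-k)`, hence power series for both generating
functions on `|q| < R`, and `ψ_B̂ = p q ψ_B'`.

The product formula `1 - ψ_B(q) = ∏ (1 - ζ_ℓ(q))` comes from the kernel method (`kernel_zero`,
`one_sub_pgf_eq_prod`). A first block of length `i` ends with `b (i - 1) + r` keys for some `r < b`,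
so its joint generating function in length and number of keys reduces to a polynomial of degree less
than `b` in `z`. Wherever `q e^(bα(z-1)) = z^b` with `0 < |z| ≤ 1 / α`, this polynomial equals
`z^b`. The `ζ_ℓ(q)` are `b` distinct such points, by the functional equation `T e^(-T) = z` of the
tree function; that equation follows from Abel's identity through a differential equation for `T z /
z`. So `z^b` minus the polynomial is `∏ (z - ζ_ℓ)`, to be evaluated at `z = 1`. Differentiating at
`q = 1`, where `ζ_0 = 1`, and using `ψ_B̂(1) = 1` gives `p = T₀(bα)`.

For the exact model, multinomial counts in a fixed window converge to independent Poisson counts.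
Being non-full is not a local event, but ignoring windows longer than `L` costs a geometric error,
eventually uniform in `m, n` (`exactModel_truncation`). Thus the law of the block length converges
pointwise, and a geometric majorant upgrades this to convergence in weighted `ℓ¹`
(`tendsto_tsum_blockLength`), which gives all three modes of convergence at once. -/

/-- The walk with increments `x i - b`, normalized to vanish at `0`. -/
noncomputable def walk (b : ℕ) (x : ℤ → ℕ) (i : ℤ) : ℤ :=
  ∑ k ∈ Finset.Ioc 0 i, ((x k : ℤ) - b) - ∑ k ∈ Finset.Ioc i 0, ((x k : ℤ) - b)

theorem walk_add_one (b : ℕ) (x : ℤ → ℕ) (i : ℤ) :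
    walk b x (i + 1) = walk b x i + (x (i + 1) - b) := by
  unfold walk
  rcases le_or_gt 0 i with h | h
  · have h1 : Finset.Ioc 0 (i + 1) = insert (i + 1) (Finset.Ioc 0 i) := by
      ext k; simp only [Finset.mem_Ioc, Finset.mem_insert]; omega
    have h2 : Finset.Ioc (i + 1) 0 = ∅ := by
      ext k; simp only [Finset.mem_Ioc, Finset.notMem_empty, iff_false]; omega
    have h3 : Finset.Ioc i 0 = ∅ := by
      ext k; simp only [Finset.mem_Ioc, Finset.notMem_empty, iff_false]; omega
    rw [h1, h2, h3, Finset.sum_insert (by simp)]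
    simp only [Finset.sum_empty]; ring
  · have h1 : Finset.Ioc i 0 = insert (i + 1) (Finset.Ioc (i + 1) 0) := by
      ext k; simp only [Finset.mem_Ioc, Finset.mem_insert]; omega
    have h2 : Finset.Ioc 0 (i + 1) = ∅ := by
      ext k; simp only [Finset.mem_Ioc, Finset.notMem_empty, iff_false]; omega
    have h3 : Finset.Ioc 0 i = ∅ := by
      ext k; simp only [Finset.mem_Ioc, Finset.notMem_empty, iff_false]; omega
    rw [h1, h2, h3, Finset.sum_insert (by simp)]
    simp only [Finset.sum_empty]; ring

theorem walk_add_nat (b : ℕ) (x : ℤ → ℕ) (a : ℤ) (l : ℕ) :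
    walk b x (a + l) = walk b x a + ((∑ k ∈ Finset.Ioc a (a + l), x k : ℕ) - b * l : ℤ) := by
  induction l with
  | zero => simp
  | succ l ih =>
    have h1 : Finset.Ioc a (a + (l + 1 : ℕ)) = insert (a + l + 1) (Finset.Ioc a (a + l)) := by
      ext k; simp only [Finset.mem_Ioc, Finset.mem_insert]; omega
    rw [h1, Finset.sum_insert (by simp)]
    have : a + ((l + 1 : ℕ) : ℤ) = a + l + 1 := by push_cast; ring
    rw [this, walk_add_one, ih]
    push_cast; ring

theorem sum_range_sub_eq_sum_Ioc (x : ℤ → ℕ) (i : ℤ) (l : ℕ) :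
    ∑ k ∈ Finset.range l, x (i - k) = ∑ k ∈ Finset.Ioc (i - l) i, x k := by
  induction l with
  | zero => simp
  | succ l ih =>
    have h1 : Finset.Ioc (i - (l + 1 : ℕ)) i = insert (i - l) (Finset.Ioc (i - l) i) := by
      ext k; simp only [Finset.mem_Ioc, Finset.mem_insert]; omega
    rw [h1, Finset.sum_insert (by simp), Finset.sum_range_succ, ih, add_comm]

/-- A bucket is full iff some window ending there holds at least its capacity in keys. -/
theorem isFull_iff_exists_sum {b : ℕ} (hb : 0 < b) (x : ℤ → ℕ) (i : ℤ) :
    IsFull b x i ↔ ∃ l : ℕ, 1 ≤ l ∧ b * l ≤ ∑ k ∈ Finset.Ioc (i - l) i, x k := by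
  have hsum : ∀ L : ℕ, (∑ k ∈ Finset.range (L + 1), x (i - k))
      = x i + ∑ k ∈ Finset.range L, x (i - 1 - k) := by
    intro L
    rw [Finset.sum_range_succ', add_comm]
    congr 1
    · simp
    · refine Finset.sum_congr rfl fun k _ => ?_
      congr 1
      push_cast
      ring
  have key : IsFull b x i ↔
      ∃ L : ℕ, b ≤ x i + ((∑ k ∈ Finset.range L, x (i - 1 - k)) - b * L) := by
    unfold IsFull profile overflow
    rw [ENat.add_iSup]
    constructor
    · intro h
      -- A supremum in `ℕ∞` need not be attained; weakening `b ≤` to `b - 1 <` produces an index,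
      -- and integrality restores the bound.
      have h2 : ((b - 1 : ℕ) : ℕ∞) < _ := lt_of_lt_of_le (by exact_mod_cast (by omega)) h
      obtain ⟨L, hL⟩ := lt_iSup_iff.1 h2
      refine ⟨L, ?_⟩
      norm_cast at hL
      omega
    · rintro ⟨L, hL⟩
      refine le_trans ?_ (le_iSup _ L)
      exact_mod_cast hL
  rw [key]
  constructor
  · rintro ⟨L, hL⟩
    -- If the truncated difference vanishes, bucket `i` alone already holds `b` keys.
    by_cases h : (∑ k ∈ Finset.range L, x (i - 1 - k)) ≤ b * L
    · refine ⟨1, le_rfl, ?_⟩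
      rw [← sum_range_sub_eq_sum_Ioc]
      simp; omega
    · refine ⟨L + 1, by omega, ?_⟩
      rw [← sum_range_sub_eq_sum_Ioc, hsum]
      have : b * (L + 1) = b * L + b := by ring
      omega
  · rintro ⟨l, hl, h⟩
    obtain ⟨L, rfl⟩ : ∃ L, l = L + 1 := ⟨l - 1, by omega⟩
    refine ⟨L, ?_⟩
    rw [← sum_range_sub_eq_sum_Ioc, hsum] at h
    have : b * (L + 1) = b * L + b := by ring
    omega

/-- A bucket is non-full iff the walk has a strict record minimum there. -/
theorem isFull_iff_walk {b : ℕ} (hb : 0 < b) (x : ℤ → ℕ) (i : ℤ) :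
    IsFull b x i ↔ ∃ a < i, walk b x a ≤ walk b x i := by
  rw [isFull_iff_exists_sum hb]
  constructor
  · rintro ⟨l, hl, h⟩
    refine ⟨i - l, by omega, ?_⟩
    have := walk_add_nat b x (i - l) l
    rw [sub_add_cancel] at this
    rw [this]
    have : ((b * l : ℕ) : ℤ) ≤ ((∑ k ∈ Finset.Ioc (i - l) i, x k : ℕ) : ℤ) := by exact_mod_cast h
    push_cast at this ⊢
    linarith
  · rintro ⟨a, ha, h⟩
    obtain ⟨l, rfl⟩ : ∃ l : ℕ, a = i - l := ⟨(i - a).toNat, by omega⟩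
    refine ⟨l, by omega, ?_⟩
    have h2 := walk_add_nat b x (i - l) l
    rw [sub_add_cancel] at h2
    have : ((b * l : ℕ) : ℤ) ≤ ((∑ k ∈ Finset.Ioc (i - l) i, x k : ℕ) : ℤ) := by
      push_cast at h2 ⊢; linarith
    exact_mod_cast this

/-- Started empty after bucket `a`, the table has a first block of length `k`. -/
def FirstBlock (b : ℕ) (x : ℤ → ℕ) (a : ℤ) (k : ℕ) : Prop :=
  1 ≤ k ∧ (∀ j : ℕ, 1 ≤ j → j < k → b * j ≤ ∑ i ∈ Finset.Ioc a (a + j), x i) ∧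
    ∑ i ∈ Finset.Ioc a (a + k), x i < b * k

theorem firstBlock_iff_walk (b : ℕ) (x : ℤ → ℕ) (a : ℤ) (k : ℕ) :
    FirstBlock b x a k ↔ 1 ≤ k ∧ (∀ j : ℕ, 1 ≤ j → j < k → walk b x a ≤ walk b x (a + j)) ∧
      walk b x (a + k) < walk b x a := by
  unfold FirstBlock
  refine and_congr_right fun _ => and_congr (forall_congr' fun j => ?_) ?_
  · refine imp_congr_right fun _ => imp_congr_right fun _ => ?_
    rw [walk_add_nat, ← Int.ofNat_le]; push_cast
    constructor <;> intro h <;> linarith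
  · rw [walk_add_nat, ← Int.ofNat_lt]; push_cast
    constructor <;> intro h <;> linarith

/-- After a non-full bucket, a first block of length `k` is a block of the table. -/
theorem block_eq_Ioc {b : ℕ} (hb : 0 < b) {x : ℤ → ℕ} {a i : ℤ} {k : ℕ}
    (hk : FirstBlock b x a k) (ha : ¬ IsFull b x a) (hai : a < i) (hik : i ≤ a + k) :
    block b x i = Set.Ioc a (a + k) := by
  rw [firstBlock_iff_walk] at hk
  obtain ⟨h1, h2, h3⟩ := hk
  have hfull : ∀ j, a < j → j < a + k → IsFull b x j := by
    intro j hj1 hj2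
    rw [isFull_iff_walk hb]
    have := h2 (j - a).toNat (by omega) (by omega)
    rw [show a + ((j - a).toNat : ℤ) = j by omega] at this
    exact ⟨a, hj1, this⟩
  -- The end is a record: before `a` the walk exceeds its value at `a`, from `a` to the end it is at
  -- least that value, and at the end it is below.
  have hend : ¬ IsFull b x (a + k) := by
    rw [isFull_iff_walk hb] at ha ⊢
    push Not at ha ⊢
    intro c hc
    rcases lt_trichotomy c a with h | h | h
    · linarith [ha c h]
    · rw [h]; exact h3
    · have := h2 (c - a).toNat (by omega) (by omega)
      rw [show a + ((c - a).toNat : ℤ) = c by omega] at this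
      linarith
  ext j
  simp only [block, Set.mem_ofPred_eq, Set.mem_Ioc]
  constructor
  · intro h
    constructor
    · by_contra hj
      exact ha (h a (by omega) (by omega))
    · by_contra hj
      exact hend (h (a + k) (by omega) (by omega))
  · rintro ⟨hj1, hj2⟩ c hc1 hc2
    exact hfull c (by omega) (by omega)

theorem blockLength_eq_of_firstBlock {b : ℕ} (hb : 0 < b) {x : ℤ → ℕ} {a i : ℤ} {k : ℕ}
    (hk : FirstBlock b x a k) (ha : ¬ IsFull b x a) (hai : a < i) (hik : i ≤ a + k) :
    blockLength b x i = k := by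
  rw [blockLength, block_eq_Ioc hb hk ha hai hik, ← Finset.coe_Ioc, Set.ncard_coe_finset]
  simp

/-- Take for `a` the leftmost minimizer of the walk on `(-∞, i - 1]`. Being leftmost makes it a
strict record, hence non-full; being a minimizer prevents the next descent below its level from
occurring before `i`. -/
theorem exists_firstBlock_of_walk {b : ℕ} (hb : 0 < b) {x : ℤ → ℕ}
    (hbot : ∀ C : ℤ, ∃ j₀ : ℤ, ∀ j ≤ j₀, C ≤ walk b x j)
    (htop : ∀ C : ℤ, ∀ j₀ : ℤ, ∃ j ≥ j₀, walk b x j ≤ C) (i : ℤ) :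
    ∃ (a : ℤ) (k : ℕ), a < i ∧ i ≤ a + k ∧ FirstBlock b x a k ∧ ¬ IsFull b x a := by
  classical
  -- the minimum of the walk on `(-∞, i - 1]`
  obtain ⟨w, ⟨c, hc, rfl⟩, hw⟩ : ∃ w, (∃ c ≤ i - 1, walk b x c = w) ∧
      ∀ z, (∃ c ≤ i - 1, walk b x c = z) → w ≤ z := by
    refine Int.exists_least_of_bdd ?_ ⟨_, i - 1, le_rfl, rfl⟩
    obtain ⟨j₀, hj₀⟩ := hbot 0
    refine ⟨min 0 (-∑ j ∈ Finset.Icc j₀ (i - 1), |walk b x j|), ?_⟩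
    rintro z ⟨c, hc, rfl⟩
    rcases le_or_gt c j₀ with h | h
    · exact le_trans (min_le_left _ _) (hj₀ c h)
    · refine le_trans (min_le_right _ _) ?_
      have : |walk b x c| ≤ ∑ j ∈ Finset.Icc j₀ (i - 1), |walk b x j| :=
        Finset.single_le_sum (f := fun j => |walk b x j|) (fun _ _ => abs_nonneg _)
          (Finset.mem_Icc.2 ⟨h.le, hc⟩)
      linarith [neg_abs_le (walk b x c)]
  obtain ⟨a, ⟨ha1, ha2⟩, ha3⟩ : ∃ a, (a ≤ i - 1 ∧ walk b x a = walk b x c) ∧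
      ∀ z, (z ≤ i - 1 ∧ walk b x z = walk b x c) → a ≤ z := by
    refine Int.exists_least_of_bdd ?_ ⟨c, hc, rfl⟩
    obtain ⟨j₀, hj₀⟩ := hbot (walk b x c + 1)
    refine ⟨j₀, fun z hz => ?_⟩
    by_contra h
    have := hj₀ z (by omega)
    omega
  have hnf : ¬ IsFull b x a := by
    rw [isFull_iff_walk hb]
    push Not
    intro z hz
    have h1 := hw (walk b x z) ⟨z, by omega, rfl⟩
    rcases h1.lt_or_eq with h | h
    · omega
    · have := ha3 z ⟨by omega, h.symm⟩
      omega
  have hex : ∃ k : ℕ, 1 ≤ k ∧ walk b x (a + k) < walk b x a := by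
    obtain ⟨j, hj1, hj2⟩ := htop (walk b x a - 1) (a + 1)
    refine ⟨(j - a).toNat, by omega, ?_⟩
    rw [show a + ((j - a).toNat : ℤ) = j by omega]
    omega
  have hk := Nat.find_spec hex
  refine ⟨a, Nat.find hex, by omega, ?_, ?_, hnf⟩
  · by_contra h
    have := hw (walk b x (a + (Nat.find hex : ℕ))) ⟨_, by omega, rfl⟩
    omega
  · rw [firstBlock_iff_walk]
    refine ⟨hk.1, fun j hj1 hj2 => ?_, hk.2⟩
    have := Nat.find_min hex hj2
    push Not at this
    exact this hj1

/-- If the walk tends to `∞` on the left and to `-∞` on the right, then the block containing `i`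
is the first block after a non-full bucket among the `k` buckets before `i`. -/
theorem blockLength_eq_iff {b : ℕ} (hb : 0 < b) {x : ℤ → ℕ}
    (hbot : ∀ C : ℤ, ∃ j₀ : ℤ, ∀ j ≤ j₀, C ≤ walk b x j)
    (htop : ∀ C : ℤ, ∀ j₀ : ℤ, ∃ j ≥ j₀, walk b x j ≤ C) (i : ℤ) (k : ℕ) :
    blockLength b x i = k ↔
      ∃ r < k, FirstBlock b x (i - 1 - r) k ∧ ¬ IsFull b x (i - 1 - r) := by
  obtain ⟨a, l, h1, h2, h3, h4⟩ := exists_firstBlock_of_walk hb hbot htop i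
  constructor
  · rintro rfl
    rw [blockLength_eq_of_firstBlock hb h3 h4 h1 h2]
    refine ⟨(i - 1 - a).toNat, by omega, ?_⟩
    rw [show i - 1 - ((i - 1 - a).toNat : ℤ) = a by omega]
    exact ⟨h3, h4⟩
  · rintro ⟨r, hr, h5, h6⟩
    exact blockLength_eq_of_firstBlock hb h5 h6 (by omega) (by omega)

theorem blockLength_pos {b : ℕ} (hb : 0 < b) {x : ℤ → ℕ}
    (hbot : ∀ C : ℤ, ∃ j₀ : ℤ, ∀ j ≤ j₀, C ≤ walk b x j)
    (htop : ∀ C : ℤ, ∀ j₀ : ℤ, ∃ j ≥ j₀, walk b x j ≤ C) (i : ℤ) :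
    0 < blockLength b x i := by
  obtain ⟨a, l, h1, h2, h3, h4⟩ := exists_firstBlock_of_walk hb hbot htop i
  rw [blockLength_eq_of_firstBlock hb h3 h4 h1 h2]
  exact h3.1

/-- The starting points of the block containing `i` are unique. -/
theorem firstBlock_start_unique {b : ℕ} (hb : 0 < b) {x : ℤ → ℕ} {i : ℤ} {k r s : ℕ}
    (hr : r < k) (hs : s < k)
    (h1 : FirstBlock b x (i - 1 - r) k) (h1' : ¬ IsFull b x (i - 1 - r))
    (h2 : FirstBlock b x (i - 1 - s) k) (h2' : ¬ IsFull b x (i - 1 - s)) : r = s := by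
  have e1 := block_eq_Ioc hb h1 h1' (i := i) (by omega) (by omega)
  have e2 := block_eq_Ioc hb h2 h2' (i := i) (by omega) (by omega)
  rw [e1] at e2
  -- The first bucket of each block lies in the other block, so neither block starts earlier.
  have m1 : i - r ∈ Set.Ioc (i - 1 - (r : ℤ)) (i - 1 - r + k) := by
    simp only [Set.mem_Ioc]; omega
  have m2 : i - s ∈ Set.Ioc (i - 1 - (s : ℤ)) (i - 1 - s + k) := by
    simp only [Set.mem_Ioc]; omega
  rw [e2] at m1
  rw [← e2] at m2
  simp only [Set.mem_Ioc] at m1 m2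
  omega

/-! ### The one-sided table -/

/-- While all buckets are full the truncation at `0` in the recursion is inactive, so the overflow
is the plain surplus of keys over capacity. -/
theorem overflowOneSided_add (b : ℕ) (x : ℤ → ℕ) (k : ℕ)
    (h : ∀ j : ℕ, 1 ≤ j → j < k → b * j ≤ ∑ i ∈ Finset.Ioc (0 : ℤ) (0 + j), x i) :
    ∀ j < k, overflowOneSided b (fun i : ℕ => x i) j + b * j
      = ∑ i ∈ Finset.Ioc (0 : ℤ) (0 + j), x i := by
  intro j hj
  induction j with
  | zero => simp [overflowOneSided]
  | succ j ih =>
    have h1 := ih (by omega)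
    have h2 := h (j + 1) (by omega) hj
    have h3 : Finset.Ioc (0 : ℤ) (0 + (j + 1 : ℕ))
        = insert ((j + 1 : ℕ) : ℤ) (Finset.Ioc 0 (0 + (j : ℤ))) := by
      ext k; simp only [Finset.mem_Ioc, Finset.mem_insert]; omega
    rw [h3, Finset.sum_insert (by simp)] at h2 ⊢
    simp only [overflowOneSided]
    have : b * (j + 1) = b * j + b := by ring
    omega

/-- Up to the first non-full bucket, the profile of bucket `k` is the window sum minus `b (k - 1)`,
so it drops below `b` when the sum drops below `b k`. The hypothesis `1 ≤ k` keeps away the default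
value `sInf ∅ = 0`. -/
theorem firstBlockLength_eq_iff (b : ℕ) (x : ℤ → ℕ) {k : ℕ} (hk : 1 ≤ k) :
    firstBlockLength b (fun i : ℕ => x i) = k ↔ FirstBlock b x 0 k := by
  have hprof : ∀ k : ℕ,
      (∀ j : ℕ, 1 ≤ j → j < k → b * j ≤ ∑ i ∈ Finset.Ioc (0 : ℤ) (0 + j), x i) → 1 ≤ k →
      profileOneSided b (fun i : ℕ => x i) k + b * k
        = ∑ i ∈ Finset.Ioc (0 : ℤ) (0 + k), x i + b := by
    intro k h hk
    obtain ⟨j, rfl⟩ : ∃ j, k = j + 1 := ⟨k - 1, by omega⟩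
    have h1 := overflowOneSided_add b x (j + 1) h j (by omega)
    have h3 : Finset.Ioc (0 : ℤ) (0 + (j + 1 : ℕ))
        = insert ((j + 1 : ℕ) : ℤ) (Finset.Ioc 0 (0 + (j : ℤ))) := by
      ext k; simp only [Finset.mem_Ioc, Finset.mem_insert]; omega
    rw [h3, Finset.sum_insert (by simp)]
    simp only [profileOneSided, Nat.add_sub_cancel]
    have : b * (j + 1) = b * j + b := by ring
    omega
  have hiff : ∀ k : ℕ, (∀ j : ℕ, 1 ≤ j → j < k → b ≤ profileOneSided b (fun i : ℕ => x i) j) →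
      (∀ j : ℕ, 1 ≤ j → j < k → b * j ≤ ∑ i ∈ Finset.Ioc (0 : ℤ) (0 + j), x i) := by
    intro k h j
    induction j using Nat.strong_induction_on with
    | _ j ih =>
      intro h1 h2
      have := hprof j (fun l hl1 hl2 => ih l hl2 hl1 (by omega)) h1
      have := h j h1 h2
      omega
  constructor
  · intro h
    have hne : {i | 1 ≤ i ∧ profileOneSided b (fun i : ℕ => x i) i < b}.Nonempty := by
      by_contra hne
      rw [Set.not_nonempty_iff_eq_empty] at hne
      rw [firstBlockLength, hne, Nat.sInf_empty] at h
      omega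
    have hmem := Nat.sInf_mem hne
    change sInf _ = k at h
    rw [h] at hmem
    have hall := hiff k fun j h1 h2 => by
      by_contra hlt
      rw [← h] at h2
      exact Nat.notMem_of_lt_sInf h2 ⟨h1, by omega⟩
    refine ⟨hk, hall, ?_⟩
    have := hprof k hall hk
    have := hmem.2
    omega
  · rintro ⟨_, h2, h3⟩
    have hmem : k ∈ {i | 1 ≤ i ∧ profileOneSided b (fun i : ℕ => x i) i < b} := by
      refine ⟨hk, ?_⟩
      have := hprof k h2 hk
      omega
    apply le_antisymm (Nat.sInf_le hmem)
    refine le_csInf ⟨k, hmem⟩ ?_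
    rintro j ⟨hj1, hj2⟩
    by_contra hlt
    have := hprof j (fun l hl1 hl2 => h2 l hl1 (by omega)) hj1
    have := h2 j hj1 (by omega)
    omega

/-! ### Abel's identity -/

/-- This is the `N`-th forward difference at `0` of a polynomial of degree `N - 1`, without its term
`k = 0`; that term is nonzero only for `N = 1`. -/
theorem sum_neg_one_pow_mul_choose_mul_pow (N : ℕ) (hN : 1 ≤ N) :
    ∑ k ∈ Finset.Icc 1 N, ((-1 : ℂ) ^ (N - k) * N.choose k) * (k : ℂ) ^ (N - 1)
      = if N = 1 then 1 else 0 := by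
  split_ifs with h
  · subst h; simp
  · have h1 := congrFun (fwdDiff_iter_pow_eq_zero_of_lt (R := ℂ) (j := N - 1) (n := N) (by omega)) 0
    rw [fwdDiff_iter_eq_sum_shift, Finset.sum_range_succ'] at h1
    simp only [zsmul_eq_mul, zero_add, nsmul_eq_mul, mul_one, Pi.zero_apply, Nat.cast_zero] at h1
    rw [zero_pow (by omega), mul_zero, add_zero] at h1
    rw [← h1, Finset.range_eq_Ico, Finset.sum_Ico_add' (fun k => (((-1 : ℤ) ^ (N - k) * (N.choose k : ℕ) : ℤ) : ℂ) * (k : ℂ) ^ (N - 1)) 0 N 1]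
    refine Finset.sum_congr (by ext k; simp only [Finset.mem_Icc, Finset.mem_Ico]; omega) ?_
    intro k _
    push_cast; rfl

theorem choose_mul_choose_sub_comm {N k j : ℕ} (h : k + j ≤ N) :
    N.choose k * (N - k).choose j = N.choose j * (N - j).choose k := by
  obtain ⟨l, rfl⟩ : ∃ l, N = k + j + l := ⟨N - (k + j), by omega⟩
  have h1 := Nat.choose_mul_factorial_mul_factorial (n := k + j + l) (k := k) (by omega)
  have h2 := Nat.choose_mul_factorial_mul_factorial (n := k + j + l - k) (k := j) (by omega)
  have h3 := Nat.choose_mul_factorial_mul_factorial (n := k + j + l) (k := j) (by omega)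
  have h4 := Nat.choose_mul_factorial_mul_factorial (n := k + j + l - j) (k := k) (by omega)
  rw [show k + j + l - k - j = l by omega] at h2
  rw [show k + j + l - j - k = l by omega] at h4
  have hp : 0 < k.factorial * j.factorial * l.factorial := by positivity
  apply Nat.eq_of_mul_eq_mul_right hp
  calc _ = (k + j + l).choose k * k.factorial *
        ((k + j + l - k).choose j * j.factorial * l.factorial) := by ring
    _ = (k + j + l).choose j * j.factorial *
        ((k + j + l - j).choose k * k.factorial * l.factorial) := by rw [h2, h4, h1, h3]
    _ = _ := by ring

/-- A limiting case of Abel's binomial theorem. -/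
theorem abel_identity (N : ℕ) (hN : 1 ≤ N) (y : ℂ) :
    ∑ k ∈ Finset.Icc 1 N, (N.choose k : ℂ) * (k : ℂ) ^ (k - 1) * (y - k) ^ (N - k)
      = N * y ^ (N - 1) := by
  -- Expanding in powers of `y` makes the coefficient of `y ^ j` an `(N - j)`-th difference of a
  -- power of degree `N - j - 1`; only `j = N - 1` survives.
  have h1 : ∀ k ∈ Finset.Icc 1 N,
      (N.choose k : ℂ) * (k : ℂ) ^ (k - 1) * (y - k) ^ (N - k)
        = ∑ j ∈ Finset.range (N - k + 1), (N.choose j : ℂ) * y ^ j *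
          (((-1 : ℂ) ^ (N - j - k) * (N - j).choose k) * (k : ℂ) ^ (N - j - 1)) := by
    intro k hk
    rw [Finset.mem_Icc] at hk
    rw [sub_eq_add_neg, add_pow, Finset.mul_sum]
    refine Finset.sum_congr rfl fun j hj => ?_
    rw [Finset.mem_range] at hj
    have hc := choose_mul_choose_sub_comm (N := N) (k := k) (j := j) (by omega)
    have hc' : (N.choose k : ℂ) * (N - k).choose j = N.choose j * (N - j).choose k := by
      exact_mod_cast hc
    rw [neg_pow, show N - k - j = N - j - k by omega,
      show N - j - 1 = (k - 1) + (N - j - k) by omega, pow_add]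
    linear_combination (y ^ j * (-1) ^ (N - j - k) * (k : ℂ) ^ (k - 1) * (k : ℂ) ^ (N - j - k)) * hc'
  rw [Finset.sum_congr rfl h1,
    Finset.sum_comm' (t' := Finset.range N) (s' := fun j => Finset.Icc 1 (N - j))
      (by intro k j; simp only [Finset.mem_Icc, Finset.mem_range]; omega)]
  have h2 : ∀ j ∈ Finset.range N, ∑ k ∈ Finset.Icc 1 (N - j), (N.choose j : ℂ) * y ^ j *
          (((-1 : ℂ) ^ (N - j - k) * (N - j).choose k) * (k : ℂ) ^ (N - j - 1))
        = if j = N - 1 then (N : ℂ) * y ^ (N - 1) else 0 := by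
    intro j hj
    rw [Finset.mem_range] at hj
    rw [← Finset.mul_sum, sum_neg_one_pow_mul_choose_mul_pow _ (by omega)]
    split_ifs with h3 h4 h4
    · subst h4
      rw [show N.choose (N - 1) = N by
        rw [Nat.choose_symm_of_eq_add (show N = (N - 1) + 1 by omega)]; simp]
      ring
    · omega
    · omega
    · simp
  rw [Finset.sum_congr rfl h2, Finset.sum_ite_eq']
  simp; omega

/-- The coefficient `(n + 1) ^ n / (n + 1)!` of the tree function. -/
noncomputable def treeCoeff (n : ℕ) : ℂ := (n + 1 : ℂ) ^ n / ((n + 1).factorial : ℂ)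

/-- Abel's identity with `N = y = n + 2`, whose term `k = N` is moved to the other side and leaves
`(N - 1) N ^ (N - 1)`. In terms of `F = T z / z` the recursion says `F' = F (z F)'`. -/
theorem treeCoeff_recursion (n : ℕ) :
    ((n : ℂ) + 1) * treeCoeff (n + 1)
      = ∑ p ∈ Finset.HasAntidiagonal.antidiagonal n, treeCoeff p.1 * ((p.2 + 1) * treeCoeff p.2) := by
  have h := abel_identity (n + 2) (by omega) ((n + 2 : ℕ) : ℂ)
  have hI : Finset.Icc 1 (n + 2) = insert (n + 2) (Finset.Ico 1 (n + 2)) := by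
    ext k; simp only [Finset.mem_Icc, Finset.mem_insert, Finset.mem_Ico]; omega
  rw [hI, Finset.sum_insert (by simp)] at h
  have hf : ((n + 2).factorial : ℂ) ≠ 0 := by exact_mod_cast (n + 2).factorial_ne_zero
  rw [Finset.Nat.sum_antidiagonal_eq_sum_range_succ
    (f := fun i j => treeCoeff i * ((j + 1) * treeCoeff j))]
  have e : ∑ k ∈ Finset.Ico 1 (n + 2), (((n + 2).choose k : ℕ) : ℂ) * (k : ℂ) ^ (k - 1) *
        (((n + 2 : ℕ) : ℂ) - k) ^ (n + 2 - k)
      = (n + 2).factorial * ∑ k ∈ Finset.range n.succ,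
        treeCoeff k * (((n - k : ℕ) + 1) * treeCoeff (n - k)) := by
    rw [Finset.sum_Ico_eq_sum_range, Finset.mul_sum]
    refine Finset.sum_congr rfl fun k hk => ?_
    rw [Finset.mem_range] at hk
    obtain ⟨j, rfl⟩ : ∃ j, n = k + j := ⟨n - k, by omega⟩
    have hc := Nat.choose_mul_factorial_mul_factorial (n := k + j + 2) (k := k + 1) (by omega)
    rw [show k + j + 2 - (k + 1) = j + 1 by omega] at hc
    have hc' : ((k + j + 2).choose (k + 1) : ℂ) * (k + 1).factorial * (j + 1).factorial
      = (k + j + 2).factorial := by exact_mod_cast hc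
    have hk0 : ((k + 1).factorial : ℂ) ≠ 0 := by exact_mod_cast (k + 1).factorial_ne_zero
    have hj0 : ((j + 1).factorial : ℂ) ≠ 0 := by exact_mod_cast (j + 1).factorial_ne_zero
    rw [show k + j - k = j by omega, show k + j + 2 - (1 + k) = j + 1 by omega,
      show 1 + k - 1 = k by omega, show 1 + k = k + 1 by omega, treeCoeff, treeCoeff, ← hc']
    field_simp
    push_cast
    ring
  rw [e] at h
  generalize (∑ k ∈ Finset.range n.succ,
    treeCoeff k * (((n - k : ℕ) + 1) * treeCoeff (n - k))) = S at h ⊢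
  apply mul_left_cancel₀ hf
  simp only [Nat.choose_self, Nat.sub_self, pow_zero, Nat.cast_one, one_mul, mul_one,
    show n + 2 - 1 = n + 1 by omega] at h
  rw [treeCoeff]
  simp only [show n + 1 + 1 = n + 2 by omega]
  field_simp
  push_cast at h ⊢
  rw [show (n : ℂ) + 1 + 1 = n + 2 by ring]
  linear_combination -h

/-! ### Differentiation of power series -/

theorem summable_norm_deriv_pow {c : ℕ → ℂ} {R : ℝ}
    (hc : ∀ r : ℝ, 0 ≤ r → r < R → Summable fun n : ℕ => (n + 1 : ℝ) * ‖c n‖ * r ^ n)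
    {z : ℂ} (hz : ‖z‖ < R) : Summable fun n : ℕ => ‖c n * (n * z ^ (n - 1))‖ := by
  rw [← summable_nat_add_iff 1]
  have h := hc ‖z‖ (norm_nonneg z) hz
  by_cases h0 : z = 0
  · refine summable_of_ne_finset_zero (s := {0}) fun n hn => ?_
    simp only [Finset.mem_singleton] at hn
    simp [h0, hn]
  rw [← summable_nat_add_iff 1] at h
  refine Summable.of_nonneg_of_le (fun n => norm_nonneg _) (fun n => ?_) (h.mul_left (‖z‖⁻¹))
  have hz0 : 0 < ‖z‖ := norm_pos_iff.2 h0
  rw [norm_mul, norm_mul, norm_pow, Nat.add_sub_cancel, pow_succ, Complex.norm_natCast]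
  calc _ ≤ ‖c (n + 1)‖ * ((((n + 1 : ℕ) : ℝ) + 1) * ‖z‖ ^ n) := by gcongr; linarith
    _ = _ := by field_simp

theorem hasDerivAt_tsum_pow {c : ℕ → ℂ} {R : ℝ}
    (hc : ∀ r : ℝ, 0 ≤ r → r < R → Summable fun n : ℕ => (n + 1 : ℝ) * ‖c n‖ * r ^ n)
    {z : ℂ} (hz : ‖z‖ < R) :
    HasDerivAt (fun z => ∑' n : ℕ, c n * z ^ n) (∑' n : ℕ, c n * (n * z ^ (n - 1))) z := by
  -- On the ball of this intermediate radius the derivative series is dominated by its norms at `r`.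
  obtain ⟨r, hr1, hr2⟩ := exists_between hz
  have hr0 : 0 < r := lt_of_le_of_lt (norm_nonneg z) hr1
  have hsum : Summable fun n : ℕ => ‖c n * (n * (r : ℂ) ^ (n - 1))‖ := by
    apply summable_norm_deriv_pow hc
    rwa [Complex.norm_real, Real.norm_of_nonneg hr0.le]
  refine hasDerivAt_tsum_of_isPreconnected (t := Metric.ball (0 : ℂ) r)
    (g := fun n z => c n * z ^ n)
    (g' := fun n z => c n * (n * z ^ (n - 1))) (y₀ := 0) hsum
    Metric.isOpen_ball (convex_ball _ _).isPreconnected ?_ ?_ (Metric.mem_ball_self hr0) ?_ ?_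
  · intro n y _
    exact (hasDerivAt_pow n y).const_mul _
  · intro n y hy
    rw [mem_ball_zero_iff] at hy
    simp only [norm_mul, norm_pow, Complex.norm_real, Real.norm_of_nonneg hr0.le]
    gcongr
  · refine summable_of_ne_finset_zero (s := {0}) fun n hn => ?_
    simp only [Finset.mem_singleton] at hn
    simp [hn]
  · simpa using hr1

/-! ### Analytic properties of the tree function -/

/-- The left side is `(n + 1) ^ (n + 1) / (n + 1)!`, a single term of the series of `e ^ (n + 1)`.
-/
theorem norm_treeCoeff_mul_le (n : ℕ) : (n + 1 : ℝ) * ‖treeCoeff n‖ ≤ Real.exp 1 ^ (n + 1) := by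
  have h1 : ‖treeCoeff n‖ = (n + 1 : ℝ) ^ n / ((n + 1).factorial : ℝ) := by
    have : treeCoeff n = (((n + 1 : ℝ) ^ n / ((n + 1).factorial : ℝ) : ℝ) : ℂ) := by
      rw [treeCoeff]; push_cast; rfl
    rw [this, Complex.norm_real, Real.norm_of_nonneg (by positivity)]
  have h2 := Real.pow_div_factorial_le_exp (n + 1 : ℝ) (by positivity) (n + 1)
  rw [h1, ← Real.exp_nat_mul]
  convert! h2 using 1
  · ring
  · push_cast; simp

theorem summable_treeCoeff_bound {r : ℝ} (hr0 : 0 ≤ r) (hr : r < Real.exp (-1)) :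
    Summable fun n : ℕ => (n + 1 : ℝ) * ‖treeCoeff n‖ * r ^ n := by
  have h : Real.exp 1 * r < 1 := by
    have := mul_lt_mul_of_pos_left hr (Real.exp_pos 1)
    rwa [← Real.exp_add, add_neg_cancel, Real.exp_zero] at this
  refine Summable.of_nonneg_of_le (fun n => by positivity) (fun n => ?_)
    ((summable_geometric_of_lt_one (by positivity) h).mul_left (Real.exp 1))
  calc _ ≤ Real.exp 1 ^ (n + 1) * r ^ n := by gcongr; exact norm_treeCoeff_mul_le n
    _ = _ := by rw [mul_pow]; ring

/-- The function `T z / z`. -/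
noncomputable def treeQuot (z : ℂ) : ℂ := ∑' n : ℕ, treeCoeff n * z ^ n

/-- The derivative of `T z / z`. -/
noncomputable def treeQuotDeriv (z : ℂ) : ℂ := ∑' n : ℕ, treeCoeff n * (n * z ^ (n - 1))

theorem treeFun_eq_mul_treeQuot (z : ℂ) : treeFun z = z * treeQuot z := by
  rw [treeFun, treeQuot, ← tsum_mul_left]
  refine tsum_congr fun n => ?_
  rw [treeCoeff]; ring

theorem summable_norm_treeCoeff_mul {z : ℂ} (hz : ‖z‖ < Real.exp (-1)) :
    Summable fun n : ℕ => ‖treeCoeff n * z ^ n‖ := by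
  refine Summable.of_nonneg_of_le (fun n => norm_nonneg _) (fun n => ?_)
    (summable_treeCoeff_bound (norm_nonneg z) hz)
  rw [norm_mul, norm_pow]
  gcongr
  exact le_mul_of_one_le_left (norm_nonneg _) (by linarith [(Nat.cast_nonneg n : (0 : ℝ) ≤ n)])

theorem summable_norm_treeCoeff_deriv {z : ℂ} (hz : ‖z‖ < Real.exp (-1)) :
    Summable fun n : ℕ => ‖(n + 1 : ℂ) * treeCoeff n * z ^ n‖ := by
  refine (summable_treeCoeff_bound (norm_nonneg z) hz).congr fun n => ?_
  rw [norm_mul, norm_mul, norm_pow]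
  congr 2
  rw [show (n + 1 : ℂ) = ((n + 1 : ℕ) : ℂ) by push_cast; rfl, Complex.norm_natCast]
  push_cast; rfl

theorem summable_norm_treeQuotDeriv {z : ℂ} (hz : ‖z‖ < Real.exp (-1)) :
    Summable fun n : ℕ => ‖treeCoeff n * (n * z ^ (n - 1))‖ :=
  summable_norm_deriv_pow (fun _ h0 h => summable_treeCoeff_bound h0 h) hz

theorem hasDerivAt_treeQuot {z : ℂ} (hz : ‖z‖ < Real.exp (-1)) :
    HasDerivAt treeQuot (treeQuotDeriv z) z :=
  hasDerivAt_tsum_pow (fun _ h0 h => summable_treeCoeff_bound h0 h) hz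

/-- The differential equation `F' = F T'` for `F = T z / z`: a Cauchy product whose coefficients
match by `treeCoeff_recursion`. -/
theorem treeQuotDeriv_eq {z : ℂ} (hz : ‖z‖ < Real.exp (-1)) :
    treeQuotDeriv z = treeQuot z * (treeQuot z + z * treeQuotDeriv z) := by
  have h1 : treeQuot z + z * treeQuotDeriv z = ∑' n : ℕ, (n + 1 : ℂ) * treeCoeff n * z ^ n := by
    rw [treeQuot, treeQuotDeriv, ← tsum_mul_left,
      ← (summable_norm_treeCoeff_mul hz).of_norm.tsum_add
        ((summable_norm_treeQuotDeriv hz).of_norm.mul_left z)]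
    refine tsum_congr fun n => ?_
    rcases n with _ | n
    · simp
    · rw [Nat.add_sub_cancel, pow_succ]; ring
  rw [h1, treeQuot, tsum_mul_tsum_eq_tsum_sum_antidiagonal_of_summable_norm
    (summable_norm_treeCoeff_mul hz) (summable_norm_treeCoeff_deriv hz), treeQuotDeriv,
    (summable_norm_treeQuotDeriv hz).of_norm.tsum_eq_zero_add]
  simp only [Nat.cast_zero, zero_mul, mul_zero, zero_add, Nat.add_sub_cancel]
  refine tsum_congr fun n => ?_
  have h2 := treeCoeff_recursion n
  calc _ = (((n : ℂ) + 1) * treeCoeff (n + 1)) * z ^ n := by push_cast; ring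
    _ = _ := by
      rw [h2, Finset.sum_mul]
      refine Finset.sum_congr rfl fun p hp => ?_
      rw [Finset.HasAntidiagonal.mem_antidiagonal] at hp
      rw [← hp, pow_add]; ring

theorem hasDerivAt_treeFun {z : ℂ} (hz : ‖z‖ < Real.exp (-1)) :
    HasDerivAt treeFun (treeQuot z + z * treeQuotDeriv z) z := by
  have h := (hasDerivAt_id z).mul (hasDerivAt_treeQuot hz)
  have e : treeFun = (id * treeQuot) := funext fun z => treeFun_eq_mul_treeQuot z
  rw [e]
  simpa using h

/-- The functional equation `T z * e ^ (-T z) = z`. -/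
theorem treeFun_mul_exp_neg {z : ℂ} (hz : ‖z‖ < Real.exp (-1)) :
    treeFun z * Complex.exp (-treeFun z) = z := by
  -- The derivative of `F e ^ (-T)` is `e ^ (-T) (F' - F T') = 0`, so this function keeps its value
  -- `1` at the origin.
  have hd : ∀ w ∈ Metric.ball (0 : ℂ) (Real.exp (-1)),
      HasDerivAt (fun w => treeQuot w * Complex.exp (-treeFun w)) 0 w := by
    intro w hw
    rw [mem_ball_zero_iff] at hw
    have h := (hasDerivAt_treeQuot hw).mul ((hasDerivAt_treeFun hw).neg.cexp)
    convert! h using 1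
    nth_rewrite 1 [treeQuotDeriv_eq hw]
    ring
  have hc := (convex_ball (0 : ℂ) (Real.exp (-1))).is_const_of_fderivWithin_eq_zero (𝕜 := ℂ)
    (f := fun w => treeQuot w * Complex.exp (-treeFun w))
    (fun w hw => (hd w hw).differentiableAt.differentiableWithinAt)
    (fun w hw => by
      rw [fderivWithin_of_isOpen Metric.isOpen_ball hw]
      ext
      simp [(hd w hw).deriv])
    (mem_ball_zero_iff.2 hz) (Metric.mem_ball_self (Real.exp_pos _))
  have h0 : treeQuot 0 = 1 := by
    rw [treeQuot, tsum_eq_single 0 (fun n hn => by simp [hn])]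
    simp [treeCoeff]
  simp only [treeFun_eq_mul_treeQuot 0, h0, neg_zero, Complex.exp_zero, mul_one] at hc
  calc _ = z * (treeQuot z * Complex.exp (-treeFun z)) := by rw [treeFun_eq_mul_treeQuot z]; ring
    _ = z := by rw [hc, mul_one]

theorem treeFun_injOn {z w : ℂ} (hz : ‖z‖ < Real.exp (-1)) (hw : ‖w‖ < Real.exp (-1))
    (h : treeFun z = treeFun w) : z = w := by
  rw [← treeFun_mul_exp_neg hz, ← treeFun_mul_exp_neg hw, h]

/-- The derivative of the tree function: `z T'(z) (1 - T z) = T z`. -/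
theorem mul_deriv_treeFun {z : ℂ} (hz : ‖z‖ < Real.exp (-1)) :
    z * deriv treeFun z * (1 - treeFun z) = treeFun z := by
  rw [(hasDerivAt_treeFun hz).deriv, treeFun_eq_mul_treeQuot]
  have := treeQuotDeriv_eq hz
  linear_combination z ^ 2 * this

theorem treeFun_ofReal_re (x : ℝ) : treeFun x = ((treeFun x).re : ℂ) := by
  rw [eq_comm, ← Complex.conj_eq_iff_re, treeFun, Complex.conj_tsum]
  refine tsum_congr fun n => ?_
  simp [map_pow]

/-- If `T` reached `1` on `[0, x]`, the functional equation at that point `t` would force `t = e ^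
(-1)`. -/
theorem treeFun_re_lt_one {x : ℝ} (hx0 : 0 ≤ x) (hx : x < Real.exp (-1)) :
    (treeFun x).re < 1 := by
  by_contra hge
  push Not at hge
  have hcont : ContinuousOn (fun t : ℝ => (treeFun (t : ℂ)).re) (Set.Icc 0 x) := by
    intro t ht
    have : ‖(t : ℂ)‖ < Real.exp (-1) := by
      rw [Complex.norm_real, Real.norm_of_nonneg ht.1]
      exact lt_of_le_of_lt ht.2 hx
    have hca := (hasDerivAt_treeFun this).continuousAt
    exact (Complex.continuous_re.continuousAt.comp
      (hca.comp Complex.continuous_ofReal.continuousAt)).continuousWithinAt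
  have h0 : (treeFun ((0 : ℝ) : ℂ)).re = 0 := by simp [treeFun_eq_mul_treeQuot]
  obtain ⟨t, ht, hte⟩ := intermediate_value_Icc hx0 hcont (show (1 : ℝ) ∈ _ from ⟨by
    simp only [h0]; norm_num, hge⟩)
  have htn : ‖(t : ℂ)‖ < Real.exp (-1) := by
    rw [Complex.norm_real, Real.norm_of_nonneg ht.1]
    exact lt_of_le_of_lt ht.2 hx
  have := treeFun_mul_exp_neg htn
  simp only at hte
  rw [treeFun_ofReal_re, hte] at this
  have h2 : (Real.exp (-1) : ℂ) = t := by simpa using this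
  rw [← h2, Complex.norm_real, Real.norm_of_nonneg (Real.exp_pos _).le] at htn
  exact lt_irrefl _ htn

/-- The coefficients are nonnegative, so `|T z| ≤ T |z|`, and the real case applies. -/
theorem norm_treeFun_lt_one {z : ℂ} (hz : ‖z‖ < Real.exp (-1)) : ‖treeFun z‖ < 1 := by
  refine lt_of_le_of_lt ?_ (treeFun_re_lt_one (norm_nonneg z) hz)
  have hre : (treeFun (‖z‖ : ℂ)).re = ∑' n : ℕ, ‖treeCoeff n * z ^ n‖ * ‖z‖ := by
    have h : treeFun (‖z‖ : ℂ) = ((∑' n : ℕ, ‖treeCoeff n * z ^ n‖ * ‖z‖ : ℝ) : ℂ) := by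
      rw [treeFun, Complex.ofReal_tsum]
      refine tsum_congr fun n => ?_
      have h1 : ‖treeCoeff n‖ = (n + 1 : ℝ) ^ n / ((n + 1).factorial : ℝ) := by
        have : treeCoeff n = (((n + 1 : ℝ) ^ n / ((n + 1).factorial : ℝ) : ℝ) : ℂ) := by
          rw [treeCoeff]; push_cast; rfl
        rw [this, Complex.norm_real, Real.norm_of_nonneg (by positivity)]
      rw [norm_mul, norm_pow, h1]
      push_cast
      ring
    rw [h, Complex.ofReal_re]
  rw [hre, treeFun_eq_mul_treeQuot, norm_mul, tsum_mul_right, mul_comm]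
  gcongr
  exact norm_tsum_le_tsum_norm (summable_norm_treeCoeff_mul hz)

theorem mul_exp_neg_lt {α : ℝ} (hα1 : α < 1) :
    α * Real.exp (-α) < Real.exp (-1) := by
  have h := Real.add_one_lt_exp (show α - 1 ≠ 0 by linarith)
  have h2 : α < Real.exp (α - 1) := by linarith
  calc α * Real.exp (-α) < Real.exp (α - 1) * Real.exp (-α) := by
        gcongr
    _ = _ := by rw [← Real.exp_add]; congr 1; ring

/-- The tree function inverts `α ↦ α e ^ (-α)` on `(0, 1)`. -/
theorem treeFun_mul_exp_neg_self {α : ℝ} (hα0 : 0 < α) (hα1 : α < 1) :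
    treeFun (α * Complex.exp (-α)) = α := by
  set x : ℝ := α * Real.exp (-α) with hx
  have hxc : (α * Complex.exp (-α) : ℂ) = (x : ℂ) := by rw [hx]; push_cast; rfl
  have hx0 : 0 ≤ x := by positivity
  have hx1 := mul_exp_neg_lt hα1
  have hn : ‖(x : ℂ)‖ < Real.exp (-1) := by
    rwa [Complex.norm_real, Real.norm_of_nonneg hx0]
  rw [hxc, treeFun_ofReal_re]
  have hfe := treeFun_mul_exp_neg hn
  rw [treeFun_ofReal_re] at hfe
  set t := (treeFun (x : ℂ)).re
  have ht1 : t < 1 := treeFun_re_lt_one hx0 hx1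
  have hfe' : t * Real.exp (-t) = α * Real.exp (-α) := by
    rw [← hx]; exact_mod_cast hfe
  -- The functional equation alone has other solutions; `t < 1` selects the branch on which `s e ^
  -- (-s)` is injective.
  have hinj : StrictMonoOn (fun s : ℝ => s * Real.exp (-s)) (Set.Iic 1) := by
    refine strictMonoOn_of_deriv_pos (convex_Iic 1) (by fun_prop) fun s hs => ?_
    rw [interior_Iic] at hs
    have hd : HasDerivAt (fun s : ℝ => s * Real.exp (-s))
        (1 * Real.exp (-s) + s * (Real.exp (-s) * (-1))) s :=
      (hasDerivAt_id s).mul ((hasDerivAt_neg s).exp)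
    rw [hd.deriv]
    have := Real.exp_pos (-s)
    have : (0 : ℝ) < 1 - s := by linarith [Set.mem_Iio.1 hs]
    nlinarith [mul_pos this (Real.exp_pos (-s))]
  have := hinj.injOn (Set.mem_Iic.2 ht1.le) (Set.mem_Iic.2 hα1.le) hfe'
  rw [this]

/-! ### Random variables with values in `ℕ` -/

section Discrete

variable {Ω : Type*} [MeasurableSpace Ω] {μ : Measure Ω} {N : Ω → ℕ}
  {E : Type*} [NormedAddCommGroup E]

theorem map_nat_eq_sum_dirac (hN : Measurable N) :
    μ.map N = Measure.sum fun k => μ {ω | N ω = k} • Measure.dirac k := by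
  rw [← Measure.sum_smul_dirac (μ.map N)]
  congr 1
  ext1 k
  rw [Measure.map_apply hN (measurableSet_singleton k)]
  rfl

variable [IsFiniteMeasure μ]

theorem integrable_comp_nat_iff (hN : Measurable N) (f : ℕ → E) :
    Integrable (fun ω => f (N ω)) μ ↔ Summable fun k => μ.real {ω | N ω = k} * ‖f k‖ := by
  have h := integrable_map_measure (μ := μ) (f := N) (g := f)
    AEStronglyMeasurable.of_discrete hN.aemeasurable
  change Integrable (f ∘ N) μ ↔ _
  rw [← h, map_nat_eq_sum_dirac hN, integrable_sum_dirac_iff (fun _ => measure_ne_top _ _)]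
  rfl

theorem hasSum_integral_comp_nat [NormedSpace ℝ E] [CompleteSpace E] (hN : Measurable N)
    (f : ℕ → E) (hf : Summable fun k => μ.real {ω | N ω = k} * ‖f k‖) :
    HasSum (fun k => μ.real {ω | N ω = k} • f k) (∫ ω, f (N ω) ∂μ) := by
  have h := hasSum_integral_sum_dirac (f := f) (x := fun k : ℕ => k)
    (c := fun k => μ {ω | N ω = k}) (fun _ => measure_ne_top _ _) hf
  rw [← map_nat_eq_sum_dirac hN, integral_map hN.aemeasurable
    AEStronglyMeasurable.of_discrete] at h
  exact h

theorem summable_measureReal_nat (hN : Measurable N) :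
    Summable fun k => μ.real {ω | N ω = k} := by
  have := (integrable_comp_nat_iff (μ := μ) hN (fun _ => (1 : ℝ))).1 (integrable_const _)
  simpa using this

theorem tsum_measureReal_nat {Ω : Type*} [MeasurableSpace Ω] {μ : Measure Ω}
    [IsProbabilityMeasure μ] {N : Ω → ℕ} (hN : Measurable N) :
    ∑' k, μ.real {ω | N ω = k} = 1 := by
  have := hasSum_integral_comp_nat (μ := μ) hN (fun _ => (1 : ℝ))
    (by simpa using summable_measureReal_nat hN)
  simpa using this.tsum_eq

end Discrete

/-! ### Measurability -/

theorem measurable_sum_eval (s : Finset ℤ) : Measurable fun x : ℤ → ℕ => ∑ k ∈ s, x k :=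
  Finset.measurable_fun_sum s fun k _ => measurable_pi_apply k

theorem measurableSet_firstBlock (b : ℕ) (a : ℤ) (k : ℕ) :
    MeasurableSet {x : ℤ → ℕ | FirstBlock b x a k} := by
  simp only [FirstBlock, Set.ofPred_and, Set.ofPred_forall]
  refine MeasurableSet.inter (MeasurableSet.const _) (MeasurableSet.inter ?_ ?_)
  · refine MeasurableSet.iInter fun j => MeasurableSet.iInter fun _ => MeasurableSet.iInter fun _ => ?_
    exact measurableSet_le measurable_const (measurable_sum_eval _)
  · exact measurableSet_lt (measurable_sum_eval _) measurable_const

theorem measurableSet_isFull {b : ℕ} (hb : 0 < b) (i : ℤ) :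
    MeasurableSet {x : ℤ → ℕ | IsFull b x i} := by
  simp only [isFull_iff_exists_sum hb, Set.ofPred_and, Set.ofPred_exists]
  refine MeasurableSet.iUnion fun j => MeasurableSet.inter (MeasurableSet.const _) ?_
  exact measurableSet_le measurable_const (measurable_sum_eval _)

theorem measurableSet_mem_block {b : ℕ} (hb : 0 < b) (i j : ℤ) :
    MeasurableSet {x : ℤ → ℕ | j ∈ block b x i} := by
  change MeasurableSet {x : ℤ → ℕ | ∀ k, min i j ≤ k → k < max i j → IsFull b x k}
  simp only [Set.ofPred_forall]
  exact MeasurableSet.iInter fun k => MeasurableSet.iInter fun _ => MeasurableSet.iInter fun _ =>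
    measurableSet_isFull hb k

/-- There are only countably many finite subsets of `ℤ`, so each fibre is a countable union over the
possible blocks; the fibre over `0` also collects the infinite blocks, where `ncard` defaults to
`0`. -/
theorem measurable_blockLength {b : ℕ} (hb : 0 < b) (i : ℤ) :
    Measurable fun x : ℤ → ℕ => blockLength b x i := by
  have hS : ∀ s : Finset ℤ, MeasurableSet {x : ℤ → ℕ | block b x i = s} := by
    intro s
    have : {x : ℤ → ℕ | block b x i = s}
        = ⋂ j : ℤ, {x | j ∈ block b x i ↔ j ∈ s} := by
      ext x; simp [Set.ext_iff]
    rw [this]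
    exact MeasurableSet.iInter fun j => (measurableSet_mem_block hb i j).iff (MeasurableSet.const _)
  refine measurable_to_countable' fun k => ?_
  have : (fun x : ℤ → ℕ => blockLength b x i) ⁻¹' {k}
      = (⋃ s : Finset ℤ, {x | s.card = k} ∩ {x | block b x i = s}) ∪
        ({x | k = 0} ∩ ⋂ s : Finset ℤ, {x | block b x i = s}ᶜ) := by
    ext x
    simp only [Set.mem_preimage, Set.mem_singleton_iff, blockLength, Set.mem_union, Set.mem_iUnion,
      Set.mem_inter_iff, Set.mem_ofPred_eq, Set.mem_iInter, Set.mem_compl_iff]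
    by_cases hf : (block b x i).Finite
    · lift block b x i to Finset ℤ using hf with t
      rw [Set.ncard_coe_finset]
      constructor
      · intro h; exact Or.inl ⟨t, h, rfl⟩
      · rintro (⟨s, h1, h2⟩ | ⟨_, h⟩)
        · rw [← h1, Finset.coe_inj.1 h2]
        · exact absurd rfl (h t)
    · rw [Set.Infinite.ncard hf]
      constructor
      · rintro rfl
        exact Or.inr ⟨rfl, fun s hs => hf (hs ▸ s.finite_toSet)⟩
      · rintro (⟨s, h1, h2⟩ | ⟨h, _⟩)
        · exact absurd (h2 ▸ s.finite_toSet) hf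
        · exact h.symm
  rw [this]
  exact (MeasurableSet.iUnion fun s => (MeasurableSet.const _).inter (hS s)).union
    ((MeasurableSet.const _).inter (MeasurableSet.iInter fun s => (hS s).compl))

theorem measurable_firstBlockLength (b : ℕ) :
    Measurable fun x : ℤ → ℕ => firstBlockLength b (fun i : ℕ => x i) := by
  have hpos : ∀ k : ℕ, 1 ≤ k →
      MeasurableSet ((fun x : ℤ → ℕ => firstBlockLength b (fun i : ℕ => x i)) ⁻¹' {k}) := by
    intro k hk
    convert! measurableSet_firstBlock b 0 k using 1
    ext x
    exact firstBlockLength_eq_iff b x hk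
  refine measurable_to_countable' fun k => ?_
  rcases Nat.eq_zero_or_pos k with rfl | hk
  · have : (fun x : ℤ → ℕ => firstBlockLength b (fun i : ℕ => x i)) ⁻¹' {0}
        = ⋂ k : ℕ, ((fun x : ℤ → ℕ => firstBlockLength b (fun i : ℕ => x i)) ⁻¹' {k + 1})ᶜ := by
      ext x
      simp only [Set.mem_preimage, Set.mem_singleton_iff, Set.mem_iInter, Set.mem_compl_iff]
      constructor
      · intro h k; omega
      · intro h
        by_contra h0
        exact h (firstBlockLength b (fun i : ℕ => x i) - 1) (by omega)
    rw [this]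
    exact MeasurableSet.iInter fun k => (hpos (k + 1) (by omega)).compl
  · exact hpos k hk

/-! ### The infinite Poisson model -/

/-- The decay rate `(α e ^ (1 - α)) ^ b` of the tails, which is the inverse of the radius `R`. -/
noncomputable def decayRate (b : ℕ) (α : ℝ) : ℝ := (α * Real.exp (1 - α)) ^ b

theorem decayRate_pos (b : ℕ) {α : ℝ} (hα0 : 0 < α) : 0 < decayRate b α := by
  unfold decayRate; positivity

theorem decayRate_lt_one {b : ℕ} (hb : 0 < b) {α : ℝ} (hα0 : 0 < α) (hα1 : α < 1) :
    decayRate b α < 1 := by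
  refine pow_lt_one₀ (by positivity) ?_ hb.ne'
  have h := Real.add_one_lt_exp (show α - 1 ≠ 0 by linarith)
  have h2 : α < Real.exp (α - 1) := by linarith
  calc α * Real.exp (1 - α) < Real.exp (α - 1) * Real.exp (1 - α) := by gcongr
    _ = 1 := by rw [← Real.exp_add]; simp

theorem inv_decayRate (b : ℕ) (α : ℝ) : (decayRate b α)⁻¹ = (Real.exp (α - 1) / α) ^ b := by
  rw [decayRate, ← inv_pow, mul_inv, ← Real.exp_neg, neg_sub, div_eq_mul_inv, mul_comm]

/-- The numbers of keys with given hash addresses in the infinite Poisson model. -/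
structure IsPoissonTable (b : ℕ) (α : ℝ) {Ω : Type*} [MeasurableSpace Ω] (μ : Measure Ω)
    (X : ℤ → Ω → ℕ) : Prop where
  measurable : ∀ i, Measurable (X i)
  indep : iIndepFun X μ
  law : ∀ i, μ.map (X i) = poissonMeasure (b * α).toNNReal

section Poisson

variable {b : ℕ} {α : ℝ} {Ω : Type*} [MeasurableSpace Ω] {μ : Measure Ω}
  {X : ℤ → Ω → ℕ}

theorem IsPoissonTable.measurable_table (h : IsPoissonTable b α μ X) :
    Measurable fun ω => (fun j => X j ω : ℤ → ℕ) :=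
  measurable_pi_iff.2 h.measurable

theorem IsPoissonTable.integral_pow (h : IsPoissonTable b α μ X) (hα0 : 0 < α) (i : ℤ) (z : ℂ) :
    Integrable (fun ω => z ^ X i ω) μ ∧ ∫ ω, z ^ X i ω ∂μ = Complex.exp (b * α * (z - 1)) := by
  have hl : ((b * α).toNNReal : ℝ) = b * α := Real.coe_toNNReal _ (by positivity)
  have hs := NormedSpace.expSeries_div_hasSum_exp (𝔸 := ℂ) ((b * α : ℝ) * z)
  have hint : Integrable (fun n : ℕ => z ^ n) (μ.map (X i)) := by
    rw [h.law, integrable_poissonMeasure_iff, hl]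
    have := NormedSpace.expSeries_div_hasSum_exp (𝔸 := ℝ) ((b * α) * ‖z‖)
    refine (this.summable.mul_left (Real.exp (-(b * α)))).congr fun n => ?_
    rw [norm_pow, mul_pow]; ring
  have hms : AEStronglyMeasurable (fun n : ℕ => z ^ n) (μ.map (X i)) := hint.aestronglyMeasurable
  refine ⟨(integrable_map_measure hms (h.measurable i).aemeasurable).1 hint, ?_⟩
  have e := integral_map (h.measurable i).aemeasurable hms
  rw [← e, h.law, integral_poissonMeasure, hl]
  calc _ = ∑' n : ℕ, Complex.exp (-(b * α)) * ((((b * α : ℝ) : ℂ) * z) ^ n / n.factorial) := by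
        refine tsum_congr fun n => ?_
        rw [Complex.real_smul]
        push_cast
        rw [mul_pow]; ring
    _ = _ := by
        rw [tsum_mul_left, hs.tsum_eq, ← Complex.exp_eq_exp_ℂ, ← Complex.exp_add]
        congr 1; push_cast; ring

variable [IsProbabilityMeasure μ]

theorem IsPoissonTable.integral_pow_sum (h : IsPoissonTable b α μ X) (hα0 : 0 < α) (s : Finset ℤ)
    (z : ℂ) : Integrable (fun ω => z ^ ∑ k ∈ s, X k ω) μ ∧
      ∫ ω, z ^ ∑ k ∈ s, X k ω ∂μ = Complex.exp (b * α * (z - 1)) ^ s.card := by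
  induction s using Finset.induction_on with
  | empty => simp
  | insert i s hi ih =>
    have hind : IndepFun (fun ω => z ^ X i ω) (fun ω => z ^ ∑ k ∈ s, X k ω) μ := by
      have h1 := (h.indep.indepFun_finsetSum_of_notMem h.measurable hi).symm
      have h2 := h1.comp (φ := fun n : ℕ => z ^ n) (ψ := fun n : ℕ => z ^ n)
        (measurable_of_countable _) (measurable_of_countable _)
      convert! h2 using 1
      ext ω; simp
    obtain ⟨h1, h2⟩ := h.integral_pow hα0 i z
    simp only [Finset.sum_insert hi, pow_add, Finset.card_insert_of_notMem hi]
    refine ⟨hind.integrable_mul h1 ih.1, ?_⟩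
    rw [hind.integral_fun_mul_eq_mul_integral h1.aestronglyMeasurable ih.1.aestronglyMeasurable,
      h2, ih.2]
    ring

/-- The exponential moment of a window, for real arguments. -/
theorem IsPoissonTable.integral_real_pow_sum (h : IsPoissonTable b α μ X) (hα0 : 0 < α)
    (s : Finset ℤ) (z : ℝ) : Integrable (fun ω => z ^ ∑ k ∈ s, X k ω) μ ∧
      ∫ ω, z ^ ∑ k ∈ s, X k ω ∂μ = Real.exp (b * α * (z - 1)) ^ s.card := by
  obtain ⟨h1, h2⟩ := h.integral_pow_sum hα0 s z
  constructor
  · have := h1.re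
    refine this.congr (Eventually.of_forall fun ω => ?_)
    simp only [← Complex.ofReal_pow]
    exact Complex.ofReal_re _
  · have : ((∫ ω, z ^ ∑ k ∈ s, X k ω ∂μ : ℝ) : ℂ) = _ := integral_complex_ofReal.symm
    push_cast at this
    rw [h2] at this
    exact_mod_cast this

/-- The base `z = 1 / α` minimizes `z ^ (-b) e ^ (bα (z - 1))` over `z > 0`, and the minimum is the
decay rate. -/
theorem pow_mul_exp_eq_decayRate (hα0 : 0 < α) (l : ℕ) :
    Real.exp (b * α * (1 / α - 1)) ^ l * α ^ (b * l) = decayRate b α ^ l := by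
  rw [decayRate, ← pow_mul, mul_pow, ← Real.exp_nat_mul, ← Real.exp_nat_mul, mul_comm]
  congr 2
  push_cast
  field_simp

/-- Chernoff's bound for the number of keys in a window. -/
theorem IsPoissonTable.measure_window_le (h : IsPoissonTable b α μ X) (hα0 : 0 < α) (hα1 : α < 1)
    (s : Finset ℤ) (K : ℕ) :
    μ.real {ω | b * s.card ≤ ∑ k ∈ s, X k ω + K} ≤ (1 / α) ^ K * decayRate b α ^ s.card := by
  obtain ⟨h1, h2⟩ := h.integral_real_pow_sum hα0 s (1 / α)
  have hm := mul_meas_ge_le_integral_of_nonneg (μ := μ)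
    (f := fun ω => (1 / α) ^ K * (1 / α) ^ ∑ k ∈ s, X k ω)
    (Eventually.of_forall fun ω => by positivity) (h1.const_mul _) ((1 / α) ^ (b * s.card))
  rw [integral_const_mul, h2] at hm
  have hone : 1 ≤ 1 / α := by rw [le_div_iff₀ hα0]; linarith
  have hsub : μ.real {ω | b * s.card ≤ ∑ k ∈ s, X k ω + K}
      ≤ μ.real {ω | (1 / α) ^ (b * s.card) ≤ (1 / α) ^ K * (1 / α) ^ ∑ k ∈ s, X k ω} := by
    refine measureReal_mono fun ω hω => ?_
    simp only [Set.mem_ofPred_eq] at hω ⊢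
    rw [← pow_add, add_comm K]
    exact pow_le_pow_right₀ hone hω
  rw [← pow_mul_exp_eq_decayRate hα0]
  have hp : (1 / α) ^ (b * s.card) * α ^ (b * s.card) = 1 := by
    rw [← mul_pow, one_div_mul_cancel hα0.ne', one_pow]
  calc _ ≤ _ := hsub
    _ = ((1 / α) ^ (b * s.card) * μ.real {ω | (1 / α) ^ (b * s.card)
          ≤ (1 / α) ^ K * (1 / α) ^ ∑ k ∈ s, X k ω}) * α ^ (b * s.card) := by
        rw [mul_right_comm, hp, one_mul]
    _ ≤ ((1 / α) ^ K * Real.exp (b * α * (1 / α - 1)) ^ s.card) * α ^ (b * s.card) := by gcongr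
    _ = _ := by ring

/-- Borel–Cantelli with the Chernoff bound. Only the sizes of the windows matter, so this serves
both directions of the walk. -/
theorem IsPoissonTable.ae_eventually_window_lt (h : IsPoissonTable b α μ X) (hb : 0 < b)
    (hα0 : 0 < α) (hα1 : α < 1) (s : ℕ → Finset ℤ) (hs : ∀ l, (s l).card = l) :
    ∀ᵐ ω ∂μ, ∀ K : ℕ, ∀ᶠ l in atTop, ∑ k ∈ s l, X k ω + K < b * l := by
  rw [ae_all_iff]
  intro K
  have hsum : ∑' l, μ {ω | b * l ≤ ∑ k ∈ s l, X k ω + K} ≠ ⊤ := by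
    have hle : ∀ l, μ {ω | b * l ≤ ∑ k ∈ s l, X k ω + K}
        ≤ ENNReal.ofReal ((1 / α) ^ K * decayRate b α ^ l) := by
      intro l
      have := h.measure_window_le hα0 hα1 (s l) K
      rw [hs] at this
      rw [← ofReal_measureReal]
      exact ENNReal.ofReal_le_ofReal this
    refine ne_top_of_le_ne_top ?_ (ENNReal.tsum_le_tsum hle)
    have hsm := (summable_geometric_of_lt_one (decayRate_pos b hα0).le
      (decayRate_lt_one hb hα0 hα1)).mul_left ((1 / α) ^ K)
    exact hsm.tsum_ofReal_ne_top
  filter_upwards [ae_eventually_notMem hsum] with ω hω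
  filter_upwards [hω] with l hl
  simpa using hl

/-- Almost surely the walk tends to `∞` on the left and to `-∞` on the right. -/
theorem IsPoissonTable.ae_walk (h : IsPoissonTable b α μ X) (hb : 0 < b)
    (hα0 : 0 < α) (hα1 : α < 1) :
    ∀ᵐ ω ∂μ, (∀ C : ℤ, ∃ j₀ : ℤ, ∀ j ≤ j₀, C ≤ walk b (fun j => X j ω) j) ∧
      ∀ C : ℤ, ∀ j₀ : ℤ, ∃ j ≥ j₀, walk b (fun j => X j ω) j ≤ C := by
  have hL := h.ae_eventually_window_lt hb hα0 hα1 (fun l => Finset.Ioc (-(l : ℤ)) 0)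
    (fun l => by simp)
  have hR := h.ae_eventually_window_lt hb hα0 hα1 (fun l => Finset.Ioc 0 (l : ℤ))
    (fun l => by simp)
  filter_upwards [hL, hR] with ω h1 h2
  have h0 : walk b (fun j => X j ω) 0 = 0 := by simp [walk]
  constructor
  · intro C
    obtain ⟨l₀, hl₀⟩ := eventually_atTop.1 (h1 C.toNat)
    refine ⟨-l₀, fun j hj => ?_⟩
    have h3 := hl₀ (-j).toNat (by omega)
    have h4 := walk_add_nat b (fun j => X j ω) j (-j).toNat
    rw [show j + ((-j).toNat : ℤ) = 0 by omega, h0] at h4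
    rw [show -(((-j).toNat : ℕ) : ℤ) = j by omega] at h3
    zify at h3
    have := Int.self_le_toNat C
    push_cast at h4 h3
    linarith
  · intro C j₀
    obtain ⟨l₀, hl₀⟩ := eventually_atTop.1 (h2 (-C).toNat)
    refine ⟨max l₀ j₀.toNat, by omega, ?_⟩
    have h3 := hl₀ (max l₀ j₀.toNat) (by omega)
    have h4 := walk_add_nat b (fun j => X j ω) 0 (max l₀ j₀.toNat)
    rw [zero_add, h0, zero_add] at h4
    zify at h3
    have := Int.self_le_toNat (-C)
    push_cast at h4 h3 ⊢
    linarith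

end Poisson

/-! ### Translations -/

theorem sum_Ioc_shift (x : ℤ → ℕ) (a c d : ℤ) :
    ∑ k ∈ Finset.Ioc c d, x (k + a) = ∑ k ∈ Finset.Ioc (c + a) (d + a), x k := by
  rw [← Finset.map_add_right_Ioc, Finset.sum_map]
  rfl

theorem firstBlock_shift (b : ℕ) (x : ℤ → ℕ) (a c : ℤ) (k : ℕ) :
    FirstBlock b (fun j => x (j + a)) c k ↔ FirstBlock b x (c + a) k := by
  simp only [FirstBlock, sum_Ioc_shift]
  refine and_congr_right fun _ => and_congr (forall_congr' fun j => ?_) ?_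
  · rw [add_right_comm]
  · rw [add_right_comm]

theorem isFull_shift {b : ℕ} (hb : 0 < b) (x : ℤ → ℕ) (a i : ℤ) :
    IsFull b (fun j => x (j + a)) i ↔ IsFull b x (i + a) := by
  simp only [isFull_iff_exists_sum hb, sum_Ioc_shift]
  refine exists_congr fun l => ?_
  rw [sub_add_eq_add_sub]

/-- The law of the block length, by the position of the block. -/
theorem measure_blockLength_eq_sum {b : ℕ} (hb : 0 < b) {Ω : Type*} [MeasurableSpace Ω]
    {μ : Measure Ω} [IsFiniteMeasure μ] {Y : Ω → ℤ → ℕ} (hY : Measurable Y)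
    (hwalk : ∀ᵐ ω ∂μ, (∀ C : ℤ, ∃ j₀ : ℤ, ∀ j ≤ j₀, C ≤ walk b (Y ω) j) ∧
      ∀ C : ℤ, ∀ j₀ : ℤ, ∃ j ≥ j₀, walk b (Y ω) j ≤ C) (i : ℤ) (k : ℕ) :
    μ.real {ω | blockLength b (Y ω) i = k} = ∑ r ∈ Finset.range k,
      μ.real {ω | FirstBlock b (Y ω) (i - 1 - r) k ∧ ¬ IsFull b (Y ω) (i - 1 - r)} := by
  rw [← measureReal_biUnion_finset]
  · apply measureReal_congr
    filter_upwards [hwalk] with ω hω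
    have := blockLength_eq_iff hb hω.1 hω.2 i k
    apply propext
    change blockLength b (Y ω) i = k ↔ ω ∈ ⋃ r ∈ Finset.range k, _
    rw [this]
    simp [and_left_comm]
  · intro r hr s hs hrs
    rw [Function.onFun, Set.disjoint_left]
    intro ω h1 h2
    exact hrs (firstBlock_start_unique hb (Finset.mem_range.1 hr) (Finset.mem_range.1 hs)
      h1.1 h1.2 h2.1 h2.2)
  · intro r _
    exact ((measurableSet_firstBlock b _ k).inter (measurableSet_isFull hb _).compl).preimage hY

theorem measurable_sum_iSup_comap {Ω : Type*} (X : ℤ → Ω → ℕ) (S : Set ℤ) (s : Finset ℤ)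
    (hs : ∀ k ∈ s, k ∈ S) :
    Measurable[⨆ j ∈ S, MeasurableSpace.comap (X j) inferInstance] fun ω => ∑ k ∈ s, X k ω := by
  refine Finset.measurable_fun_sum s fun k hk => ?_
  have h1 : MeasurableSpace.comap (X k) inferInstance
      ≤ ⨆ j ∈ S, MeasurableSpace.comap (X j) inferInstance := le_iSup₂_of_le k (hs k hk) le_rfl
  exact (comap_measurable (X k)).mono h1 le_rfl

/-! ### Stationarity, independence and the size-biased law. -/

section Poisson

variable {b : ℕ} {α : ℝ} {Ω : Type*} [MeasurableSpace Ω] {μ : Measure Ω}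
  {X : ℤ → Ω → ℕ}

/-- The table is stationary. -/
theorem IsPoissonTable.measure_shift (h : IsPoissonTable b α μ X) (a : ℤ) {A : Set (ℤ → ℕ)}
    (hA : MeasurableSet A) :
    μ.real {ω | (fun j => X (j + a) ω) ∈ A} = μ.real {ω | (fun j => X j ω) ∈ A} := by
  have h1 := h.indep.map_fun_eq_infinitePi_map h.measurable
  have hm : ∀ i, Measurable (X (i + a)) := fun i => h.measurable _
  have h2 := (h.indep.precomp (g := fun i : ℤ => i + a)
    (add_left_injective a)).map_fun_eq_infinitePi_map hm
  simp only [h.law] at h1 h2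
  rw [measureReal_def, measureReal_def]
  congr 1
  have e1 := Measure.map_apply h.measurable_table hA (μ := μ)
  have e2 := Measure.map_apply (measurable_pi_iff.2 hm) hA (μ := μ)
  rw [h1] at e1
  rw [h2] at e2
  exact e2.symm.trans e1

theorem IsPoissonTable.measure_isFull (h : IsPoissonTable b α μ X) (hb : 0 < b) (a : ℤ) :
    μ.real {ω | ¬ IsFull b (fun j => X j ω) a} = μ.real {ω | ¬ IsFull b (fun j => X j ω) 0} := by
  have h1 := h.measure_shift a (measurableSet_isFull hb 0).compl
  have h2 : ∀ ω, IsFull b (fun j => X (j + a) ω) 0 ↔ IsFull b (fun j => X j ω) a := fun ω => by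
    simpa using isFull_shift hb (fun j => X j ω) a 0
  simpa only [Set.mem_compl_iff, Set.mem_ofPred_eq, h2] using h1

theorem IsPoissonTable.measure_firstBlock (h : IsPoissonTable b α μ X) (a : ℤ) (k : ℕ) :
    μ.real {ω | FirstBlock b (fun j => X j ω) a k}
      = μ.real {ω | FirstBlock b (fun j => X j ω) 0 k} := by
  have h1 := h.measure_shift a (measurableSet_firstBlock b 0 k)
  have h2 : ∀ ω, FirstBlock b (fun j => X (j + a) ω) 0 k ↔ FirstBlock b (fun j => X j ω) a k :=
    fun ω => by simpa using firstBlock_shift b (fun j => X j ω) a 0 k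
  simpa only [Set.mem_ofPred_eq, h2] using h1

/-- Fullness of bucket `a` is independent of the first block after it. -/
theorem IsPoissonTable.measure_inter (h : IsPoissonTable b α μ X) (hb : 0 < b) (a : ℤ) (k : ℕ) :
    μ.real {ω | FirstBlock b (fun j => X j ω) a k ∧ ¬ IsFull b (fun j => X j ω) a}
      = μ.real {ω | ¬ IsFull b (fun j => X j ω) 0}
        * μ.real {ω | FirstBlock b (fun j => X j ω) 0 k} := by
  set m : ℤ → MeasurableSpace Ω := fun j => MeasurableSpace.comap (X j) inferInstance with hm
  -- Fullness of `a` is decided by windows that end at `a`, the first block by windows that start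
  -- after `a`.
  have hind : Indep (⨆ j ∈ Set.Iic a, m j) (⨆ j ∈ Set.Ioi a, m j) μ :=
    indep_iSup_of_disjoint (fun j => (h.measurable j).comap_le) h.indep
      (Set.Iic_disjoint_Ioi le_rfl)
  have h1 : MeasurableSet[⨆ j ∈ Set.Iic a, m j] {ω | ¬ IsFull b (fun j => X j ω) a} := by
    refine MeasurableSet.compl (m := ⨆ j ∈ Set.Iic a, m j)
      (s := {ω | IsFull b (fun j => X j ω) a}) ?_
    simp only [isFull_iff_exists_sum hb, Set.ofPred_and, Set.ofPred_exists]
    refine MeasurableSet.iUnion fun l => MeasurableSet.inter (MeasurableSet.const _) ?_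
    refine (measurable_sum_iSup_comap X (Set.Iic a) _ fun k hk => ?_) (measurableSet_Ici (a := b * l))
    exact (Finset.mem_Ioc.1 hk).2
  have h2 : MeasurableSet[⨆ j ∈ Set.Ioi a, m j] {ω | FirstBlock b (fun j => X j ω) a k} := by
    simp only [FirstBlock, Set.ofPred_and, Set.ofPred_forall]
    refine MeasurableSet.inter (MeasurableSet.const _) (MeasurableSet.inter ?_ ?_)
    · refine MeasurableSet.iInter fun j => MeasurableSet.iInter fun _ => MeasurableSet.iInter fun _ => ?_
      refine (measurable_sum_iSup_comap X (Set.Ioi a) _ fun k hk => ?_) (measurableSet_Ici (a := b * j))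
      exact (Finset.mem_Ioc.1 hk).1
    · refine (measurable_sum_iSup_comap X (Set.Ioi a) _ fun k hk => ?_) (measurableSet_Iio (a := b * k))
      exact (Finset.mem_Ioc.1 hk).1
  have h3 := (Indep_iff _ _ _).1 hind _ _ h1 h2
  rw [← h.measure_isFull hb a, ← h.measure_firstBlock a k, measureReal_def, measureReal_def,
    measureReal_def, ← ENNReal.toReal_mul, ← h3, Set.inter_comm]
  rfl

theorem IsPoissonTable.measurable_firstBlockLength (h : IsPoissonTable b α μ X) :
    Measurable fun ω => firstBlockLength b (fun i : ℕ => X i ω) :=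
  (LinearProbing.measurable_firstBlockLength b).comp h.measurable_table

theorem IsPoissonTable.measurable_blockLength (h : IsPoissonTable b α μ X) (hb : 0 < b) (i : ℤ) :
    Measurable fun ω => blockLength b (fun j => X j ω) i :=
  (LinearProbing.measurable_blockLength hb i).comp h.measurable_table

theorem measure_firstBlockLength_eq (k : ℕ) (hk : 1 ≤ k) :
    μ.real {ω | firstBlockLength b (fun i : ℕ => X i ω) = k}
      = μ.real {ω | FirstBlock b (fun j => X j ω) 0 k} := by
  congr 1
  ext ω
  exact firstBlockLength_eq_iff b (fun j => X j ω) hk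

variable [IsProbabilityMeasure μ]

theorem IsPoissonTable.ae_firstBlockLength_pos (h : IsPoissonTable b α μ X) (hb : 0 < b)
    (hα0 : 0 < α) (hα1 : α < 1) :
    ∀ᵐ ω ∂μ, 0 < firstBlockLength b (fun i : ℕ => X i ω) := by
  classical
  filter_upwards [h.ae_walk hb hα0 hα1] with ω hω
  obtain ⟨j, hj1, hj2⟩ := hω.2 (-1) 1
  have h0 : walk b (fun j => X j ω) 0 = 0 := by simp [walk]
  have hex : ∃ k : ℕ, 1 ≤ k ∧ walk b (fun j => X j ω) (0 + k) < walk b (fun j => X j ω) 0 := by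
    refine ⟨j.toNat, by omega, ?_⟩
    rw [h0, zero_add, Int.toNat_of_nonneg (by omega)]
    omega
  have hF : FirstBlock b (fun j => X j ω) 0 (Nat.find hex) := by
    rw [firstBlock_iff_walk]
    refine ⟨(Nat.find_spec hex).1, fun j hj1 hj2 => ?_, (Nat.find_spec hex).2⟩
    have := Nat.find_min hex hj2
    push Not at this
    exact this hj1
  rw [(firstBlockLength_eq_iff b (fun j => X j ω) hF.1).2 hF]
  exact hF.1

theorem IsPoissonTable.ae_blockLength_pos (h : IsPoissonTable b α μ X) (hb : 0 < b)
    (hα0 : 0 < α) (hα1 : α < 1) (i : ℤ) :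
    ∀ᵐ ω ∂μ, 0 < blockLength b (fun j => X j ω) i := by
  filter_upwards [h.ae_walk hb hα0 hα1] with ω hω
  exact blockLength_pos hb hω.1 hω.2 i

theorem IsPoissonTable.measure_firstBlockLength_zero (h : IsPoissonTable b α μ X) (hb : 0 < b)
    (hα0 : 0 < α) (hα1 : α < 1) : μ.real {ω | firstBlockLength b (fun i : ℕ => X i ω) = 0} = 0 := by
  have := h.ae_firstBlockLength_pos hb hα0 hα1
  rw [ae_iff] at this
  rw [measureReal_def, ← ENNReal.toReal_zero, ← this]
  congr 2
  ext ω
  simp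

/-- Each of the `k` positions that bucket `i` can have in its block contributes the same
probability; this is the origin of the size bias. The factor `k` makes the convention for length `0`
harmless. -/
theorem IsPoissonTable.measure_blockLength (h : IsPoissonTable b α μ X) (hb : 0 < b)
    (hα0 : 0 < α) (hα1 : α < 1) (i : ℤ) (k : ℕ) :
    μ.real {ω | blockLength b (fun j => X j ω) i = k}
      = μ.real {ω | ¬ IsFull b (fun j => X j ω) 0} *
        (k * μ.real {ω | firstBlockLength b (fun i : ℕ => X i ω) = k}) := by
  rw [measure_blockLength_eq_sum hb h.measurable_table (h.ae_walk hb hα0 hα1)]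
  simp only [h.measure_inter hb, Finset.sum_const, Finset.card_range, nsmul_eq_mul]
  rcases Nat.eq_zero_or_pos k with rfl | hk
  · simp
  · rw [measure_firstBlockLength_eq k hk]; ring

/-! ### Geometric tails and generating functions as power series. -/

/-- The tail bound for the length of the first block. -/
theorem IsPoissonTable.measure_firstBlockLength_le (h : IsPoissonTable b α μ X)
    (hα0 : 0 < α) (hα1 : α < 1) (k : ℕ) :
    μ.real {ω | firstBlockLength b (fun i : ℕ => X i ω) = k + 1} ≤ decayRate b α ^ k := by
  rw [measure_firstBlockLength_eq (k + 1) (by omega)]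
  have h1 := h.measure_window_le hα0 hα1 (Finset.Ioc 0 (k : ℤ)) 0
  simp only [Int.card_Ioc, sub_zero, Int.toNat_natCast, add_zero, pow_zero, one_mul] at h1
  refine le_trans (measureReal_mono fun ω hω => ?_) h1
  simp only [Set.mem_ofPred_eq] at hω ⊢
  rcases Nat.eq_zero_or_pos k with rfl | hk
  · simp
  · simpa using hω.2.1 k hk (by omega)

theorem summable_add_one_pow_mul_geometric (d : ℕ) {x : ℝ} (hx0 : 0 ≤ x) (hx1 : x < 1) :
    Summable fun k : ℕ => (k + 1 : ℝ) ^ d * x ^ k := by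
  have hs := summable_pow_mul_geometric_of_norm_lt_one d
    (r := x) (by rwa [Real.norm_of_nonneg hx0])
  rw [← summable_nat_add_iff 1] at hs ⊢
  refine Summable.of_nonneg_of_le (fun k => by positivity) (fun k => ?_) (hs.mul_left (2 ^ d))
  rw [← mul_assoc, ← mul_pow]
  gcongr
  push_cast
  linarith [(Nat.cast_nonneg k : (0 : ℝ) ≤ k)]

theorem IsPoissonTable.measure_firstBlockLength_le' (h : IsPoissonTable b α μ X) (hb : 0 < b)
    (hα0 : 0 < α) (hα1 : α < 1) (k : ℕ) :
    μ.real {ω | firstBlockLength b (fun i : ℕ => X i ω) = k}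
      ≤ (decayRate b α)⁻¹ * decayRate b α ^ k := by
  have hρ := decayRate_pos b hα0
  rcases k with _ | k
  · rw [h.measure_firstBlockLength_zero hb hα0 hα1]; positivity
  · rw [pow_succ', inv_mul_cancel_left₀ hρ.ne']
    exact h.measure_firstBlockLength_le hα0 hα1 k

theorem IsPoissonTable.summable_firstBlockLength (h : IsPoissonTable b α μ X) (hb : 0 < b)
    (hα0 : 0 < α) (hα1 : α < 1) (d : ℕ) {r : ℝ} (hr0 : 0 ≤ r) (hr : decayRate b α * r < 1) :
    Summable fun k : ℕ => (k + 1 : ℝ) ^ d *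
      μ.real {ω | firstBlockLength b (fun i : ℕ => X i ω) = k} * r ^ k := by
  have hρ := decayRate_pos b hα0
  refine Summable.of_nonneg_of_le (fun k => by positivity) (fun k => ?_)
    ((summable_add_one_pow_mul_geometric d (by positivity) hr).mul_left (decayRate b α)⁻¹)
  calc _ ≤ (k + 1 : ℝ) ^ d * ((decayRate b α)⁻¹ * decayRate b α ^ k) * r ^ k := by
        gcongr
        exact h.measure_firstBlockLength_le' hb hα0 hα1 k
    _ = _ := by rw [mul_pow]; ring

/-- The probability that a bucket is not full is the inverse of the mean first block length. -/
theorem IsPoissonTable.integral_firstBlockLength (h : IsPoissonTable b α μ X) (hb : 0 < b)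
    (hα0 : 0 < α) (hα1 : α < 1) :
    Integrable (fun ω => (firstBlockLength b (fun i : ℕ => X i ω) : ℝ)) μ ∧
      μ.real {ω | ¬ IsFull b (fun j => X j ω) 0} *
        ∫ ω, (firstBlockLength b (fun i : ℕ => X i ω) : ℝ) ∂μ = 1 := by
  have hs := h.summable_firstBlockLength hb hα0 hα1 1 (r := 1) zero_le_one
    (by simpa using decayRate_lt_one hb hα0 hα1)
  have hs' : Summable fun k : ℕ => μ.real {ω | firstBlockLength b (fun i : ℕ => X i ω) = k} *
      ‖(k : ℝ)‖ := by
    refine Summable.of_nonneg_of_le (fun k => by positivity) (fun k => ?_) hs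
    rw [Real.norm_natCast, mul_comm, one_pow, mul_one, pow_one]
    gcongr
    linarith
  refine ⟨(integrable_comp_nat_iff h.measurable_firstBlockLength (fun k : ℕ => (k : ℝ))).2 hs', ?_⟩
  have h1 := hasSum_integral_comp_nat h.measurable_firstBlockLength (fun k : ℕ => (k : ℝ)) hs'
  -- The total mass of the size-biased law is `p E B`, so it has to be one.
  have h2 := tsum_measureReal_nat (μ := μ) (h.measurable_blockLength hb 0)
  simp only [h.measure_blockLength hb hα0 hα1, tsum_mul_left] at h2
  rw [← h1.tsum_eq, ← h2]
  congr 1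
  exact tsum_congr fun k => by rw [smul_eq_mul, mul_comm]

/-- The generating function of the first block length is a power series, and so differentiable. -/
theorem IsPoissonTable.pgf_firstBlockLength (h : IsPoissonTable b α μ X) (hb : 0 < b)
    (hα0 : 0 < α) (hα1 : α < 1) {q : ℂ} (hq : decayRate b α * ‖q‖ < 1) :
    Integrable (fun ω => q ^ firstBlockLength b (fun i : ℕ => X i ω)) μ ∧
    ∫ ω, q ^ firstBlockLength b (fun i : ℕ => X i ω) ∂μ
      = ∑' k : ℕ, (μ.real {ω | firstBlockLength b (fun i : ℕ => X i ω) = k} : ℂ) * q ^ k := by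
  have hs := h.summable_firstBlockLength hb hα0 hα1 0 (norm_nonneg q) hq
  have hs' : Summable fun k : ℕ => μ.real {ω | firstBlockLength b (fun i : ℕ => X i ω) = k} *
      ‖q ^ k‖ := by
    refine hs.congr fun k => ?_
    rw [norm_pow, pow_zero, one_mul]
  refine ⟨(integrable_comp_nat_iff h.measurable_firstBlockLength (fun k : ℕ => q ^ k)).2 hs', ?_⟩
  have h1 := hasSum_integral_comp_nat h.measurable_firstBlockLength (fun k : ℕ => q ^ k) hs'
  rw [← h1.tsum_eq]
  exact tsum_congr fun k => by rw [Complex.real_smul]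

theorem IsPoissonTable.hasDerivAt_pgf_firstBlockLength (h : IsPoissonTable b α μ X) (hb : 0 < b)
    (hα0 : 0 < α) (hα1 : α < 1) {q : ℂ} (hq : ‖q‖ < (decayRate b α)⁻¹) :
    HasDerivAt (fun q : ℂ => ∫ ω, q ^ firstBlockLength b (fun i : ℕ => X i ω) ∂μ)
      (∑' k : ℕ, (μ.real {ω | firstBlockLength b (fun i : ℕ => X i ω) = k} : ℂ) *
        (k * q ^ (k - 1))) q := by
  have hρ := decayRate_pos b hα0
  have hlt : ∀ r : ℝ, r < (decayRate b α)⁻¹ → decayRate b α * r < 1 := by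
    intro r hr
    have := mul_lt_mul_of_pos_left hr hρ
    rwa [mul_inv_cancel₀ hρ.ne'] at this
  have hd := hasDerivAt_tsum_pow
    (c := fun k => (μ.real {ω | firstBlockLength b (fun i : ℕ => X i ω) = k} : ℂ)) (fun r h0 h1 => by
      refine (h.summable_firstBlockLength hb hα0 hα1 1 h0 (hlt r h1)).congr fun k => ?_
      rw [Complex.norm_real, Real.norm_of_nonneg measureReal_nonneg, pow_one]) hq
  refine hd.congr_of_eventuallyEq ?_
  filter_upwards [(isOpen_lt continuous_norm continuous_const).mem_nhds hq] with z hz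
  exact (h.pgf_firstBlockLength hb hα0 hα1 (hlt _ hz)).2

theorem IsPoissonTable.summable_blockLength (h : IsPoissonTable b α μ X) (hb : 0 < b)
    (hα0 : 0 < α) (hα1 : α < 1) (i : ℤ) (d : ℕ) {r : ℝ} (hr0 : 0 ≤ r)
    (hr : decayRate b α * r < 1) :
    Summable fun k : ℕ => (k + 1 : ℝ) ^ d *
      μ.real {ω | blockLength b (fun j => X j ω) i = k} * r ^ k := by
  have hs := (h.summable_firstBlockLength hb hα0 hα1 (d + 1) hr0 hr).mul_left
    (μ.real {ω | ¬ IsFull b (fun j => X j ω) 0})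
  refine Summable.of_nonneg_of_le (fun k => by positivity) (fun k => ?_) hs
  rw [h.measure_blockLength hb hα0 hα1]
  calc _ ≤ (k + 1 : ℝ) ^ d * (μ.real {ω | ¬ IsFull b (fun j => X j ω) 0} *
        ((k + 1) * μ.real {ω | firstBlockLength b (fun i : ℕ => X i ω) = k})) * r ^ k := by
        gcongr; linarith
    _ = _ := by ring

theorem IsPoissonTable.pgf_blockLength (h : IsPoissonTable b α μ X) (hb : 0 < b)
    (hα0 : 0 < α) (hα1 : α < 1) (i : ℤ) {q : ℂ} (hq : decayRate b α * ‖q‖ < 1) :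
    Integrable (fun ω => q ^ blockLength b (fun j => X j ω) i) μ ∧
    ∫ ω, q ^ blockLength b (fun j => X j ω) i ∂μ
      = μ.real {ω | ¬ IsFull b (fun j => X j ω) 0} * q *
        ∑' k : ℕ, (μ.real {ω | firstBlockLength b (fun i : ℕ => X i ω) = k} : ℂ) *
          (k * q ^ (k - 1)) := by
  have hs := h.summable_blockLength hb hα0 hα1 i 0 (norm_nonneg q) hq
  have hs' : Summable fun k : ℕ => μ.real {ω | blockLength b (fun j => X j ω) i = k} *
      ‖q ^ k‖ := by
    refine hs.congr fun k => ?_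
    rw [norm_pow, pow_zero, one_mul]
  refine ⟨(integrable_comp_nat_iff (h.measurable_blockLength hb i) (fun k : ℕ => q ^ k)).2 hs', ?_⟩
  have h1 := hasSum_integral_comp_nat (h.measurable_blockLength hb i) (fun k : ℕ => q ^ k) hs'
  rw [← h1.tsum_eq, ← tsum_mul_left]
  refine tsum_congr fun k => ?_
  rw [Complex.real_smul, h.measure_blockLength hb hα0 hα1]
  rcases k with _ | k
  · simp
  · rw [Nat.add_sub_cancel, pow_succ]
    push_cast
    ring

end Poisson

/-! ### The kernel method -/

section Poisson

variable {b : ℕ} {α : ℝ} {Ω : Type*} [MeasurableSpace Ω] {μ : Measure Ω}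
  {X : ℤ → Ω → ℕ}

/-- Started empty, the first `i` buckets of the table are full. -/
def AllFull (b : ℕ) (x : ℤ → ℕ) (i : ℕ) : Prop :=
  ∀ j : ℕ, 1 ≤ j → j ≤ i → b * j ≤ ∑ k ∈ Finset.Ioc (0 : ℤ) j, x k

theorem allFull_iff (b : ℕ) (x : ℤ → ℕ) (i : ℕ) :
    AllFull b x i ↔ AllFull b x (i + 1) ∨ FirstBlock b x 0 (i + 1) := by
  simp only [FirstBlock, AllFull, zero_add]
  constructor
  · intro h
    by_cases h1 : b * (i + 1) ≤ ∑ k ∈ Finset.Ioc (0 : ℤ) ((i + 1 : ℕ) : ℤ), x k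
    · left
      intro j hj1 hj2
      rcases Nat.lt_or_ge j (i + 1) with h2 | h2
      · exact h j hj1 (by omega)
      · obtain rfl : j = i + 1 := by omega
        exact h1
    · exact Or.inr ⟨by omega, fun j hj1 hj2 => h j hj1 (by omega), by omega⟩
  · rintro (h | h) j hj1 hj2
    · exact h j hj1 (by omega)
    · exact h.2.1 j hj1 (by omega)

theorem not_allFull_of_firstBlock {b : ℕ} {x : ℤ → ℕ} {i : ℕ} (h : FirstBlock b x 0 i) :
    ¬ AllFull b x i := by
  intro h1
  have h2 := h1 i h.1 le_rfl
  have h3 := h.2.2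
  rw [zero_add] at h3
  omega

/-- The generating function of the walk while all buckets are full. -/
noncomputable def fullGF (b : ℕ) (μ : Measure Ω) (X : ℤ → Ω → ℕ) (i : ℕ) (z : ℂ) : ℂ :=
  ∫ ω, Set.indicator {ω | AllFull b (fun j => X j ω) i}
    (fun ω => z ^ ∑ k ∈ Finset.Ioc (0 : ℤ) i, X k ω) ω ∂μ

/-- The generating function of the walk at the end of a first block of length `i`. -/
noncomputable def firstGF (b : ℕ) (μ : Measure Ω) (X : ℤ → Ω → ℕ) (i : ℕ) (z : ℂ) : ℂ :=
  ∫ ω, Set.indicator {ω | FirstBlock b (fun j => X j ω) 0 i}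
    (fun ω => z ^ ∑ k ∈ Finset.Ioc (0 : ℤ) i, X k ω) ω ∂μ

theorem measurableSet_allFull_iSup {Ω : Type*} (b : ℕ) (X : ℤ → Ω → ℕ) (i : ℕ) :
    MeasurableSet[⨆ j ∈ Set.Iic (i : ℤ), MeasurableSpace.comap (X j) inferInstance]
      {ω | AllFull b (fun j => X j ω) i} := by
  simp only [AllFull, Set.ofPred_forall]
  refine MeasurableSet.iInter fun j => MeasurableSet.iInter fun _ => MeasurableSet.iInter fun hj => ?_
  refine (measurable_sum_iSup_comap X (Set.Iic (i : ℤ)) _ fun k hk => ?_)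
    (measurableSet_Ici (a := b * j))
  have := (Finset.mem_Ioc.1 hk).2
  simp only [Set.mem_Iic]
  omega

theorem IsPoissonTable.measurableSet_allFull (h : IsPoissonTable b α μ X) (i : ℕ) :
    MeasurableSet {ω | AllFull b (fun j => X j ω) i} :=
  iSup₂_le (fun j _ => (h.measurable j).comap_le) _ (measurableSet_allFull_iSup b X i)

theorem IsPoissonTable.measurableSet_firstBlock (h : IsPoissonTable b α μ X) (i : ℕ) :
    MeasurableSet {ω | FirstBlock b (fun j => X j ω) 0 i} :=
  (LinearProbing.measurableSet_firstBlock b 0 i).preimage h.measurable_table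

/-- The law of the first block length `i` together with the number `b (i - 1) + r` of its keys. -/
noncomputable def firstBlockLaw (b : ℕ) (μ : Measure Ω) (X : ℤ → Ω → ℕ) (i r : ℕ) : ℝ :=
  μ.real {ω | FirstBlock b (fun j => X j ω) 0 i ∧
    ∑ k ∈ Finset.Ioc (0 : ℤ) i, X k ω = b * (i - 1) + r}

/-- The first `i - 1` buckets receive at least `b (i - 1)` keys, and the first `i` fewer than `b i`.
Only `b` values of the sum remain, which makes the kernel equation polynomial of degree below `b`.
-/
theorem FirstBlock.exists_sum_eq {b : ℕ} {x : ℤ → ℕ} {i : ℕ} (h : FirstBlock b x 0 i) :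
    ∃ r < b, ∑ k ∈ Finset.Ioc (0 : ℤ) i, x k = b * (i - 1) + r := by
  obtain ⟨h1, h2, h3⟩ := h
  simp only [zero_add] at h2 h3
  obtain ⟨j, rfl⟩ : ∃ j, i = j + 1 := ⟨i - 1, by omega⟩
  have hle : b * j ≤ ∑ k ∈ Finset.Ioc (0 : ℤ) (j + 1 : ℕ), x k := by
    rcases Nat.eq_zero_or_pos j with rfl | hj
    · simp
    · refine (h2 j hj (by omega)).trans (Finset.sum_le_sum_of_subset fun k => ?_)
      simp only [Finset.mem_Ioc]; omega
  rw [mul_add, mul_one] at h3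
  exact ⟨∑ k ∈ Finset.Ioc (0 : ℤ) (j + 1 : ℕ), x k - b * j, by omega, by
    rw [Nat.add_sub_cancel]; omega⟩

theorem IsPoissonTable.measurableSet_firstBlockLaw (h : IsPoissonTable b α μ X) (i r : ℕ) :
    MeasurableSet {ω | FirstBlock b (fun j => X j ω) 0 i ∧
      ∑ k ∈ Finset.Ioc (0 : ℤ) i, X k ω = b * (i - 1) + r} :=
  (h.measurableSet_firstBlock i).inter
    (((measurable_sum_eval (Finset.Ioc (0 : ℤ) i)).comp h.measurable_table)
      (measurableSet_singleton _))

variable [IsProbabilityMeasure μ]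

theorem fullGF_zero (b : ℕ) (X : ℤ → Ω → ℕ) (z : ℂ) : fullGF b μ X 0 z = 1 := by
  have h : ∀ ω, AllFull b (fun j => X j ω) 0 := fun ω j h1 h2 => by omega
  simp [fullGF, h]

/-- The keys of bucket `i + 1` are independent of the first `i` buckets; adding them either keeps
all buckets full or ends the first block. -/
theorem IsPoissonTable.fullGF_mul (h : IsPoissonTable b α μ X) (hα0 : 0 < α) (i : ℕ) (z : ℂ) :
    fullGF b μ X i z * Complex.exp (b * α * (z - 1))
      = fullGF b μ X (i + 1) z + firstGF b μ X (i + 1) z := by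
  set m : ℤ → MeasurableSpace Ω := fun j => MeasurableSpace.comap (X j) inferInstance with hm
  have hind : Indep (⨆ j ∈ Set.Iic (i : ℤ), m j) (⨆ j ∈ Set.Ioi (i : ℤ), m j) μ :=
    indep_iSup_of_disjoint (fun j => (h.measurable j).comap_le) h.indep
      (Set.Iic_disjoint_Ioi le_rfl)
  have hint := (h.integral_pow_sum hα0 (Finset.Ioc (0 : ℤ) i) z).1
  have hint1 := (h.integral_pow_sum hα0 (Finset.Ioc (0 : ℤ) (i + 1 : ℕ)) z).1
  obtain ⟨hX1, hX2⟩ := h.integral_pow hα0 (i + 1) z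
  have hf : Measurable[⨆ j ∈ Set.Iic (i : ℤ), m j]
      (Set.indicator {ω | AllFull b (fun j => X j ω) i}
        (fun ω => z ^ ∑ k ∈ Finset.Ioc (0 : ℤ) i, X k ω)) := by
    refine Measurable.indicator ?_ (measurableSet_allFull_iSup b X i)
    exact (measurable_of_countable fun n : ℕ => z ^ n).comp
      (measurable_sum_iSup_comap X (Set.Iic (i : ℤ)) _ fun k hk => (Finset.mem_Ioc.1 hk).2)
  have hg : Measurable[⨆ j ∈ Set.Ioi (i : ℤ), m j] (fun ω => z ^ X (i + 1) ω) := by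
    have h1 : m (i + 1) ≤ ⨆ j ∈ Set.Ioi (i : ℤ), m j :=
      le_iSup₂_of_le ((i : ℤ) + 1) (by simp) le_rfl
    exact (measurable_of_countable fun n : ℕ => z ^ n).comp
      ((comap_measurable (X (i + 1))).mono h1 le_rfl)
  have hfg : IndepFun (Set.indicator {ω | AllFull b (fun j => X j ω) i}
        (fun ω => z ^ ∑ k ∈ Finset.Ioc (0 : ℤ) i, X k ω)) (fun ω => z ^ X (i + 1) ω) μ :=
    indep_of_indep_of_le_left (indep_of_indep_of_le_right hind hg.comap_le) hf.comap_le
  have hA := h.measurableSet_allFull i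
  have hA1 := h.measurableSet_allFull (i + 1)
  have hF1 := h.measurableSet_firstBlock (i + 1)
  rw [fullGF, ← hX2, ← hfg.integral_fun_mul_eq_mul_integral
    (hint.indicator hA).aestronglyMeasurable hX1.aestronglyMeasurable, fullGF, firstGF,
    ← integral_add (hint1.indicator hA1) (hint1.indicator hF1)]
  refine integral_congr_ae (Eventually.of_forall fun ω => ?_)
  have hI : Finset.Ioc (0 : ℤ) (i + 1 : ℕ) = insert ((i : ℤ) + 1) (Finset.Ioc (0 : ℤ) i) := by
    ext k; simp only [Finset.mem_Ioc, Finset.mem_insert]; omega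
  have hsum : z ^ ∑ k ∈ Finset.Ioc (0 : ℤ) (i + 1 : ℕ), X k ω
      = z ^ (∑ k ∈ Finset.Ioc (0 : ℤ) i, X k ω) * z ^ X (i + 1) ω := by
    rw [hI, Finset.sum_insert (by simp), add_comm, pow_add]
  have hiff := allFull_iff b (fun j => X j ω) i
  classical
  simp only [Set.indicator_apply, Set.mem_ofPred_eq]
  rw [hsum]
  by_cases h1 : AllFull b (fun j => X j ω) (i + 1)
  · have h2 : ¬ FirstBlock b (fun j => X j ω) 0 (i + 1) :=
      fun h2 => not_allFull_of_firstBlock h2 h1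
    simp [h1, h2, hiff.2 (Or.inl h1)]
  · by_cases h2 : FirstBlock b (fun j => X j ω) 0 (i + 1)
    · simp [h1, h2, hiff.2 (Or.inr h2)]
    · simp [h1, h2, hiff]

/-- On the event the key count is `b i + c` with `c ≥ 0`, and `|z| ^ c ≤ (1 / α) ^ c`. Thus the
moment at `1 / α` controls every `z` in the disc and makes the remainder of the telescoping sum
vanish. -/
theorem IsPoissonTable.norm_fullGF_le (h : IsPoissonTable b α μ X) (hα0 : 0 < α) (i : ℕ) {z : ℂ}
    (hz : ‖z‖ ≤ 1 / α) : ‖fullGF b μ X i z‖ ≤ (‖z‖ ^ b * decayRate b α) ^ i := by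
  rcases Nat.eq_zero_or_pos i with rfl | hi
  · simp [fullGF_zero]
  obtain ⟨h1, h2⟩ := h.integral_real_pow_sum hα0 (Finset.Ioc (0 : ℤ) i) (1 / α)
  have hle : ∀ ω, ‖Set.indicator {ω | AllFull b (fun j => X j ω) i}
      (fun ω => z ^ ∑ k ∈ Finset.Ioc (0 : ℤ) i, X k ω) ω‖
      ≤ (‖z‖ ^ (b * i) * α ^ (b * i)) * (1 / α) ^ ∑ k ∈ Finset.Ioc (0 : ℤ) i, X k ω := by
    intro ω
    rw [norm_indicator_eq_indicator_norm]
    by_cases hω : AllFull b (fun j => X j ω) i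
    swap
    · rw [Set.indicator_of_notMem hω]; positivity
    rw [Set.indicator_of_mem hω]
    obtain ⟨c, hc⟩ := Nat.exists_eq_add_of_le (hω i hi le_rfl)
    simp only at hc
    rw [hc, norm_pow, pow_add, pow_add, ← mul_assoc, mul_assoc (‖z‖ ^ (b * i)), ← mul_pow α,
      mul_one_div_cancel hα0.ne', one_pow, mul_one]
    gcongr
  refine (norm_integral_le_of_norm_le (h1.const_mul _) (Eventually.of_forall hle)).trans_eq ?_
  rw [integral_const_mul, h2, mul_assoc, mul_comm (α ^ (b * i))]
  simp only [Int.card_Ioc, sub_zero, Int.toNat_natCast]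
  rw [pow_mul_exp_eq_decayRate hα0, mul_pow, pow_mul]

theorem IsPoissonTable.firstGF_eq_sum (h : IsPoissonTable b α μ X) (i : ℕ) (z : ℂ) :
    firstGF b μ X i z = ∑ r ∈ Finset.range b, (firstBlockLaw b μ X i r : ℂ) *
      z ^ (b * (i - 1) + r) := by
  have hms := h.measurableSet_firstBlockLaw i
  have hpt : ∀ ω, Set.indicator {ω | FirstBlock b (fun j => X j ω) 0 i}
      (fun ω => z ^ ∑ k ∈ Finset.Ioc (0 : ℤ) i, X k ω) ω
      = ∑ r ∈ Finset.range b, Set.indicator {ω | FirstBlock b (fun j => X j ω) 0 i ∧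
          ∑ k ∈ Finset.Ioc (0 : ℤ) i, X k ω = b * (i - 1) + r}
          (fun _ => z ^ (b * (i - 1) + r)) ω := by
    intro ω
    classical
    by_cases hF : FirstBlock b (fun j => X j ω) 0 i
    · obtain ⟨r, hr, hsum⟩ := hF.exists_sum_eq
      rw [Finset.sum_eq_single r]
      · simp only [Set.indicator_apply, Set.mem_ofPred_eq, hF, hsum, and_self, if_true]
      · intro s _ hs
        simp only [Set.indicator_apply, Set.mem_ofPred_eq, hF, hsum, true_and]
        rw [if_neg (by omega)]
      · intro hr'
        exact absurd (Finset.mem_range.2 hr) hr'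
    · simp [hF]
  rw [firstGF, integral_congr_ae (Eventually.of_forall hpt), integral_finsetSum]
  · refine Finset.sum_congr rfl fun r _ => ?_
    rw [integral_indicator_const _ (hms r), Complex.real_smul, firstBlockLaw]
  · intro r _
    exact (integrable_const _).indicator (hms r)

theorem IsPoissonTable.sum_firstBlockLaw (h : IsPoissonTable b α μ X) {i : ℕ} (hi : 1 ≤ i) :
    ∑ r ∈ Finset.range b, firstBlockLaw b μ X i r
      = μ.real {ω | firstBlockLength b (fun i : ℕ => X i ω) = i} := by
  have h1 := h.firstGF_eq_sum i 1
  simp only [one_pow, mul_one] at h1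
  rw [firstGF, integral_congr_ae (g := Set.indicator {ω | FirstBlock b (fun j => X j ω) 0 i}
      (fun _ => (1 : ℂ))) (Eventually.of_forall fun ω => by simp),
    integral_indicator_const _ (h.measurableSet_firstBlock i), Complex.real_smul, mul_one] at h1
  rw [measure_firstBlockLength_eq i hi]
  exact_mod_cast h1.symm

theorem IsPoissonTable.summable_firstBlockLaw (h : IsPoissonTable b α μ X) (hb : 0 < b)
    (hα0 : 0 < α) (hα1 : α < 1) {r : ℕ} (hr : r < b) {q : ℂ} (hq : decayRate b α * ‖q‖ < 1) :
    Summable fun i : ℕ => (firstBlockLaw b μ X (i + 1) r : ℂ) * q ^ (i + 1) := by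
  have hs := h.summable_firstBlockLength hb hα0 hα1 0 (norm_nonneg q) hq
  rw [← summable_nat_add_iff 1] at hs
  refine Summable.of_norm_bounded hs fun i => ?_
  rw [norm_mul, norm_pow, Complex.norm_real, pow_zero, one_mul,
    Real.norm_of_nonneg (show 0 ≤ firstBlockLaw b μ X (i + 1) r from measureReal_nonneg),
    ← h.sum_firstBlockLaw (by omega : 1 ≤ i + 1)]
  gcongr
  exact Finset.single_le_sum (f := fun r => firstBlockLaw b μ X (i + 1) r)
    (fun _ _ => measureReal_nonneg) (Finset.mem_range.2 hr)

/-- The generating function of first blocks that hold `b (i - 1) + r` keys. -/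
noncomputable def firstBlockGF (b : ℕ) (μ : Measure Ω) (X : ℤ → Ω → ℕ) (q : ℂ) (r : ℕ) : ℂ :=
  ∑' i : ℕ, (firstBlockLaw b μ X (i + 1) r : ℂ) * q ^ (i + 1)

theorem IsPoissonTable.sum_firstBlockGF (h : IsPoissonTable b α μ X) (hb : 0 < b)
    (hα0 : 0 < α) (hα1 : α < 1) {q : ℂ} (hq : decayRate b α * ‖q‖ < 1) :
    ∑ r ∈ Finset.range b, firstBlockGF b μ X q r
      = ∫ ω, q ^ firstBlockLength b (fun i : ℕ => X i ω) ∂μ := by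
  have hs : Summable fun k : ℕ =>
      (μ.real {ω | firstBlockLength b (fun i : ℕ => X i ω) = k} : ℂ) * q ^ k := by
    refine Summable.of_norm ((h.summable_firstBlockLength hb hα0 hα1 0 (norm_nonneg q) hq).congr
      fun k => ?_)
    rw [norm_mul, norm_pow, Complex.norm_real, pow_zero, one_mul,
      Real.norm_of_nonneg measureReal_nonneg]
  rw [(h.pgf_firstBlockLength hb hα0 hα1 hq).2, hs.tsum_eq_zero_add,
    h.measure_firstBlockLength_zero hb hα0 hα1]
  simp only [firstBlockGF]
  rw [← Summable.tsum_finsetSum fun r hr =>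
    h.summable_firstBlockLaw hb hα0 hα1 (Finset.mem_range.1 hr) hq]
  simp only [Complex.ofReal_zero, zero_mul, zero_add]
  refine tsum_congr fun i => ?_
  rw [← Finset.sum_mul, ← h.sum_firstBlockLaw (by omega : 1 ≤ i + 1)]
  push_cast
  rfl

/-- Every zero of the kernel `z ^ b - q e ^ (bα (z - 1))` in the disc of radius `1 / α` is a zero of
a polynomial of degree `b`. -/
theorem IsPoissonTable.kernel_zero (h : IsPoissonTable b α μ X) (hb : 0 < b)
    (hα0 : 0 < α) (hα1 : α < 1) {q z : ℂ} (hq : decayRate b α * ‖q‖ < 1) (hz : ‖z‖ ≤ 1 / α)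
    (hz0 : z ≠ 0) (hker : q * Complex.exp (b * α * (z - 1)) = z ^ b) :
    ∑ r ∈ Finset.range b, firstBlockGF b μ X q r * z ^ r = z ^ b := by
  -- With weight `u ^ i`, the vanishing of the kernel makes the recursion `fullGF_mul` telescope.
  set u : ℂ := q / z ^ b with hu
  have hzb : z ^ b ≠ 0 := pow_ne_zero _ hz0
  have hu1 : u * Complex.exp (b * α * (z - 1)) = 1 := by
    rw [hu, div_mul_eq_mul_div, hker, div_self hzb]
  have htel : ∀ n : ℕ, ∑ i ∈ Finset.range n, u ^ (i + 1) * firstGF b μ X (i + 1) z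
      = 1 - u ^ n * fullGF b μ X n z := by
    intro n
    induction n with
    | zero => simp [fullGF_zero]
    | succ n ih =>
      rw [Finset.sum_range_succ, ih]
      have := h.fullGF_mul hα0 n z
      rw [pow_succ]
      linear_combination (u ^ n * fullGF b μ X n z) * hu1 - u ^ n * u * this
  have hlim : Tendsto (fun n => u ^ n * fullGF b μ X n z) atTop (𝓝 0) := by
    refine squeeze_zero_norm (a := fun n => (decayRate b α * ‖q‖) ^ n) (fun n => ?_)
      (tendsto_pow_atTop_nhds_zero_of_lt_one
        (mul_nonneg (decayRate_pos b hα0).le (norm_nonneg q)) hq)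
    rw [norm_mul, norm_pow, hu, norm_div, norm_pow]
    refine (mul_le_mul_of_nonneg_left (h.norm_fullGF_le hα0 n hz) (by positivity)).trans_eq ?_
    have : ‖z‖ ^ b ≠ 0 := pow_ne_zero _ (norm_ne_zero_iff.2 hz0)
    rw [← mul_pow]
    congr 1
    field_simp
  -- Since `z ^ b * u ^ (i + 1) * z ^ (b * i) = q ^ (i + 1)`, only the power `z ^ r` with `r < b` is
  -- left.
  have hterm : ∀ i : ℕ, z ^ b * (u ^ (i + 1) * firstGF b μ X (i + 1) z)
      = ∑ r ∈ Finset.range b, (firstBlockLaw b μ X (i + 1) r : ℂ) * q ^ (i + 1) * z ^ r := by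
    intro i
    rw [h.firstGF_eq_sum, Finset.mul_sum, Finset.mul_sum]
    refine Finset.sum_congr rfl fun r _ => ?_
    rw [hu, div_pow, Nat.add_sub_cancel, ← pow_mul, show b * (i + 1) = b + b * i by ring,
      pow_add z b, pow_add z (b * i)]
    have : z ^ (b * i) ≠ 0 := pow_ne_zero _ hz0
    field_simp
  have h1 : Tendsto (fun n => ∑ i ∈ Finset.range n, ∑ r ∈ Finset.range b,
      (firstBlockLaw b μ X (i + 1) r : ℂ) * q ^ (i + 1) * z ^ r) atTop (𝓝 (z ^ b)) := by
    have := (hlim.const_sub 1).const_mul (z ^ b)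
    rw [sub_zero, mul_one] at this
    refine this.congr fun n => ?_
    rw [← htel, Finset.mul_sum]
    exact Finset.sum_congr rfl fun i _ => hterm i
  have h2 : HasSum (fun i : ℕ => ∑ r ∈ Finset.range b,
      (firstBlockLaw b μ X (i + 1) r : ℂ) * q ^ (i + 1) * z ^ r)
      (∑ r ∈ Finset.range b, firstBlockGF b μ X q r * z ^ r) :=
    hasSum_sum fun r hr =>
      (h.summable_firstBlockLaw hb hα0 hα1 (Finset.mem_range.1 hr) hq).hasSum.mul_right _
  exact tendsto_nhds_unique h2.tendsto_sum_nat h1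

/-! ### Zeros of the kernel. -/

theorem exp_two_pi_pow_injOn {b : ℕ} (hb : 0 < b) {l j : ℕ} (hl : l < b) (hj : j < b)
    (h : Complex.exp (2 * Real.pi * Complex.I / b) ^ l
      = Complex.exp (2 * Real.pi * Complex.I / b) ^ j) : l = j :=
  (Complex.isPrimitiveRoot_exp b hb.ne').pow_inj hl hj h

theorem norm_exp_two_pi (b : ℕ) : ‖Complex.exp (2 * Real.pi * Complex.I / b)‖ = 1 := by
  rw [show (2 * Real.pi * Complex.I / b : ℂ) = ((2 * Real.pi / b : ℝ) : ℂ) * Complex.I by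
    push_cast; ring]
  exact Complex.norm_exp_ofReal_mul_I _

/-- The `b`-th power of `e` times this norm is `decayRate b α * ‖q‖`, so `|q| < R` is exactly the
condition that the argument lies in the open disc of radius `e ^ (-1)`. -/
theorem norm_zeta_arg_lt {b : ℕ} {α : ℝ} (hα0 : 0 < α) {q w : ℂ} (hw : w ^ b = q)
    (hq : decayRate b α * ‖q‖ < 1) (l : ℕ) :
    ‖Complex.exp (2 * Real.pi * Complex.I / b) ^ l * (α * Complex.exp (-α)) * w‖
      < Real.exp (-1) := by
  have h1 : ‖Complex.exp (2 * Real.pi * Complex.I / b) ^ l * (α * Complex.exp (-α)) * w‖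
      = α * Real.exp (-α) * ‖w‖ := by
    rw [norm_mul, norm_mul, norm_pow, norm_exp_two_pi, one_pow, one_mul, norm_mul,
      Complex.norm_real, Real.norm_of_nonneg hα0.le, Complex.norm_exp]
    simp
  have h2 : α * Real.exp (1 - α) * ‖w‖ < 1 := by
    rw [decayRate, ← hw, norm_pow, ← mul_pow] at hq
    by_contra hge
    exact absurd hq (not_lt.2 (one_le_pow₀ (not_lt.1 hge)))
  rw [h1]
  calc α * Real.exp (-α) * ‖w‖ = Real.exp (-1) * (α * Real.exp (1 - α) * ‖w‖) := by
        rw [show -α = -1 + (1 - α) by ring, Real.exp_add]; ring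
    _ < Real.exp (-1) * 1 := by gcongr
    _ = _ := mul_one _

/-- The functional equation of `T` reads `ζ = ω ^ l * q ^ (1/b) * e ^ (α (ζ - 1))`; the `b`-th power
removes the root of unity and the branch. -/
theorem kernel_zeta {b : ℕ} (hb : 0 < b) {α : ℝ} (hα0 : 0 < α) {root : ℂ → ℂ} {q : ℂ}
    (hroot : root q ^ b = q) (hq : decayRate b α * ‖q‖ < 1) (l : ℕ) :
    q * Complex.exp (b * α * (zeta b α root l q - 1)) = zeta b α root l q ^ b := by
  have hα : (α : ℂ) ≠ 0 := by exact_mod_cast hα0.ne'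
  have hfe := treeFun_mul_exp_neg (norm_zeta_arg_lt hα0 hroot hq l)
  have hT : treeFun (Complex.exp (2 * Real.pi * Complex.I / b) ^ l * (α * Complex.exp (-α)) *
      root q) = α * zeta b α root l q := by
    rw [zeta, mul_div_cancel₀ _ hα]
  rw [hT] at hfe
  set z := zeta b α root l q
  set ω := Complex.exp (2 * Real.pi * Complex.I / b)
  have hω : ω ^ b = 1 := (Complex.isPrimitiveRoot_exp b hb.ne').pow_eq_one
  have h1 : z = ω ^ l * root q * Complex.exp (α * (z - 1)) := by
    apply mul_left_cancel₀ hα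
    calc α * z = (α * z * Complex.exp (-(α * z))) * Complex.exp (α * z) := by
          rw [mul_assoc (α * z : ℂ), ← Complex.exp_add]; simp
      _ = ω ^ l * (α * Complex.exp (-α)) * root q * Complex.exp (α * z) := by rw [hfe]
      _ = _ := by
          rw [show (α * (z - 1) : ℂ) = -α + α * z by ring, Complex.exp_add]; ring
  calc q * Complex.exp (b * α * (z - 1)) = (ω ^ l * root q * Complex.exp (α * (z - 1))) ^ b := by
        rw [mul_pow, mul_pow, hroot, ← pow_mul, mul_comm l, pow_mul, hω, one_pow, one_mul,
          ← Complex.exp_nat_mul, mul_assoc]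
    _ = z ^ b := by rw [← h1]

theorem norm_zeta_le {b : ℕ} {α : ℝ} (hα0 : 0 < α) {root : ℂ → ℂ} {q : ℂ}
    (hroot : root q ^ b = q) (hq : decayRate b α * ‖q‖ < 1) (l : ℕ) :
    ‖zeta b α root l q‖ ≤ 1 / α := by
  rw [zeta, norm_div, Complex.norm_real, Real.norm_of_nonneg hα0.le]
  gcongr
  exact (norm_treeFun_lt_one (norm_zeta_arg_lt hα0 hroot hq l)).le

/-- The generating function of the first block length. -/
theorem IsPoissonTable.one_sub_pgf_eq_prod (h : IsPoissonTable b α μ X) (hb : 0 < b)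
    (hα0 : 0 < α) (hα1 : α < 1) {root : ℂ → ℂ} {q : ℂ} (hq0 : q ≠ 0)
    (hroot : root q ^ b = q) (hq : decayRate b α * ‖q‖ < 1) :
    1 - ∫ ω, q ^ firstBlockLength b (fun i : ℕ => X i ω) ∂μ
      = ∏ l ∈ Finset.range b, (1 - zeta b α root l q) := by
  classical
  have hα : (α : ℂ) ≠ 0 := by exact_mod_cast hα0.ne'
  have hr0 : root q ≠ 0 := by
    intro h0
    rw [h0, zero_pow hb.ne'] at hroot
    exact hq0 hroot.symm
  have hz0 : ∀ l, zeta b α root l q ≠ 0 := by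
    intro l h0
    have := kernel_zeta hb hα0 hroot hq l
    rw [h0, zero_pow hb.ne', mul_eq_zero] at this
    exact this.elim hq0 (Complex.exp_ne_zero _)
  have hinj : Set.InjOn (fun l => zeta b α root l q) (Finset.range b) := by
    intro l hl j hj hlj
    simp only [Finset.coe_range, Set.mem_Iio] at hl hj
    simp only [zeta] at hlj
    have h1 := treeFun_injOn (norm_zeta_arg_lt hα0 hroot hq l) (norm_zeta_arg_lt hα0 hroot hq j)
      (by rwa [div_left_inj' hα] at hlj)
    have hne : (α * Complex.exp (-α) : ℂ) ≠ 0 := mul_ne_zero hα (Complex.exp_ne_zero _)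
    exact exp_two_pi_pow_injOn hb hl hj (mul_right_cancel₀ hne (mul_right_cancel₀ hr0 h1))
  set P : Polynomial ℂ := ∑ r ∈ Finset.range b, Polynomial.C (firstBlockGF b μ X q r) *
    Polynomial.X ^ r with hP
  have hPdeg : P.degree < b := by
    rw [hP, Finset.sum_range]
    exact Polynomial.degree_sum_fin_lt _
  have hmonic : (Polynomial.X ^ b - P).Monic := Polynomial.monic_X_pow_sub hPdeg
  have hdeg : (Polynomial.X ^ b - P).degree = (b : WithBot ℕ) := by
    rw [Polynomial.degree_sub_eq_left_of_degree_lt (by rwa [Polynomial.degree_X_pow]),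
      Polynomial.degree_X_pow]
  set Q : Polynomial ℂ := ∏ l ∈ Finset.range b,
    (Polynomial.X - Polynomial.C (zeta b α root l q)) with hQ
  have hQmonic : Q.Monic := Polynomial.monic_prod_X_sub_C _ _
  have hQdeg : Q.degree = b := by
    rw [hQ, Polynomial.degree_prod]
    simp
  -- Both polynomials are monic of degree `b`, so their difference has degree below `b`; it vanishes
  -- at the `b` distinct points `ζ_l`.
  have hPQ : Polynomial.X ^ b - P = Q := by
    refine Polynomial.eq_of_degree_sub_lt_of_eval_index_eq _ hinj ?_ fun l hl => ?_
    · have := Polynomial.degree_sub_lt_left (hdeg.trans hQdeg.symm) hmonic.ne_zero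
        (by rw [hmonic.leadingCoeff, hQmonic.leadingCoeff])
      rw [Finset.card_range]
      rwa [hdeg] at this
    · have h1 := h.kernel_zero hb hα0 hα1 hq (norm_zeta_le hα0 hroot hq l) (hz0 l)
        (kernel_zeta hb hα0 hroot hq l)
      have h2 : Q.eval (zeta b α root l q) = 0 := by
        rw [hQ, Polynomial.eval_prod]
        exact Finset.prod_eq_zero hl (by simp)
      rw [h2, hP, Polynomial.eval_sub, Polynomial.eval_finsetSum]
      simp only [Polynomial.eval_pow, Polynomial.eval_X, Polynomial.eval_mul, Polynomial.eval_C]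
      rw [h1, sub_self]
  have h3 := congrArg (Polynomial.eval 1) hPQ
  rw [hP, hQ, Polynomial.eval_sub, Polynomial.eval_finsetSum, Polynomial.eval_prod] at h3
  simp only [Polynomial.eval_pow, Polynomial.eval_X, Polynomial.eval_mul, Polynomial.eval_C,
    one_pow, mul_one, Polynomial.eval_sub] at h3
  rw [← h3, h.sum_firstBlockGF hb hα0 hα1 hq]

/-! ### Differentiation of the generating function -/

/-- A continuous local inverse of `w ↦ w ^ b` is differentiable because `b w ^ (b - 1) ≠ 0`. -/
theorem hasDerivAt_root {b : ℕ} (hb : 0 < b) {root : ℂ → ℂ} {q : ℂ} (hq0 : q ≠ 0)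
    (hcont : ContinuousAt root q) (hroot : ∀ᶠ z in 𝓝 q, root z ^ b = z) :
    HasDerivAt root ((b : ℂ) * root q ^ (b - 1))⁻¹ q := by
  have hr0 : root q ≠ 0 := by
    intro h0
    have := hroot.self_of_nhds
    rw [h0, zero_pow hb.ne'] at this
    exact hq0 this.symm
  exact HasDerivAt.of_local_left_inverse hcont (hasDerivAt_pow b (root q))
    (mul_ne_zero (by exact_mod_cast hb.ne') (pow_ne_zero _ hr0)) hroot

theorem hasDerivAt_zeta {b : ℕ} (hb : 0 < b) {α : ℝ} (hα0 : 0 < α) {root : ℂ → ℂ} {q : ℂ}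
    (hq0 : q ≠ 0) (hcont : ContinuousAt root q) (hroot : ∀ᶠ z in 𝓝 q, root z ^ b = z)
    (hq : decayRate b α * ‖q‖ < 1) (l : ℕ) :
    HasDerivAt (zeta b α root l)
      (deriv treeFun (Complex.exp (2 * Real.pi * Complex.I / b) ^ l * (α * Complex.exp (-α)) *
        root q) * (Complex.exp (2 * Real.pi * Complex.I / b) ^ l * (α * Complex.exp (-α)) *
        ((b : ℂ) * root q ^ (b - 1))⁻¹) / α) q := by
  have hT := (hasDerivAt_treeFun (norm_zeta_arg_lt hα0 hroot.self_of_nhds hq l))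
  have hT' := hT.differentiableAt.hasDerivAt
  exact (hT'.comp q ((hasDerivAt_root hb hq0 hcont hroot).const_mul _)).div_const _

theorem IsPoissonTable.deriv_pgf (h : IsPoissonTable b α μ X) (hb : 0 < b)
    (hα0 : 0 < α) (hα1 : α < 1) {root : ℂ → ℂ} {q : ℂ} (hq0 : q ≠ 0)
    (hcont : ContinuousAt root q) (hroot : ∀ᶠ z in 𝓝 q, root z ^ b = z)
    (hq : decayRate b α * ‖q‖ < 1) :
    deriv (fun q : ℂ => ∫ ω, q ^ firstBlockLength b (fun i : ℕ => X i ω) ∂μ) q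
      = ∑ l ∈ Finset.range b, deriv (zeta b α root l) q *
        ∏ j ∈ (Finset.range b).erase l, (1 - zeta b α root j q) := by
  -- All conditions of the product formula are stable near `q`, so it may be differentiated.
  have hev : (fun q : ℂ => ∫ ω, q ^ firstBlockLength b (fun i : ℕ => X i ω) ∂μ)
      =ᶠ[𝓝 q] fun q => 1 - ∏ l ∈ Finset.range b, (1 - zeta b α root l q) := by
    have hopen : IsOpen {z : ℂ | decayRate b α * ‖z‖ < 1} :=
      isOpen_lt (by fun_prop) continuous_const
    filter_upwards [hopen.mem_nhds hq, eventually_ne_nhds hq0, hroot] with z h1 h2 h3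
    rw [← h.one_sub_pgf_eq_prod hb hα0 hα1 h2 h3 h1]
    ring
  have hd : ∀ l, HasDerivAt (zeta b α root l) (deriv (zeta b α root l) q) q := fun l =>
    (hasDerivAt_zeta hb hα0 hq0 hcont hroot hq l).differentiableAt.hasDerivAt
  have hprod := HasDerivAt.fun_finsetProd (u := Finset.range b)
    (fun l _ => (hd l).const_sub 1)
  rw [hev.deriv_eq, (hprod.const_sub 1).deriv, ← Finset.sum_neg_distrib]
  refine Finset.sum_congr rfl fun l _ => ?_
  rw [smul_eq_mul]
  ring

/-- The probability that a bucket is not full. -/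
theorem IsPoissonTable.measure_not_isFull (h : IsPoissonTable b α μ X) (hb : 0 < b)
    (hα0 : 0 < α) (hα1 : α < 1) :
    (μ.real {ω | ¬ IsFull b (fun j => X j ω) 0} : ℂ) = T0 b α := by
  have hα : (α : ℂ) ≠ 0 := by exact_mod_cast hα0.ne'
  have hbC : (b : ℂ) ≠ 0 := by exact_mod_cast hb.ne'
  have hα1' : (1 - α : ℂ) ≠ 0 := sub_ne_zero.2 (by exact_mod_cast hα1.ne')
  have hq : decayRate b α * ‖(1 : ℂ)‖ < 1 := by simpa using decayRate_lt_one hb hα0 hα1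
  have hq' : ‖(1 : ℂ)‖ < (decayRate b α)⁻¹ := by
    rw [norm_one]; exact one_lt_inv₀ (decayRate_pos b hα0) |>.2 (decayRate_lt_one hb hα0 hα1)
  set root : ℂ → ℂ := fun z => z ^ ((b : ℂ)⁻¹) with hrootdef
  have hroot : ∀ᶠ z in 𝓝 (1 : ℂ), root z ^ b = z :=
    Eventually.of_forall fun z => Complex.cpow_nat_inv_pow z hb.ne'
  have hcont : ContinuousAt root 1 :=
    continuousAt_id.cpow continuousAt_const (by simp)
  have hroot1 : root 1 = 1 := Complex.one_cpow _
  have hp := h.pgf_blockLength hb hα0 hα1 0 hq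
  rw [← (h.hasDerivAt_pgf_firstBlockLength hb hα0 hα1 hq').deriv,
    h.deriv_pgf hb hα0 hα1 one_ne_zero hcont hroot hq] at hp
  -- At `q = 1` this makes the factor `1 - ζ_0` vanish, so only the summand `l = 0` survives.
  have hz0 : zeta b α root 0 1 = 1 := by
    rw [zeta, pow_zero, one_mul, hroot1, mul_one, treeFun_mul_exp_neg_self hα0 hα1, div_self hα]
  have hd0 : deriv (zeta b α root 0) 1 = 1 / (b * (1 - α)) := by
    have hn := norm_zeta_arg_lt hα0 hroot.self_of_nhds hq 0
    have hT := mul_deriv_treeFun hn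
    rw [(hasDerivAt_zeta hb hα0 one_ne_zero hcont hroot hq 0).deriv]
    simp only [pow_zero, one_mul, hroot1, mul_one, one_pow] at hT ⊢
    rw [treeFun_mul_exp_neg_self hα0 hα1] at hT
    have hT' : Complex.exp (-α) * deriv treeFun (α * Complex.exp (-α)) * (1 - α) = 1 :=
      mul_left_cancel₀ hα (by linear_combination hT)
    field_simp
    linear_combination hT'
  rw [Finset.sum_eq_single 0] at hp
  · have hI : (Finset.range b).erase 0 = Finset.Ico 1 b := by
      ext k; simp only [Finset.mem_erase, Finset.mem_range, Finset.mem_Ico]; omega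
    rw [hI, hd0] at hp
    have hP : ∏ j ∈ Finset.Ico 1 b, (1 - zeta b α root j 1) = ∏ j ∈ Finset.Ico 1 b,
        (1 - treeFun (Complex.exp (2 * Real.pi * Complex.I / b) ^ j * (α * Complex.exp (-α))) / α) :=
      Finset.prod_congr rfl fun j _ => by rw [zeta, hroot1, mul_one]
    have h2 := hp.2
    simp only [one_pow, integral_const, probReal_univ, one_smul, mul_one] at h2
    rw [hP] at h2
    rw [T0]
    generalize (∏ j ∈ Finset.Ico 1 b, (1 - treeFun (Complex.exp (2 * Real.pi * Complex.I / b) ^ j *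
      (α * Complex.exp (-α))) / α)) = P at h2 ⊢
    -- If the product vanished, the generating function of the block length at `1` would be `0`, not
    -- `1`.
    have hP0 : P ≠ 0 := by
      rintro rfl
      simp at h2
    field_simp at h2 ⊢
    linear_combination -h2
  · intro l hl hl0
    rw [Finset.prod_eq_zero (i := 0) (by simp [hb, hl0.symm]) (by rw [hz0, sub_self]), mul_zero]
  · intro h0
    exact absurd (Finset.mem_range.2 hb) h0

end Poisson

/-! ### The exact model -/

theorem exactModel_real {m n : ℕ} (A : Set (Fin n → Fin m)) [DecidablePred (· ∈ A)] :
    (exactModel m n).real A = (Finset.univ.filter (· ∈ A)).card / (m : ℝ) ^ n := by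
  rw [measureReal_def, exactModel, uniformOn_univ, Measure.count_apply_finite A A.toFinite]
  simp only [Fintype.card_pi, Fintype.card_fin, Finset.prod_const, Finset.card_univ,
    ENNReal.toReal_div, ENNReal.toReal_natCast]
  congr 2
  · congr 1; ext; simp
  · norm_cast

/-- The bucket among `0, …, m - 1` that represents `d` modulo `m`. -/
def residue (m : ℕ) [NeZero m] (d : ℤ) : Fin m :=
  ⟨(d % m).toNat, by
    have h1 : (0 : ℤ) < m := by exact_mod_cast Nat.pos_of_ne_zero (NeZero.ne m)
    have := Int.emod_lt_of_pos d h1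
    have := Int.emod_nonneg d h1.ne'
    omega⟩

theorem eq_residue_iff {m : ℕ} [NeZero m] (v : Fin m) (d : ℤ) :
    v = residue m d ↔ ((v : ℕ) : ℤ) = d % m := by
  have h1 : (0 : ℤ) < m := by exact_mod_cast Nat.pos_of_ne_zero (NeZero.ne m)
  have := Int.emod_nonneg d h1.ne'
  rw [Fin.ext_iff, residue]
  simp only
  omega

theorem keyCount_eq {m n : ℕ} [NeZero m] (h : Fin n → Fin m) (d : ℤ) :
    keyCount h d = (Finset.univ.filter fun k => h k = residue m d).card := by
  unfold keyCount
  congr 1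
  ext k
  simp only [Finset.mem_filter, Finset.mem_univ, true_and, eq_residue_iff]

theorem residue_injOn_Ioc {m : ℕ} [NeZero m] {a c : ℤ} (h : c ≤ a + m) :
    Set.InjOn (residue m) (Finset.Ioc a c) := by
  intro d hd e he hde
  simp only [Finset.coe_Ioc, Set.mem_Ioc] at hd he
  have h1 : (0 : ℤ) < m := by exact_mod_cast Nat.pos_of_ne_zero (NeZero.ne m)
  have h2 := (eq_residue_iff (residue m d) e).1 hde
  have h3 := (eq_residue_iff (residue m d) d).1 rfl
  rw [h3] at h2
  have h4 : (m : ℤ) ∣ d - e := Int.ModEq.dvd (Int.ModEq.symm h2)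
  obtain ⟨c', hc'⟩ := h4
  have : c' = 0 := by
    have h5 : (m : ℤ) * c' < m * 1 := by linarith
    have h6 : (m : ℤ) * (-1) < m * c' := by linarith
    have := lt_of_mul_lt_mul_left h5 h1.le
    have := lt_of_mul_lt_mul_left h6 h1.le
    omega
  rw [this, mul_zero] at hc'
  omega

/-- The joint generating function of the key counts in a set of distinct buckets. -/
theorem sum_prod_pow_keyCount {R : Type*} [CommSemiring R] {m n : ℕ} [NeZero m] {D : Finset ℤ}
    (hD : Set.InjOn (residue m) D) (y : ℤ → R) :
    ∑ h : Fin n → Fin m, ∏ d ∈ D, y d ^ keyCount h d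
      = (∑ d ∈ D, y d + ((m - D.card : ℕ) : R)) ^ n := by
  classical
  have h1 : ∀ h : Fin n → Fin m, ∏ d ∈ D, y d ^ keyCount h d
      = ∏ k, ∏ d ∈ D, if h k = residue m d then y d else 1 := by
    intro h
    rw [Finset.prod_comm]
    refine Finset.prod_congr rfl fun d _ => ?_
    rw [keyCount_eq, Finset.prod_ite, Finset.prod_const, Finset.prod_const_one, mul_one]
  simp only [h1]
  -- Each key contributes its own factor, so the sum over address sequences is an `n`-th power.
  rw [← Fintype.sum_pow (fun v => ∏ d ∈ D, if v = residue m d then y d else 1)]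
  congr 1
  rw [← Finset.sum_add_sum_compl (D.image (residue m)), Finset.sum_image hD]
  congr 1
  · refine Finset.sum_congr rfl fun d hd => ?_
    rw [Finset.prod_eq_single d]
    · simp
    · intro e he hed
      exact if_neg fun h => hed (hD he hd h.symm)
    · exact fun h => absurd hd h
  · rw [Finset.sum_congr rfl (g := fun _ => (1 : R)), Finset.sum_const, Finset.card_compl,
      Finset.card_image_of_injOn hD, Fintype.card_fin, nsmul_one]
    intro v hv
    refine Finset.prod_eq_one fun d hd => if_neg ?_
    rintro rfl
    simp only [Finset.mem_compl, Finset.mem_image, not_exists, not_and] at hv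
    exact hv d hd rfl

theorem card_le_of_residue_injOn {m : ℕ} [NeZero m] {D : Finset ℤ}
    (hD : Set.InjOn (residue m) D) : D.card ≤ m := by
  classical
  rw [← Finset.card_image_of_injOn hD]
  simpa using Finset.card_le_univ (D.image (residue m))

/-- The multinomial formula for the key counts in a set of distinct buckets. -/
theorem card_filter_keyCount {m n : ℕ} [NeZero m] {D : Finset ℤ}
    (hD : Set.InjOn (residue m) D) (x : ℤ → ℕ) :
    (∏ d ∈ D, (x d).factorial) *
      (Finset.univ.filter fun h : Fin n → Fin m => ∀ d ∈ D, keyCount h d = x d).card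
      = n.descFactorial (∑ d ∈ D, x d) * (m - D.card) ^ (n - ∑ d ∈ D, x d) := by
  classical
  set s : D →₀ ℕ := Finsupp.equivFunOnFinite.symm fun d => x d with hs
  set S := ∑ d ∈ D, x d with hS
  -- Indeterminates replace the weights, and the coefficient of the monomial with exponents `x d`
  -- counts the wanted sequences.
  have hgf := sum_prod_pow_keyCount (R := MvPolynomial D ℕ) (n := n) hD
    (fun d => if hd : d ∈ D then MvPolynomial.X ⟨d, hd⟩ else 1)
  have hsum : ∑ d ∈ D, (if hd : d ∈ D then MvPolynomial.X ⟨d, hd⟩ else 1 : MvPolynomial D ℕ)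
      = ∑ d : D, MvPolynomial.X d := by
    rw [← Finset.sum_coe_sort]
    exact Finset.sum_congr rfl fun d _ => dif_pos d.2
  have hprod : ∀ h : Fin n → Fin m, ∏ d ∈ D,
      (if hd : d ∈ D then MvPolynomial.X ⟨d, hd⟩ else 1 : MvPolynomial D ℕ) ^ keyCount h d
      = MvPolynomial.monomial (Finsupp.equivFunOnFinite.symm fun d : D => keyCount h d) 1 := by
    intro h
    rw [← Finset.prod_coe_sort, MvPolynomial.monomial_eq, MvPolynomial.C_1, one_mul,
      Finsupp.prod_fintype _ _ (fun _ => pow_zero _)]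
    exact Finset.prod_congr rfl fun d _ => by rw [dif_pos d.2]; rfl
  rw [hsum, Finset.sum_congr rfl fun h _ => hprod h] at hgf
  have hc := congrArg (MvPolynomial.coeff s) hgf
  rw [MvPolynomial.coeff_sum, add_pow, MvPolynomial.coeff_sum] at hc
  simp only [MvPolynomial.coeff_monomial] at hc
  have hL : ∑ h : Fin n → Fin m,
      (if (Finsupp.equivFunOnFinite.symm fun d : D => keyCount h d) = s then 1 else 0)
      = (Finset.univ.filter fun h : Fin n → Fin m => ∀ d ∈ D, keyCount h d = x d).card := by
    rw [Finset.card_filter]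
    refine Finset.sum_congr rfl fun h _ => ?_
    congr 1
    rw [hs, Equiv.apply_eq_iff_eq, funext_iff]
    simp
  have hsS : s.sum (fun _ m => m) = S := by
    rw [Finsupp.sum_fintype _ _ (fun _ => rfl), hS]
    exact Finset.sum_coe_sort D x
  have hR : ∀ j, MvPolynomial.coeff s ((∑ d : D, MvPolynomial.X d) ^ j *
      ((m - D.card : ℕ) : MvPolynomial D ℕ) ^ (n - j) * ((n.choose j : ℕ) : MvPolynomial D ℕ))
      = if S = j then s.multinomial * (m - D.card) ^ (n - j) * n.choose j else 0 := by
    intro j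
    rw [← Nat.cast_pow, mul_assoc, ← Nat.cast_mul, mul_comm, ← nsmul_eq_mul,
      MvPolynomial.coeff_smul, MvPolynomial.coeff_sum_X_pow_of_fintype, hsS]
    split_ifs
    · simp; ring
    · simp
  rw [hL, Finset.sum_congr rfl fun j _ => hR j] at hc
  have hspec : (∏ d ∈ D, (x d).factorial) * s.multinomial = S.factorial := by
    have := Nat.multinomial_spec (Finset.univ : Finset D) s
    rw [← Finsupp.multinomial_eq_of_support_subset (Finset.subset_univ _)] at this
    rw [hS, ← Finset.prod_coe_sort, ← Finset.sum_coe_sort]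
    exact this
  rw [hc, Finset.sum_ite_eq]
  split_ifs with hSn
  · rw [Nat.descFactorial_eq_factorial_mul_choose, ← hspec]; ring
  · rw [Nat.descFactorial_eq_zero_iff_lt.2 (by simpa using hSn)]; simp

theorem exactModel_keyCount {m n : ℕ} [NeZero m] {D : Finset ℤ}
    (hD : Set.InjOn (residue m) D) (x : ℤ → ℕ) :
    (exactModel m n).real {h | ∀ d ∈ D, keyCount h d = x d}
      = (∏ d ∈ D, ((x d).factorial : ℝ))⁻¹ * (n.descFactorial (∑ d ∈ D, x d) *
        ((m : ℝ) - D.card) ^ (n - ∑ d ∈ D, x d) / (m : ℝ) ^ n) := by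
  classical
  have h1 := card_filter_keyCount (n := n) hD x
  have h0 : (∏ d ∈ D, ((x d).factorial : ℝ)) ≠ 0 :=
    Finset.prod_ne_zero_iff.2 fun d _ => by exact_mod_cast (x d).factorial_ne_zero
  rw [exactModel_real]
  simp only [Set.mem_ofPred_eq]
  rw [eq_inv_mul_iff_mul_eq₀ h0, ← mul_div_assoc]
  congr 1
  rw [← Nat.cast_sub (card_le_of_residue_injOn hD)]
  exact_mod_cast h1

/-- Chernoff's bound for the number of keys in a window of the exact model. -/
theorem exactModel_window_le {b m n : ℕ} [NeZero m] {α : ℝ} (hα0 : 0 < α) (hα1 : α < 1)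
    {D : Finset ℤ} (hD : Set.InjOn (residue m) D) :
    (exactModel m n).real {h | b * D.card ≤ ∑ d ∈ D, keyCount h d}
      ≤ (α ^ b * Real.exp ((n : ℝ) / m * (1 / α - 1))) ^ D.card := by
  classical
  have hm : (0 : ℝ) < m := by exact_mod_cast Nat.pos_of_ne_zero (NeZero.ne m)
  have hone : 1 ≤ 1 / α := by rw [le_div_iff₀ hα0]; linarith
  have hgf := sum_prod_pow_keyCount (n := n) hD (fun _ => 1 / α)
  simp only [Finset.prod_pow_eq_pow_sum, Finset.sum_const, nsmul_eq_mul] at hgf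
  rw [exactModel_real, div_le_iff₀ (by positivity)]
  simp only [Set.mem_ofPred_eq]
  set A := Finset.univ.filter fun h : Fin n → Fin m => b * D.card ≤ ∑ d ∈ D, keyCount h d
  have h1 : (A.card : ℝ) * (1 / α) ^ (b * D.card)
      ≤ ∑ h : Fin n → Fin m, (1 / α) ^ ∑ d ∈ D, keyCount h d := by
    rw [← nsmul_eq_mul]
    refine (Finset.card_nsmul_le_sum A (fun h => (1 / α) ^ ∑ d ∈ D, keyCount h d) _
      fun h hh => pow_le_pow_right₀ hone (Finset.mem_filter.1 hh).2).trans ?_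
    exact Finset.sum_le_sum_of_subset_of_nonneg (Finset.subset_univ _)
      fun _ _ _ => by positivity
  rw [hgf, Nat.cast_sub (card_le_of_residue_injOn hD)] at h1
  -- The bound `1 + y ≤ e ^ y` for each key gives the Poisson exponent with `n / m` in place of
  -- `bα`.
  have h2 : (D.card : ℝ) * (1 / α) + (m - D.card)
      ≤ m * Real.exp (D.card / m * (1 / α - 1)) := by
    have := Real.add_one_le_exp (D.card / m * (1 / α - 1) : ℝ)
    calc _ = m * (D.card / m * (1 / α - 1) + 1) := by field_simp; ring
      _ ≤ _ := by gcongr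
  have h3 : (0 : ℝ) ≤ (D.card : ℝ) * (1 / α) + (m - D.card) := by
    have : (D.card : ℝ) ≤ m := by exact_mod_cast card_le_of_residue_injOn hD
    have : (0 : ℝ) ≤ (D.card : ℝ) * (1 / α) := by positivity
    linarith
  have hp : (1 / α) ^ (b * D.card) * α ^ (b * D.card) = 1 := by
    rw [← mul_pow, one_div_mul_cancel hα0.ne', one_pow]
  calc (A.card : ℝ) = (A.card * (1 / α) ^ (b * D.card)) * α ^ (b * D.card) := by
        rw [mul_assoc, hp, mul_one]
    _ ≤ (m * Real.exp (D.card / m * (1 / α - 1))) ^ n * α ^ (b * D.card) := by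
        gcongr
        exact h1.trans (pow_le_pow_left₀ h3 h2 n)
    _ = _ := by
        rw [mul_pow, mul_pow, ← pow_mul, ← Real.exp_nat_mul, ← Real.exp_nat_mul]
        rw [show (n : ℝ) * (D.card / m * (1 / α - 1)) = D.card * (n / m * (1 / α - 1)) by ring]
        ring

/-! ### Periodicity -/

theorem sum_keyCount_period {m n : ℕ} [NeZero m] (h : Fin n → Fin m) (a : ℤ) :
    ∑ d ∈ Finset.Ioc a (a + m), keyCount h d = n := by
  classical
  have hinj := residue_injOn_Ioc (m := m) (a := a) (c := a + m) le_rfl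
  have himg : (Finset.Ioc a (a + m)).image (residue m) = Finset.univ := by
    rw [← Finset.card_eq_iff_eq_univ, Finset.card_image_of_injOn hinj]
    simp
  simp only [keyCount_eq, Finset.card_filter]
  rw [Finset.sum_comm]
  have : ∀ k : Fin n, ∑ d ∈ Finset.Ioc a (a + m), (if h k = residue m d then 1 else 0) = 1 := by
    intro k
    rw [← Finset.sum_image (f := fun v => if h k = v then 1 else 0) hinj, himg]
    simp
  simp [this]

theorem walk_keyCount_add_mul {b m n : ℕ} [NeZero m] (h : Fin n → Fin m) (a : ℤ) (c : ℕ) :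
    walk b (keyCount h) (a + m * c) = walk b (keyCount h) a + c * ((n : ℤ) - b * m) := by
  induction c with
  | zero => simp
  | succ c ih =>
    have h1 := walk_add_nat b (keyCount h) (a + m * c) m
    rw [sum_keyCount_period, ih] at h1
    rw [show a + (m : ℤ) * ((c + 1 : ℕ) : ℤ) = a + m * c + m by push_cast; ring, h1]
    push_cast; ring

/-- The walk changes by `n - b m ≤ -1` over each period, so the drift that is almost sure in the
Poisson model holds here for every key sequence. -/
theorem walk_keyCount_tendsto {b m n : ℕ} [NeZero m] (hn : n < b * m) (h : Fin n → Fin m) :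
    (∀ C : ℤ, ∃ j₀ : ℤ, ∀ j ≤ j₀, C ≤ walk b (keyCount h) j) ∧
      ∀ C : ℤ, ∀ j₀ : ℤ, ∃ j ≥ j₀, walk b (keyCount h) j ≤ C := by
  have hm : (0 : ℤ) < m := by exact_mod_cast Nat.pos_of_ne_zero (NeZero.ne m)
  have hn' : (n : ℤ) - b * m ≤ -1 := by
    have : (n : ℤ) < b * m := by exact_mod_cast hn
    omega
  constructor
  · intro C
    set S := ∑ r ∈ Finset.Ico (0 : ℤ) m, |walk b (keyCount h) r| with hS
    have hS0 : 0 ≤ S := Finset.sum_nonneg fun _ _ => abs_nonneg _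
    refine ⟨m * (-(|C| + S)), fun j hj => ?_⟩
    have hr0 := Int.emod_nonneg j hm.ne'
    have hr1 := Int.emod_lt_of_pos j hm
    have hdiv := Int.emod_add_mul_ediv j m
    have hq : j / m ≤ -(|C| + S) := by
      have := Int.ediv_le_ediv hm hj
      rwa [Int.mul_ediv_cancel_left _ hm.ne'] at this
    have hC := le_abs_self C
    have hC0 := abs_nonneg C
    set c := (-(j / m)).toNat with hc
    have hcz : (c : ℤ) = -(j / m) := by omega
    have h1 := walk_keyCount_add_mul (b := b) h j c
    rw [hcz, show j + (m : ℤ) * -(j / m) = j % m by linarith] at h1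
    have h2 : |walk b (keyCount h) (j % m)| ≤ S :=
      Finset.single_le_sum (f := fun r => |walk b (keyCount h) r|) (fun _ _ => abs_nonneg _)
        (Finset.mem_Ico.2 ⟨hr0, hr1⟩)
    have h3 := neg_abs_le (walk b (keyCount h) (j % m))
    have h4 : -(j / (m : ℤ)) * ((n : ℤ) - b * m) ≤ -(j / (m : ℤ)) * (-1) :=
      mul_le_mul_of_nonneg_left hn' (by omega)
    linarith
  · intro C j₀
    set c := (|j₀| + |C|).toNat with hc
    have hcz : (c : ℤ) = |j₀| + |C| := Int.toNat_of_nonneg (by positivity)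
    have h1 := walk_keyCount_add_mul (b := b) h 0 c
    have h0 : walk b (keyCount h) 0 = 0 := by simp [walk]
    rw [h0, zero_add, zero_add] at h1
    refine ⟨m * c, ?_, ?_⟩
    · have : (c : ℤ) ≤ m * c := by nlinarith [Int.natCast_nonneg c]
      have := le_abs_self j₀
      have := abs_nonneg C
      linarith
    · rw [h1]
      have : (c : ℤ) * ((n : ℤ) - b * m) ≤ c * (-1) :=
        mul_le_mul_of_nonneg_left hn' (Int.natCast_nonneg c)
      have := neg_abs_le C
      have := abs_nonneg j₀
      linarith

/-- No window of length at most `L` that ends at bucket `a` overflows. -/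
def NotFullUpTo (b : ℕ) (x : ℤ → ℕ) (a : ℤ) (L : ℕ) : Prop :=
  ∀ l : ℕ, 1 ≤ l → l ≤ L → ∑ k ∈ Finset.Ioc (a - l) a, x k < b * l

theorem not_isFull_iff {b : ℕ} (hb : 0 < b) (x : ℤ → ℕ) (a : ℤ) :
    ¬ IsFull b x a ↔ ∀ L, NotFullUpTo b x a L := by
  rw [isFull_iff_exists_sum hb]
  push Not
  exact ⟨fun h L l h1 _ => h l h1, fun h l h1 => h l l h1 le_rfl⟩

/-- A window longer than `m` contains a period, which holds fewer than `b m` keys; removing it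
leaves a shorter overflowing window. This matters because the Chernoff bound requires buckets
distinct modulo `m`. -/
theorem isFull_keyCount {b m n : ℕ} [NeZero m] (hb : 0 < b) (hn : n < b * m) (h : Fin n → Fin m)
    (a : ℤ) (hfull : IsFull b (keyCount h) a) :
    ∃ l : ℕ, 1 ≤ l ∧ l ≤ m ∧ b * l ≤ ∑ k ∈ Finset.Ioc (a - l) a, keyCount h k := by
  have hm : 0 < m := Nat.pos_of_ne_zero (NeZero.ne m)
  obtain ⟨l, hl1, hl2⟩ := (isFull_iff_exists_sum hb _ a).1 hfull
  induction l using Nat.strong_induction_on with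
  | _ l ih =>
    rcases le_or_gt l m with h1 | h1
    · exact ⟨l, hl1, h1, hl2⟩
    · refine ih (l - m) (by omega) (by omega) ?_
      have hI : Finset.Ioc (a - l) a
          = Finset.Ioc (a - l) (a - l + m) ∪ Finset.Ioc (a - (l - m : ℕ)) a := by
        ext k; simp only [Finset.mem_Ioc, Finset.mem_union]; omega
      rw [hI, Finset.sum_union, sum_keyCount_period] at hl2
      · have : b * l = b * (l - m) + b * m := by rw [← mul_add]; congr 1; omega
        omega
      · rw [Finset.disjoint_left]
        intro k hk
        simp only [Finset.mem_Ioc] at hk ⊢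
        omega

/-! ### Tail bounds in the exact model -/

/-- Chernoff's decay rate in the exact model. -/
noncomputable def exactRate (b : ℕ) (α : ℝ) (m n : ℕ) : ℝ :=
  α ^ b * Real.exp ((n : ℝ) / m * (1 / α - 1))

theorem exactModel_Ioc_le {b m n : ℕ} [NeZero m] {α : ℝ} (hα0 : 0 < α) (hα1 : α < 1)
    {a c : ℤ} {l : ℕ} (hac : c = a + l) (hl : l ≤ m) :
    (exactModel m n).real {h | b * l ≤ ∑ d ∈ Finset.Ioc a c, keyCount h d}
      ≤ exactRate b α m n ^ l := by
  subst hac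
  have := exactModel_window_le (b := b) (n := n) hα0 hα1
    (residue_injOn_Ioc (m := m) (a := a) (c := a + l) (by omega))
  simpa [exactRate] using this

/-- For `k ≤ m` the first `k` buckets hold at least `b k` keys, so Chernoff applies. For `k > m` the
event is empty, since a period holds too few keys. -/
theorem exactModel_firstBlock_le {b m n : ℕ} [NeZero m] {α : ℝ} (hα0 : 0 < α) (hα1 : α < 1)
    (hn : n < b * m) (a : ℤ) (k : ℕ) :
    (exactModel m n).real {h | FirstBlock b (keyCount h) a (k + 1) ∧ ¬ IsFull b (keyCount h) a}
      ≤ exactRate b α m n ^ k := by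
  have hr : 0 ≤ exactRate b α m n := by unfold exactRate; positivity
  rcases le_or_gt k m with hk | hk
  · refine le_trans (measureReal_mono fun h hh => ?_)
      (exactModel_Ioc_le (b := b) (n := n) hα0 hα1 (a := a) rfl hk)
    rcases Nat.eq_zero_or_pos k with rfl | hk0
    · simp
    · exact hh.1.2.1 k hk0 (by omega)
  · have : {h : Fin n → Fin m | FirstBlock b (keyCount h) a (k + 1) ∧ ¬ IsFull b (keyCount h) a}
        = ∅ := by
      ext h
      simp only [Set.mem_ofPred_eq, Set.mem_empty_iff_false, iff_false]
      intro hh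
      have := hh.1.2.1 m (Nat.pos_of_ne_zero (NeZero.ne m)) (by omega)
      rw [sum_keyCount_period] at this
      omega
    rw [this, measureReal_empty]
    positivity

theorem exactModel_blockLength_eq_sum {b m n : ℕ} [NeZero m] (hb : 0 < b) (hn : n < b * m)
    (i : ℤ) (k : ℕ) :
    (exactModel m n).real {h | blockLength b (keyCount h) i = k} = ∑ r ∈ Finset.range k,
      (exactModel m n).real {h | FirstBlock b (keyCount h) (i - 1 - r) k ∧
        ¬ IsFull b (keyCount h) (i - 1 - r)} :=
  measure_blockLength_eq_sum hb .of_discrete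
    (Eventually.of_forall fun h => walk_keyCount_tendsto hn h) i k

theorem exactModel_blockLength_zero {b m n : ℕ} [NeZero m] (hb : 0 < b) (hn : n < b * m)
    (i : ℤ) : (exactModel m n).real {h | blockLength b (keyCount h) i = 0} = 0 := by
  rw [exactModel_blockLength_eq_sum hb hn]; simp

theorem exactModel_blockLength_le {b m n : ℕ} [NeZero m] {α : ℝ} (hb : 0 < b) (hα0 : 0 < α)
    (hα1 : α < 1) (hn : n < b * m) (i : ℤ) (k : ℕ) :
    (exactModel m n).real {h | blockLength b (keyCount h) i = k + 1}
      ≤ (k + 1) * exactRate b α m n ^ k := by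
  rw [exactModel_blockLength_eq_sum hb hn]
  refine (Finset.sum_le_sum fun r _ => exactModel_firstBlock_le hα0 hα1 hn _ k).trans_eq ?_
  simp

/-- The two events differ only if some window of length between `L + 1` and `m` ending at `a`
overflows. The union bound is a geometric tail that depends on `m, n` only through `ρ`. -/
theorem exactModel_truncation {b m n : ℕ} [NeZero m] {α ρ : ℝ} (hb : 0 < b) (hα0 : 0 < α)
    (hα1 : α < 1) (hn : n < b * m) (hρ : exactRate b α m n ≤ ρ) (hρ1 : ρ < 1) (a : ℤ) (k L : ℕ) :
    |(exactModel m n).real {h | FirstBlock b (keyCount h) a k ∧ NotFullUpTo b (keyCount h) a L}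
      - (exactModel m n).real {h | FirstBlock b (keyCount h) a k ∧ ¬ IsFull b (keyCount h) a}|
      ≤ ρ ^ (L + 1) / (1 - ρ) := by
  have hr : 0 ≤ exactRate b α m n := by unfold exactRate; positivity
  have hρ0 : 0 ≤ ρ := hr.trans hρ
  have hle : (exactModel m n).real
        {h | FirstBlock b (keyCount h) a k ∧ ¬ IsFull b (keyCount h) a}
      ≤ (exactModel m n).real
        {h | FirstBlock b (keyCount h) a k ∧ NotFullUpTo b (keyCount h) a L} :=
    measureReal_mono fun h hh => ⟨hh.1, (not_isFull_iff hb _ _).1 hh.2 L⟩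
  rw [abs_of_nonneg (sub_nonneg.2 hle), sub_le_iff_le_add']
  have hsub : {h : Fin n → Fin m | FirstBlock b (keyCount h) a k ∧
        NotFullUpTo b (keyCount h) a L}
      ⊆ {h | FirstBlock b (keyCount h) a k ∧ ¬ IsFull b (keyCount h) a} ∪
        ⋃ l ∈ Finset.Ico (L + 1) (m + 1),
          {h | b * l ≤ ∑ d ∈ Finset.Ioc (a - l) a, keyCount h d} := by
    rintro h ⟨h1, h2⟩
    by_cases hf : IsFull b (keyCount h) a
    · right
      obtain ⟨l, hl1, hl2, hl3⟩ := isFull_keyCount hb hn h a hf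
      refine Set.mem_biUnion (x := l) ?_ hl3
      simp only [Finset.coe_Ico, Set.mem_Ico]
      by_contra hlt
      have := h2 l hl1 (by omega)
      omega
    · exact Or.inl ⟨h1, hf⟩
  refine (measureReal_mono hsub).trans ((measureReal_union_le _ _).trans ?_)
  gcongr
  refine (measureReal_biUnion_finset_le _ _).trans ?_
  refine le_trans (Finset.sum_le_sum fun l hl => ?_)
    (geom_sum_Ico_le_of_lt_one (m := L + 1) (n := m + 1) hρ0 hρ1)
  rw [Finset.mem_Ico] at hl
  exact (exactModel_Ioc_le hα0 hα1 (by ring) (by omega)).trans (pow_le_pow_left₀ hr hρ l)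

/-! ### Convergence of local events -/

/-- The tables supported on `D` with entries below `M` that lie in `A`. -/
noncomputable def localTables (D : Finset ℤ) (M : ℕ) (A : Set (ℤ → ℕ)) : Finset (ℤ → ℕ) := by
  classical
  exact ((Fintype.piFinset fun _ : D => Finset.range M).image
    fun f d => if hd : d ∈ D then f ⟨d, hd⟩ else 0).filter (· ∈ A)

/-- An event that depends only on the counts in `D` and bounds them is a finite disjoint union of
cylinders, so a limit for cylinders passes to it. -/
theorem measure_eq_sum_localTables {Ω : Type*} [MeasurableSpace Ω] {μ : Measure Ω}
    [IsFiniteMeasure μ] {Y : Ω → ℤ → ℕ} (hY : Measurable Y) {D : Finset ℤ} {M : ℕ}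
    {A : Set (ℤ → ℕ)} (hA : ∀ x y : ℤ → ℕ, (∀ d ∈ D, x d = y d) → x ∈ A → y ∈ A)
    (hM : ∀ x ∈ A, ∀ d ∈ D, x d < M) :
    μ.real {ω | Y ω ∈ A}
      = ∑ f ∈ localTables D M A, μ.real {ω | ∀ d ∈ D, Y ω d = f d} := by
  classical
  rw [← measureReal_biUnion_finset]
  · congr 1
    ext ω
    simp only [Set.mem_ofPred_eq, Set.mem_iUnion, exists_prop]
    constructor
    · intro hω
      set f : ℤ → ℕ := fun d => if d ∈ D then Y ω d else 0 with hf
      refine ⟨f, ?_, fun d hd => by simp [hf, hd]⟩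
      rw [localTables, Finset.mem_filter, Finset.mem_image]
      refine ⟨⟨fun d => Y ω d, ?_, ?_⟩, hA _ _ (fun d hd => by simp [hf, hd]) hω⟩
      · rw [Fintype.mem_piFinset]
        exact fun d => Finset.mem_range.2 (hM _ hω d d.2)
      · ext d; simp [hf]
    · rintro ⟨f, hf, hω⟩
      exact hA f _ (fun d hd => (hω d hd).symm) (Finset.mem_filter.1 hf).2
  · intro f hf g hg hfg
    rw [Function.onFun, Set.disjoint_left]
    intro ω h1 h2
    apply hfg
    simp only [localTables, Finset.coe_filter, Finset.mem_image, Set.mem_ofPred_eq] at hf hg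
    obtain ⟨⟨f', _, rfl⟩, _⟩ := hf
    obtain ⟨⟨g', _, rfl⟩, _⟩ := hg
    ext d
    by_cases hd : d ∈ D
    · exact (h1 d hd).symm.trans (h2 d hd)
    · simp [hd]
  · intro f _
    have : {ω | ∀ d ∈ D, Y ω d = f d} = ⋂ d ∈ D, (fun ω => Y ω d) ⁻¹' {f d} := by
      ext ω; simp
    rw [this]
    exact Finset.measurableSet_biInter _ fun d _ =>
      ((measurable_pi_apply d).comp hY) (measurableSet_singleton _)

theorem IsPoissonTable.measure_eval {b : ℕ} {α : ℝ} {Ω : Type*} [MeasurableSpace Ω]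
    {μ : Measure Ω} {X : ℤ → Ω → ℕ} (h : IsPoissonTable b α μ X) (hα0 : 0 < α) (D : Finset ℤ)
    (x : ℤ → ℕ) :
    μ.real {ω | ∀ d ∈ D, X d ω = x d}
      = ∏ d ∈ D, (Real.exp (-(b * α)) * (b * α) ^ x d / (x d).factorial) := by
  have hl : ((b * α).toNNReal : ℝ) = b * α := Real.coe_toNNReal _ (by positivity)
  have h1 := h.indep.measure_inter_preimage_eq_mul D (sets := fun d => {x d})
    (fun d _ => measurableSet_singleton _)
  have h2 : {ω | ∀ d ∈ D, X d ω = x d} = ⋂ d ∈ D, X d ⁻¹' {x d} := by ext ω; simp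
  rw [h2, measureReal_def, h1, ENNReal.toReal_prod]
  refine Finset.prod_congr rfl fun d _ => ?_
  rw [← Measure.map_apply (h.measurable d) (measurableSet_singleton _), h.law,
    ← measureReal_def, poissonMeasure_real_singleton, hl]

section Limit

variable {m n : ℕ → ℕ}

/-- The falling factorial is asymptotic to `n ^ S`, and `(1 - w / m) ^ n = ((1 - w / m) ^ m) ^ (n /
m)`; the missing exponent `S` contributes a factor tending to `1`. -/
theorem tendsto_exactModel_factor {lam : ℝ} (hm : Tendsto m atTop atTop)
    (hn : Tendsto n atTop atTop)
    (hmn : Tendsto (fun t => (n t : ℝ) / m t) atTop (𝓝 lam)) (w S : ℕ) :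
    Tendsto (fun t => ((n t).descFactorial S : ℝ) * ((m t : ℝ) - w) ^ (n t - S) / (m t : ℝ) ^ n t)
      atTop (𝓝 (lam ^ S * Real.exp (-w) ^ lam)) := by
  have h1 : Tendsto (fun t => ((n t).descFactorial S : ℝ) / (n t : ℝ) ^ S) atTop (𝓝 1) := by
    have h := (isEquivalent_descFactorial S)
    rw [Asymptotics.isEquivalent_iff_tendsto_one] at h
    · exact h.comp hn
    · filter_upwards [eventually_gt_atTop 0] with k hk
      positivity
  have h2 := hmn.pow S
  have hmR : Tendsto (fun t => (m t : ℝ)) atTop atTop := tendsto_natCast_atTop_atTop.comp hm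
  have h3 : Tendsto (fun t => 1 + -(w : ℝ) / m t) atTop (𝓝 1) := by
    simpa using (hmR.const_div_atTop (-(w : ℝ))).const_add 1
  have h4 : Tendsto (fun t => (1 + -(w : ℝ) / m t) ^ m t) atTop (𝓝 (Real.exp (-w))) :=
    (Real.tendsto_one_add_div_pow_exp (-(w : ℝ))).comp hm
  have h5 := h4.rpow hmn (Or.inl (Real.exp_ne_zero _))
  have h6 := h3.pow S
  have h7 := (h1.mul h2).mul (h5.div h6 (by simp))
  rw [one_mul, one_pow, div_one] at h7
  refine h7.congr' ?_
  simp only [Pi.div_apply]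
  filter_upwards [hm.eventually_gt_atTop w, hm.eventually_gt_atTop 0, hn.eventually_ge_atTop S,
    hn.eventually_gt_atTop 0] with t ht1 ht2 ht3 ht4
  have hm0 : (0 : ℝ) < m t := by exact_mod_cast ht2
  have hn0 : (0 : ℝ) < n t := by exact_mod_cast ht4
  have hw : (0 : ℝ) < m t - w := sub_pos.2 (by exact_mod_cast ht1)
  have hu : 1 + -(w : ℝ) / m t = (m t - w) / m t := by field_simp; ring
  have hup : 0 < 1 + -(w : ℝ) / m t := by rw [hu]; positivity
  rw [← Real.rpow_natCast (1 + -(w : ℝ) / m t) (m t), ← Real.rpow_mul hup.le,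
    mul_div_cancel₀ _ hm0.ne', Real.rpow_natCast, hu]
  obtain ⟨c, hc⟩ := Nat.exists_eq_add_of_le ht3
  have e1 : (((m t : ℝ) - w) / m t) ^ n t
      = (((m t : ℝ) - w) / m t) ^ S * (((m t : ℝ) - w) / m t) ^ c := by rw [hc, pow_add]
  have e2 : (m t : ℝ) ^ n t = (m t : ℝ) ^ S * (m t : ℝ) ^ c := by rw [hc, pow_add]
  rw [show n t - S = c by omega, e1, e2]
  simp only [div_pow]
  field_simp

end Limit

section Limit

variable {b : ℕ} {α : ℝ} {Ω : Type*} [MeasurableSpace Ω] {μ : Measure Ω}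
  {X : ℤ → Ω → ℕ} {m n : ℕ → ℕ}

/-- Local limit theorem for the numbers of keys in a window. -/
theorem tendsto_exactModel_keyCount [∀ t, NeZero (m t)] (h : IsPoissonTable b α μ X)
    (hα0 : 0 < α) (hm : Tendsto m atTop atTop) (hn : Tendsto n atTop atTop)
    (hmn : Tendsto (fun t => (n t : ℝ) / m t) atTop (𝓝 (b * α))) (a c : ℤ) (x : ℤ → ℕ) :
    Tendsto (fun t => (exactModel (m t) (n t)).real
        {k | ∀ d ∈ Finset.Ioc a c, keyCount k d = x d})
      atTop (𝓝 (μ.real {ω | ∀ d ∈ Finset.Ioc a c, X d ω = x d})) := by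
  have hlim := (tendsto_exactModel_factor hm hn hmn (Finset.Ioc a c).card
    (∑ d ∈ Finset.Ioc a c, x d)).const_mul (∏ d ∈ Finset.Ioc a c, ((x d).factorial : ℝ))⁻¹
  have heq : (∏ d ∈ Finset.Ioc a c, ((x d).factorial : ℝ))⁻¹ *
      ((b * α) ^ (∑ d ∈ Finset.Ioc a c, x d) *
        Real.exp (-((Finset.Ioc a c).card : ℝ)) ^ ((b : ℝ) * α))
      = μ.real {ω | ∀ d ∈ Finset.Ioc a c, X d ω = x d} := by
    rw [h.measure_eval hα0, Finset.prod_div_distrib, Finset.prod_mul_distrib, Finset.prod_const,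
      Finset.prod_pow_eq_pow_sum, ← Real.exp_mul, ← Real.exp_nat_mul, div_eq_inv_mul,
      mul_comm ((b * α) ^ _)]
    congr 3
    ring
  rw [heq] at hlim
  refine hlim.congr' ?_
  filter_upwards [hm.eventually_ge_atTop (c - a).toNat] with t ht
  exact (exactModel_keyCount (residue_injOn_Ioc (by omega)) x).symm

theorem FirstBlock.congr {x y : ℤ → ℕ} {a : ℤ} {k : ℕ}
    (hxy : ∀ d ∈ Finset.Ioc a (a + k), x d = y d) (h : FirstBlock b x a k) :
    FirstBlock b y a k := by
  have hs : ∀ j : ℕ, j ≤ k →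
      ∑ i ∈ Finset.Ioc a (a + j), x i = ∑ i ∈ Finset.Ioc a (a + j), y i := by
    intro j hj
    refine Finset.sum_congr rfl fun d hd => hxy d ?_
    rw [Finset.mem_Ioc] at hd ⊢
    omega
  refine ⟨h.1, fun j h1 h2 => ?_, ?_⟩
  · rw [← hs j h2.le]; exact h.2.1 j h1 h2
  · rw [← hs k le_rfl]; exact h.2.2

theorem NotFullUpTo.congr {x y : ℤ → ℕ} {a : ℤ} {L : ℕ}
    (hxy : ∀ d ∈ Finset.Ioc (a - L) a, x d = y d) (h : NotFullUpTo b x a L) :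
    NotFullUpTo b y a L := by
  intro l h1 h2
  have hs : ∑ i ∈ Finset.Ioc (a - l) a, x i = ∑ i ∈ Finset.Ioc (a - l) a, y i := by
    refine Finset.sum_congr rfl fun d hd => hxy d ?_
    rw [Finset.mem_Ioc] at hd ⊢
    omega
  rw [← hs]; exact h l h1 h2

/-- Bounds on the windows on either side of `a` bound each count, as `measure_eq_sum_localTables`
requires. -/
theorem FirstBlock.lt_of_notFullUpTo {x : ℤ → ℕ} {a : ℤ} {k L : ℕ}
    (h : FirstBlock b x a k) (hL : NotFullUpTo b x a L) {d : ℤ}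
    (hd : d ∈ Finset.Ioc (a - L) (a + k)) : x d < b * (L + k) := by
  rw [Finset.mem_Ioc] at hd
  rcases le_or_gt d a with hda | hda
  · have h1 := hL L (by omega) le_rfl
    have h2 : x d ≤ ∑ i ∈ Finset.Ioc (a - L) a, x i :=
      Finset.single_le_sum (f := x) (fun _ _ => Nat.zero_le _) (Finset.mem_Ioc.2 ⟨hd.1, hda⟩)
    have h3 : b * L ≤ b * (L + k) := Nat.mul_le_mul_left _ (by omega)
    omega
  · have h2 : x d ≤ ∑ i ∈ Finset.Ioc a (a + k), x i :=
      Finset.single_le_sum (f := x) (fun _ _ => Nat.zero_le _) (Finset.mem_Ioc.2 ⟨hda, hd.2⟩)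
    have h3 : b * k ≤ b * (L + k) := Nat.mul_le_mul_left _ (by omega)
    have := h.2.2
    omega

theorem tendsto_exactModel_firstBlock_notFullUpTo [IsProbabilityMeasure μ] [∀ t, NeZero (m t)]
    (h : IsPoissonTable b α μ X)
    (hα0 : 0 < α) (hm : Tendsto m atTop atTop) (hn : Tendsto n atTop atTop)
    (hmn : Tendsto (fun t => (n t : ℝ) / m t) atTop (𝓝 (b * α))) (a : ℤ) (k L : ℕ) :
    Tendsto (fun t => (exactModel (m t) (n t)).real
        {x | FirstBlock b (keyCount x) a k ∧ NotFullUpTo b (keyCount x) a L})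
      atTop (𝓝 (μ.real {ω | FirstBlock b (fun j => X j ω) a k ∧
        NotFullUpTo b (fun j => X j ω) a L})) := by
  set A : Set (ℤ → ℕ) := {x | FirstBlock b x a k ∧ NotFullUpTo b x a L} with hA
  set D := Finset.Ioc (a - L) (a + k) with hD
  have h1 : ∀ x y : ℤ → ℕ, (∀ d ∈ D, x d = y d) → x ∈ A → y ∈ A := by
    intro x y hxy hx
    refine ⟨hx.1.congr fun d hd => hxy d ?_, hx.2.congr fun d hd => hxy d ?_⟩ <;>
      rw [Finset.mem_Ioc] at hd <;> rw [hD, Finset.mem_Ioc] <;> omega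
  have h2 : ∀ x ∈ A, ∀ d ∈ D, x d < b * (L + k) := fun x hx d hd =>
    hx.1.lt_of_notFullUpTo hx.2 hd
  have h3 : μ.real {ω | FirstBlock b (fun j => X j ω) a k ∧ NotFullUpTo b (fun j => X j ω) a L}
      = _ := measure_eq_sum_localTables (μ := μ) (Y := fun ω j => X j ω) h.measurable_table h1 h2
  have h4 : ∀ t, (exactModel (m t) (n t)).real
      {x | FirstBlock b (keyCount x) a k ∧ NotFullUpTo b (keyCount x) a L} = _ := fun t =>
    measure_eq_sum_localTables (μ := exactModel (m t) (n t)) (Y := keyCount) .of_discrete h1 h2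
  rw [h3]
  simp only [h4]
  exact tendsto_finsetSum _ fun f _ => tendsto_exactModel_keyCount h hα0 hm hn hmn _ _ f

theorem IsPoissonTable.tendsto_firstBlock_notFullUpTo [IsProbabilityMeasure μ]
    (h : IsPoissonTable b α μ X) (hb : 0 < b) (a : ℤ) (k : ℕ) :
    Tendsto (fun L => μ.real {ω | FirstBlock b (fun j => X j ω) a k ∧
        NotFullUpTo b (fun j => X j ω) a L})
      atTop (𝓝 (μ.real {ω | FirstBlock b (fun j => X j ω) a k ∧
        ¬ IsFull b (fun j => X j ω) a})) := by
  have hS : ∀ L, MeasurableSet {x : ℤ → ℕ | NotFullUpTo b x a L} := by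
    intro L
    simp only [NotFullUpTo, Set.ofPred_forall]
    exact .iInter fun l => .iInter fun _ => .iInter fun _ =>
      measurableSet_lt (measurable_sum_eval _) measurable_const
  have h1 : {ω | FirstBlock b (fun j => X j ω) a k ∧ ¬ IsFull b (fun j => X j ω) a}
      = ⋂ L, {ω | FirstBlock b (fun j => X j ω) a k ∧ NotFullUpTo b (fun j => X j ω) a L} := by
    ext ω
    simp only [Set.mem_iInter, Set.mem_ofPred_eq, not_isFull_iff hb]
    exact ⟨fun h L => ⟨h.1, h.2 L⟩, fun h => ⟨(h 0).1, fun L => (h L).2⟩⟩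
  rw [h1]
  refine (ENNReal.tendsto_toReal (measure_ne_top _ _)).comp (tendsto_measure_iInter_atTop
    (fun L => ?_) (fun L L' hL ω hω => ⟨hω.1, fun l h1 h2 => hω.2 l h1 (h2.trans hL)⟩)
    ⟨0, measure_ne_top _ _⟩)
  exact (((LinearProbing.measurableSet_firstBlock b a k).inter (hS L)).preimage
    h.measurable_table).nullMeasurableSet

theorem tendsto_exactRate (hα0 : 0 < α)
    (hmn : Tendsto (fun t => (n t : ℝ) / m t) atTop (𝓝 (b * α))) :
    Tendsto (fun t => exactRate b α (m t) (n t)) atTop (𝓝 (decayRate b α)) := by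
  have h1 := pow_mul_exp_eq_decayRate (b := b) hα0 1
  rw [pow_one, pow_one, mul_one, mul_comm] at h1
  rw [← h1]
  exact ((Real.continuous_exp.tendsto _).comp (hmn.mul_const _)).const_mul _

/-- The truncation error is at most `ρ ^ (L + 1) / (1 - ρ)` for all large `t`, so the limits in `L`
and `t` may be exchanged by a three-epsilon argument. -/
theorem tendsto_exactModel_firstBlock [IsProbabilityMeasure μ] [∀ t, NeZero (m t)]
    (h : IsPoissonTable b α μ X) (hb : 0 < b)
    (hα0 : 0 < α) (hα1 : α < 1) (hm : Tendsto m atTop atTop) (hn : Tendsto n atTop atTop)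
    (hmn : Tendsto (fun t => (n t : ℝ) / m t) atTop (𝓝 (b * α)))
    (hlt : ∀ᶠ t in atTop, n t < b * m t) (a : ℤ) (k : ℕ) :
    Tendsto (fun t => (exactModel (m t) (n t)).real
        {x | FirstBlock b (keyCount x) a k ∧ ¬ IsFull b (keyCount x) a})
      atTop (𝓝 (μ.real {ω | FirstBlock b (fun j => X j ω) a k ∧
        ¬ IsFull b (fun j => X j ω) a})) := by
  obtain ⟨ρ, hρ1, hρ2⟩ := exists_between (decayRate_lt_one hb hα0 hα1)
  have hρ0 : 0 < ρ := (decayRate_pos b hα0).trans hρ1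
  have htail : Tendsto (fun L : ℕ => ρ ^ (L + 1) / (1 - ρ)) atTop (𝓝 0) := by
    have := ((tendsto_pow_atTop_nhds_zero_of_lt_one hρ0.le hρ2).comp
      (tendsto_add_atTop_nat 1)).div_const (1 - ρ)
    simpa using this
  rw [Metric.tendsto_nhds]
  intro ε hε
  obtain ⟨L, hL1, hL2⟩ := (((Metric.tendsto_nhds.1 (h.tendsto_firstBlock_notFullUpTo hb a k))
    (ε / 3) (by positivity)).and ((Metric.tendsto_nhds.1 htail) (ε / 3) (by positivity))).exists
  filter_upwards [Metric.tendsto_nhds.1 (tendsto_exactModel_firstBlock_notFullUpTo h hα0 hm hn hmn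
    a k L) (ε / 3) (by positivity), hlt, (tendsto_exactRate hα0 hmn).eventually_le_const hρ1]
    with t h1 h2 h3
  have h4 := exactModel_truncation hb hα0 hα1 h2 h3 hρ2 a k L
  rw [← Real.dist_eq, dist_comm] at h4
  rw [Real.dist_eq, sub_zero] at hL2
  have h5 := lt_of_abs_lt hL2
  refine lt_of_le_of_lt (dist_triangle4 _ _ _ _) (lt_of_lt_of_eq
    (add_lt_add (add_lt_add (h4.trans_lt h5) h1) hL1) (by ring))

/-- Convergence in law of the block length in the exact model. -/
theorem tendsto_exactModel_blockLength [IsProbabilityMeasure μ] [∀ t, NeZero (m t)]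
    (h : IsPoissonTable b α μ X) (hb : 0 < b)
    (hα0 : 0 < α) (hα1 : α < 1) (hm : Tendsto m atTop atTop) (hn : Tendsto n atTop atTop)
    (hmn : Tendsto (fun t => (n t : ℝ) / m t) atTop (𝓝 (b * α)))
    (hlt : ∀ᶠ t in atTop, n t < b * m t) (i : ℤ) (k : ℕ) :
    Tendsto (fun t => (exactModel (m t) (n t)).real {x | blockLength b (keyCount x) i = k})
      atTop (𝓝 (μ.real {ω | blockLength b (fun j => X j ω) i = k})) := by
  rw [measure_blockLength_eq_sum hb h.measurable_table (h.ae_walk hb hα0 hα1)]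
  refine (tendsto_finsetSum (Finset.range k) fun r _ => tendsto_exactModel_firstBlock h hb hα0 hα1
    hm hn hmn hlt (i - 1 - r) k).congr' ?_
  filter_upwards [hlt] with t ht
  exact (exactModel_blockLength_eq_sum hb ht i k).symm

/-- The weighted `ℓ¹` distance between the laws of the block lengths tends to `0`. -/
theorem tendsto_tsum_blockLength [IsProbabilityMeasure μ] [∀ t, NeZero (m t)]
    (h : IsPoissonTable b α μ X) (hb : 0 < b)
    (hα0 : 0 < α) (hα1 : α < 1) (hm : Tendsto m atTop atTop) (hn : Tendsto n atTop atTop)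
    (hmn : Tendsto (fun t => (n t : ℝ) / m t) atTop (𝓝 (b * α)))
    (hlt : ∀ᶠ t in atTop, n t < b * m t) (i : ℤ) (d : ℕ) {r : ℝ} (hr0 : 0 < r)
    (hr : decayRate b α * r < 1) :
    Tendsto (fun t => ∑' k : ℕ, |(exactModel (m t) (n t)).real
        {x | blockLength b (keyCount x) i = k}
        - μ.real {ω | blockLength b (fun j => X j ω) i = k}| * ((k + 1 : ℝ) ^ d * r ^ k))
      atTop (𝓝 0) := by
  -- With `ρ` between the limiting rate and `1 / r`, the exact rates are eventually at most `ρ`,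
  -- while `ρ r < 1` keeps the majorant summable.
  obtain ⟨ρ, hρ1, hρ2⟩ := exists_between ((lt_div_iff₀ hr0).2 hr)
  have hρ0 : 0 < ρ := (decayRate_pos b hα0).trans hρ1
  rw [lt_div_iff₀ hr0] at hρ2
  have hs1 := h.summable_blockLength hb hα0 hα1 i d hr0.le hr
  have hs2 := (summable_add_one_pow_mul_geometric (d + 1) (by positivity) hρ2).mul_left ρ⁻¹
  have key := tendsto_tsum_of_dominated_convergence (𝓕 := atTop)
    (f := fun t (k : ℕ) => |(exactModel (m t) (n t)).real
        {x | blockLength b (keyCount x) i = k}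
        - μ.real {ω | blockLength b (fun j => X j ω) i = k}| * ((k + 1 : ℝ) ^ d * r ^ k))
    (g := fun _ => 0) (hs2.add hs1) (fun k => ?_) ?_
  · simpa using key
  · have h1 := ((tendsto_exactModel_blockLength h hb hα0 hα1 hm hn hmn hlt i k).sub_const
      (μ.real {ω | blockLength b (fun j => X j ω) i = k})).abs.mul_const ((k + 1 : ℝ) ^ d * r ^ k)
    simpa using h1
  · filter_upwards [hlt, (tendsto_exactRate hα0 hmn).eventually_le_const hρ1] with t ht hρt k
    have hr' : 0 ≤ exactRate b α (m t) (n t) := by unfold exactRate; positivity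
    have hp : (exactModel (m t) (n t)).real {x | blockLength b (keyCount x) i = k}
        ≤ (k + 1) * (ρ⁻¹ * ρ ^ k) := by
      rcases k with _ | k
      · rw [exactModel_blockLength_zero hb ht]; positivity
      · refine (exactModel_blockLength_le hb hα0 hα1 ht i k).trans ?_
        have : ρ⁻¹ * ρ ^ (k + 1) = ρ ^ k := by
          rw [pow_succ', inv_mul_cancel_left₀ hρ0.ne']
        rw [this]
        have := pow_le_pow_left₀ hr' hρt k
        push_cast
        gcongr
        linarith
    rw [norm_mul, Real.norm_eq_abs, abs_abs, Real.norm_of_nonneg (by positivity)]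
    calc _ ≤ ((k + 1) * (ρ⁻¹ * ρ ^ k) + μ.real {ω | blockLength b (fun j => X j ω) i = k}) *
          ((k + 1 : ℝ) ^ d * r ^ k) := by
          gcongr
          refine (abs_sub _ _).trans ?_
          rw [abs_of_nonneg measureReal_nonneg, abs_of_nonneg measureReal_nonneg]
          gcongr
      _ = _ := by rw [mul_pow]; ring

end Limit

/-! ### From the weighted `ℓ¹` distance to expectations. -/

theorem norm_integral_comp_nat_sub_le {Ω Ω' E : Type*} [MeasurableSpace Ω] [MeasurableSpace Ω']
    [NormedAddCommGroup E] [NormedSpace ℝ E] [CompleteSpace E] {μ : Measure Ω} {ν : Measure Ω'}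
    [IsFiniteMeasure μ] [IsFiniteMeasure ν] {N : Ω → ℕ} {M : Ω' → ℕ} (hN : Measurable N)
    (hM : Measurable M) {w : ℕ → ℝ} (hw : ∀ k, 0 ≤ w k)
    (hμ : Summable fun k => μ.real {ω | N ω = k} * w k)
    (hν : Summable fun k => ν.real {ω | M ω = k} * w k) (f : ℕ → E) {C : ℝ}
    (hf : ∀ k, ‖f k‖ ≤ C * w k) :
    ‖∫ ω, f (N ω) ∂μ - ∫ ω, f (M ω) ∂ν‖
      ≤ C * ∑' k, |μ.real {ω | N ω = k} - ν.real {ω | M ω = k}| * w k := by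
  have hsum : ∀ p : ℕ → ℝ, (∀ k, 0 ≤ p k) → Summable (fun k => p k * w k) →
      Summable fun k => p k * ‖f k‖ := fun p hp h =>
    Summable.of_nonneg_of_le (fun k => mul_nonneg (hp k) (norm_nonneg _))
      (fun k => (mul_le_mul_of_nonneg_left (hf k) (hp k)).trans_eq (by ring)) (h.mul_left C)
  have h1 := (hasSum_integral_comp_nat hN f (hsum _ (fun _ => measureReal_nonneg) hμ)).sub
    (hasSum_integral_comp_nat hM f (hsum _ (fun _ => measureReal_nonneg) hν))
  simp only [← sub_smul] at h1
  have h2 : Summable fun k => |μ.real {ω | N ω = k} - ν.real {ω | M ω = k}| * w k := by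
    refine (hμ.sub hν).abs.congr fun k => ?_
    rw [← sub_mul, abs_mul, abs_of_nonneg (hw k)]
  rw [← h1.tsum_eq, ← tsum_mul_left]
  refine tsum_of_norm_bounded (h2.mul_left C).hasSum fun k => ?_
  rw [norm_smul, Real.norm_eq_abs]
  exact (mul_le_mul_of_nonneg_left (hf k) (abs_nonneg _)).trans_eq (by ring)

section Limit

variable {b : ℕ} {α : ℝ} {Ω : Type*} [MeasurableSpace Ω] {μ : Measure Ω} [IsProbabilityMeasure μ]
  {X : ℤ → Ω → ℕ} {m n : ℕ → ℕ} [∀ t, NeZero (m t)]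

theorem IsPoissonTable.norm_integral_exactModel_sub_le {E : Type*} [NormedAddCommGroup E]
    [NormedSpace ℝ E] [CompleteSpace E] (h : IsPoissonTable b α μ X) (hb : 0 < b)
    (hα0 : 0 < α) (hα1 : α < 1) (i : ℤ) (d : ℕ) {r : ℝ} (hr0 : 0 < r)
    (hr : decayRate b α * r < 1) (f : ℕ → E) {C : ℝ}
    (hf : ∀ k : ℕ, ‖f k‖ ≤ C * ((k + 1 : ℝ) ^ d * r ^ k)) (M N : ℕ) [NeZero M] :
    ‖∫ x, f (blockLength b (keyCount x) i) ∂exactModel M N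
        - ∫ ω, f (blockLength b (fun j => X j ω) i) ∂μ‖
      ≤ C * ∑' k : ℕ, |(exactModel M N).real {x | blockLength b (keyCount x) i = k}
        - μ.real {ω | blockLength b (fun j => X j ω) i = k}| * ((k + 1 : ℝ) ^ d * r ^ k) := by
  refine norm_integral_comp_nat_sub_le .of_discrete (h.measurable_blockLength hb i)
    (fun k => by positivity) ?_ ?_ f hf
  · have h1 := (integrable_comp_nat_iff (μ := exactModel M N)
      (N := fun x => blockLength b (keyCount x) i) .of_discrete
      (fun k : ℕ => (k + 1 : ℝ) ^ d * r ^ k)).1 .of_finite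
    refine h1.congr fun k => ?_
    rw [Real.norm_of_nonneg (by positivity)]
  · exact (h.summable_blockLength hb hα0 hα1 i d hr0.le hr).congr fun k => by ring

/-- The weight `r ^ k` dominates `q ^ k` on the whole closed disc, so one `ℓ¹` distance bounds the
error uniformly in `q`. -/
theorem IsPoissonTable.tendstoUniformlyOn_exactModel_pgf (h : IsPoissonTable b α μ X) (hb : 0 < b)
    (hα0 : 0 < α) (hα1 : α < 1) (hm : Tendsto m atTop atTop) (hn : Tendsto n atTop atTop)
    (hmn : Tendsto (fun t => (n t : ℝ) / m t) atTop (𝓝 (b * α)))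
    (hlt : ∀ᶠ t in atTop, n t < b * m t) (i : ℤ) {r : ℝ} (hr0 : 0 < r)
    (hr : decayRate b α * r < 1) :
    TendstoUniformlyOn
      (fun t (q : ℂ) => ∫ x, q ^ blockLength b (keyCount x) i ∂exactModel (m t) (n t))
      (fun q => ∫ ω, q ^ blockLength b (fun j => X j ω) i ∂μ) atTop (Metric.closedBall 0 r) := by
  rw [Metric.tendstoUniformlyOn_iff]
  intro ε hε
  filter_upwards [(tendsto_tsum_blockLength h hb hα0 hα1 hm hn hmn hlt i 0 hr0 hr).eventually_lt_const
    hε] with t ht q hq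
  rw [mem_closedBall_zero_iff] at hq
  rw [dist_comm, dist_eq_norm]
  refine (h.norm_integral_exactModel_sub_le hb hα0 hα1 i 0 hr0 hr (fun k => q ^ k) (C := 1)
    (fun k => ?_) (m t) (n t)).trans_lt (by rwa [one_mul])
  rw [norm_pow, one_mul, pow_zero, one_mul]
  exact pow_le_pow_left₀ (norm_nonneg q) hq k

theorem IsPoissonTable.tendsto_exactModel_integral (h : IsPoissonTable b α μ X) (hb : 0 < b)
    (hα0 : 0 < α) (hα1 : α < 1) (hm : Tendsto m atTop atTop) (hn : Tendsto n atTop atTop)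
    (hmn : Tendsto (fun t => (n t : ℝ) / m t) atTop (𝓝 (b * α)))
    (hlt : ∀ᶠ t in atTop, n t < b * m t) (i : ℤ) (d : ℕ) (f : ℕ → ℝ) {C : ℝ}
    (hf : ∀ k : ℕ, ‖f k‖ ≤ C * (k + 1 : ℝ) ^ d) :
    Tendsto (fun t => ∫ x, f (blockLength b (keyCount x) i) ∂exactModel (m t) (n t)) atTop
      (𝓝 (∫ ω, f (blockLength b (fun j => X j ω) i) ∂μ)) := by
  have hr : decayRate b α * 1 < 1 := by rw [mul_one]; exact decayRate_lt_one hb hα0 hα1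
  rw [tendsto_iff_norm_sub_tendsto_zero]
  refine squeeze_zero (fun _ => norm_nonneg _) (fun t => h.norm_integral_exactModel_sub_le hb hα0
    hα1 i d one_pos hr f (by simpa using hf) (m t) (n t)) ?_
  simpa using (tendsto_tsum_blockLength h hb hα0 hα1 hm hn hmn hlt i d one_pos hr).const_mul C

theorem IsPoissonTable.integrable_blockLength_pow (h : IsPoissonTable b α μ X) (hb : 0 < b)
    (hα0 : 0 < α) (hα1 : α < 1) (i : ℤ) (r : ℕ) :
    Integrable (fun ω => (blockLength b (fun j => X j ω) i : ℝ) ^ r) μ := by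
  refine (integrable_comp_nat_iff (h.measurable_blockLength hb i) (fun k : ℕ => (k : ℝ) ^ r)).2 ?_
  refine Summable.of_nonneg_of_le (fun k => by positivity) (fun k => ?_)
    (h.summable_blockLength hb hα0 hα1 i r zero_le_one
      (by rw [mul_one]; exact decayRate_lt_one hb hα0 hα1))
  rw [one_pow, mul_one, mul_comm, norm_pow, Real.norm_natCast]
  gcongr
  linarith

theorem IsPoissonTable.tendstoInDistribution_exactModel (h : IsPoissonTable b α μ X) (hb : 0 < b)
    (hα0 : 0 < α) (hα1 : α < 1) (hm : Tendsto m atTop atTop) (hn : Tendsto n atTop atTop)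
    (hmn : Tendsto (fun t => (n t : ℝ) / m t) atTop (𝓝 (b * α)))
    (hlt : ∀ᶠ t in atTop, n t < b * m t) (i : ℤ) :
    TendstoInDistribution
      (fun t (x : Fin (n t) → Fin (m t)) => blockLength b (keyCount x) i) atTop
      (fun ω => blockLength b (fun j => X j ω) i) (fun t => exactModel (m t) (n t)) μ := by
  refine ⟨fun t => Measurable.of_discrete.aemeasurable, (h.measurable_blockLength hb i).aemeasurable,
    ?_⟩
  refine ProbabilityMeasure.tendsto_iff_forall_integral_tendsto.2 fun f => ?_
  have h1 := h.tendsto_exactModel_integral hb hα0 hα1 hm hn hmn hlt i 0 f (C := ‖f‖)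
    fun k => by simpa using f.norm_coe_le_norm k
  simp only [ProbabilityMeasure.coe_mk]
  rw [integral_map (h.measurable_blockLength hb i).aemeasurable .of_discrete]
  refine h1.congr fun t => ?_
  rw [integral_map Measurable.of_discrete.aemeasurable .of_discrete]

end Limit

end LinearProbing

/-! ### Assembly of the theorem. -/

theorem mainTheorem7 (b : ℕ) (hb : 0 < b) (α : ℝ) (hα0 : 0 < α) (hα1 : α < 1)
    {Ω : Type*} [MeasurableSpace Ω] (μ : Measure Ω) [IsProbabilityMeasure μ]
    -- the infinite Poisson model
    (X : ℤ → Ω → ℕ) (hX : ∀ i, Measurable (X i)) (hindep : iIndepFun X μ)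
    (hlaw : ∀ i, μ.map (X i) = poissonMeasure (b * α).toNNReal) :
    let B : Ω → ℕ := fun ω => firstBlockLength b (fun i => X i ω)
    let Bhat : ℤ → Ω → ℕ := fun i ω => blockLength b (fun j => X j ω) i
    let ψB : ℂ → ℂ := fun q => ∫ ω, q ^ B ω ∂μ
    let ψBhat : ℤ → ℂ → ℂ := fun i q => ∫ ω, q ^ Bhat i ω ∂μ
    let R : ℝ := (Real.exp (α - 1) / α) ^ b
    -- both lengths are almost surely well defined, and `B` has finite mean
    (∀ᵐ ω ∂μ, 0 < B ω) ∧ (∀ i, ∀ᵐ ω ∂μ, 0 < Bhat i ω) ∧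
    Integrable (fun ω => (B ω : ℝ)) μ ∧
    -- the size-biased distribution
    (∀ (i : ℤ) (k : ℕ),
      μ.real {ω | Bhat i ω = k} = k * μ.real {ω | B ω = k} / ∫ ω, (B ω : ℝ) ∂μ ∧
      (μ.real {ω | Bhat i ω = k} : ℂ) = T0 b α * k * μ.real {ω | B ω = k}) ∧
    -- the probability generating function
    1 < R ∧
    (∀ (i : ℤ) (q : ℂ), ‖q‖ < R →
      Integrable (fun ω => q ^ B ω) μ ∧ Integrable (fun ω => q ^ Bhat i ω) μ ∧
      DifferentiableAt ℂ ψB q ∧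
      ψBhat i q = T0 b α * q * deriv ψB q ∧
      (q ≠ 0 → ∀ root : ℂ → ℂ, ContinuousAt root q → (∀ᶠ z in 𝓝 q, root z ^ b = z) →
        (∀ l < b, DifferentiableAt ℂ (zeta b α root l) q) ∧
        ψBhat i q = T0 b α * q * ∑ l ∈ Finset.range b,
          deriv (zeta b α root l) q * ∏ j ∈ (Finset.range b).erase l, (1 - zeta b α root j q))) ∧
    -- convergence of the exact model
    ∃ δ : ℝ, 0 < δ ∧ 1 + δ < R ∧
      ∀ (i : ℤ) (m n : ℕ → ℕ) [∀ t, NeZero (m t)],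
        Tendsto m atTop atTop → Tendsto n atTop atTop →
        Tendsto (fun t => (n t : ℝ) / (b * m t)) atTop (𝓝 α) →
        TendstoInDistribution
          (fun t (h : Fin (n t) → Fin (m t)) => blockLength b (keyCount h) i) atTop (Bhat i)
          (fun t => exactModel (m t) (n t)) μ ∧
        (∀ r : ℕ, Integrable (fun ω => (Bhat i ω : ℝ) ^ r) μ ∧
          Tendsto (fun t => ∫ h, (blockLength b (keyCount h) i : ℝ) ^ r ∂exactModel (m t) (n t))
            atTop (𝓝 (∫ ω, (Bhat i ω : ℝ) ^ r ∂μ))) ∧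
        TendstoUniformlyOn
          (fun t (q : ℂ) => ∫ h, q ^ blockLength b (keyCount h) i ∂exactModel (m t) (n t))
          (ψBhat i) atTop (Metric.closedBall 0 (1 + δ)) := by
  have h : IsPoissonTable b α μ X := ⟨hX, hindep, hlaw⟩
  intro B Bhat ψB ψBhat R
  have hR : (decayRate b α)⁻¹ = R := inv_decayRate b α
  have hd0 := decayRate_pos b hα0
  have hd1 := decayRate_lt_one hb hα0 hα1
  have hR1 : 1 < R := hR ▸ (one_lt_inv₀ hd0).2 hd1
  have hT := h.measure_not_isFull hb hα0 hα1
  obtain ⟨hint, hmean⟩ := h.integral_firstBlockLength hb hα0 hα1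
  -- The choice `δ = (R - 1) / 2` puts `1 + δ` midway between `1` and `R`, independently of the
  -- sequences.
  refine ⟨h.ae_firstBlockLength_pos hb hα0 hα1, fun i => h.ae_blockLength_pos hb hα0 hα1 i, hint,
    fun i k => ⟨?_, ?_⟩, hR1, fun i q hq => ?_, (R - 1) / 2, by linarith, by linarith,
    fun i m n _ hm hn hmn => ?_⟩
  · rw [eq_div_iff (right_ne_zero_of_mul_eq_one hmean)]
    refine (congrArg (· * ∫ ω, (B ω : ℝ) ∂μ) (h.measure_blockLength hb hα0 hα1 i k)).trans ?_
    exact (mul_right_comm _ _ _).trans ((congrArg (· * _) hmean).trans (one_mul _))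
  · rw [h.measure_blockLength hb hα0 hα1 i k, ← hT]
    push_cast
    ring
  · have hq' : decayRate b α * ‖q‖ < 1 := by
      rwa [← hR, inv_eq_one_div, lt_div_iff₀' hd0] at hq
    have hderiv := h.hasDerivAt_pgf_firstBlockLength hb hα0 hα1 (hR.symm ▸ hq)
    obtain ⟨hint', hpgf⟩ := h.pgf_blockLength hb hα0 hα1 i hq'
    rw [← hderiv.deriv, hT] at hpgf
    refine ⟨(h.pgf_firstBlockLength hb hα0 hα1 hq').1, hint', hderiv.differentiableAt, hpgf,
      fun hq0 root hcont hroot => ⟨fun l _ =>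
        (hasDerivAt_zeta hb hα0 hq0 hcont hroot hq' l).differentiableAt, ?_⟩⟩
    rw [← h.deriv_pgf hb hα0 hα1 hq0 hcont hroot hq']
    exact hpgf
  · have hb' : (0 : ℝ) < b := by exact_mod_cast hb
    have hmn' : Tendsto (fun t => (n t : ℝ) / m t) atTop (𝓝 (b * α)) := by
      refine (hmn.const_mul (b : ℝ)).congr fun t => ?_
      rw [← mul_div_assoc, mul_div_mul_left _ _ hb'.ne']
    -- As `α < 1`, overfull tables, where the block length has no meaning, do not occur for large
    -- `t`.
    have hlt : ∀ᶠ t in atTop, n t < b * m t := by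
      filter_upwards [hmn.eventually_lt_const hα1] with t ht
      have hm0 : (0 : ℝ) < m t := by exact_mod_cast Nat.pos_of_ne_zero (NeZero.ne (m t))
      rw [div_lt_one (by positivity)] at ht
      exact_mod_cast ht
    have hδ : decayRate b α * (1 + (R - 1) / 2) < 1 := by
      have : 1 + (R - 1) / 2 < (decayRate b α)⁻¹ := by rw [hR]; linarith
      calc _ < decayRate b α * (decayRate b α)⁻¹ := mul_lt_mul_of_pos_left this hd0
        _ = 1 := mul_inv_cancel₀ hd0.ne'
    refine ⟨h.tendstoInDistribution_exactModel hb hα0 hα1 hm hn hmn' hlt i, fun r =>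
      ⟨h.integrable_blockLength_pow hb hα0 hα1 i r, ?_⟩,
      h.tendstoUniformlyOn_exactModel_pgf hb hα0 hα1 hm hn hmn' hlt i (by linarith) hδ⟩
    refine h.tendsto_exactModel_integral hb hα0 hα1 hm hn hmn' hlt i r (fun k => (k : ℝ) ^ r)
      (C := 1) fun k => ?_
    rw [one_mul, norm_pow, Real.norm_natCast]
    gcongr
    linarith
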